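/- Let $(M,\eta)$ be a contact manifold: $M$ is a smooth (Hausdorff, second countable) manifold of dimension $2n+1$ and $\eta$ a smooth $1$-form such that $\eta\wedge(\mathrm d\eta)^n$ vanishes nowhere. Let $\flat(v)=\iota_v\mathrm d\eta+\eta(v)\eta$, $\sharp=\flat^{-1}$, let $\mathcal R=\sharp\eta$ be the Reeb field, $\Lambda(\alpha,\beta)=-\mathrm d\eta(\sharp\alpha,\sharp\beta)$, and $\sharp_\Lambda(\alpha)=\Lambda(\alpha,\cdot)$. For a subspace $\Delta\subseteq T_xM$ with annihilator $\Delta^\circ$, the contact complement is $\Delta^{\perp}=\sharp_\Lambda(\Delta^\circ)$. An embedded submanifold $S$ is coisotropic if $TS^{\perp}\subseteq TS$ and Legendrian if $TS=TS^{\perp}$; an immersion $f:P\to M$ is Legendrian if $\mathrm df(T_pP)=\mathrm df(T_pP)^{\perp}$ for all $p\in P$, and the image of such an immersion (not necessarily injective, $P$ Hausdorff and second countable) is called an immersed Legendrian submanifold. Let $\iota:N\hookrightarrow M$ be a nonempty coisotropic embedded submanifold without horizontal points (at no $x\in N$ is $T_xN\subseteq\ker\eta_x$). Assume that the quotient $\tilde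 N$ of $N$ by the characteristic distribution $TN^{\perp}$ is a manifold, that is, $\tilde N$ is a smooth (Hausdorff, second countable) manifold and $\pi:N\to\tilde N$ is a surjective smooth submersion whose fibres are connected and satisfy $\ker T_x\pi=(T_xN)^{\perp}$ for all $x\in N$. Call a smooth $1$-form $\tilde\eta$ on $\tilde N$ a reduced form with factor $f$ if $f$ is a nowhere vanishing smooth function on $N$ and $\pi^*\tilde\eta=f\,\iota^*\eta$. Let $L\subseteq M$ be a Legendrian submanifold that meets $N$ cleanly: $N\cap L$ is an embedded submanifold (possibly with components of different dimensions) and $T(N\cap L)=TN\cap TL$. Then: 1. There is a reduced form on $\tilde N$, with some factor $f$. If every point of $N$ is vertical, that is, $T_xN=(T_xN\cap\ker\eta_x)\oplus\langle\mathcal R_x\rangle$ for all $x\in N$, then there is exactly one $1$-form $\tilde\eta$ on $\tilde N$ with $\pi^*\tilde\eta=\iota^*\eta$ (a reduced form with factor $1$). 2. For every reduced form $\tilde\eta$ on $\tilde N$ (in particular for every $\tilde\eta$ with $\pi^*\tilde\eta=\iota^*\eta$), $(\tilde N,\tilde\eta)$ is a contact manifold and $\tilde L=\pi(L\cap N)$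 is an immersed Legendrian submanifold of $(\tilde N,\tilde\eta)$. If $\tilde L$ is an embedded submanifold of $\tilde N$, then it is a Legendrian submanifold of $(\tilde N,\tilde\eta)$. -/

import Mathlib

open scoped Manifold ContDiff Topology

noncomputable section

namespace ContactReduction

/-! ### Linear algebra of one tangent space

`V` is a tangent space, `η` the value of the contact form and `Ω` the value of `dη`. -/

section Linear

variable {V : Type*} [AddCommGroup V] [Module ℝ V]

/-- Up to a positive constant factor, the value of `η ∧ Ω ∧ ... ∧ Ω` (`n` factors `Ω`)
at the vectors `v 0, ..., v (2 n)`. -/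
def wedgePow (n : ℕ) (η : Module.Dual ℝ V) (Ω : V →ₗ[ℝ] V →ₗ[ℝ] ℝ)
    (v : Fin (2 * n + 1) → V) : ℝ :=
  ∑ σ : Equiv.Perm (Fin (2 * n + 1)), ((Equiv.Perm.sign σ : ℤ) : ℝ) *
    (η (v (σ ⟨0, by omega⟩)) *
      ∏ i : Fin n, Ω (v (σ ⟨2 * (i : ℕ) + 1, by omega⟩)) (v (σ ⟨2 * (i : ℕ) + 2, by omega⟩)))

/-- `♭ v = ι_v Ω + η(v) η`. -/
def flat (η : Module.Dual ℝ V) (Ω : V →ₗ[ℝ] V →ₗ[ℝ] ℝ) : V →ₗ[ℝ] Module.Dual ℝ V :=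
  Ω + LinearMap.smulRight η η

open Classical in
/-- `♯ = ♭⁻¹` (with value `0` if `♭` is not invertible, which does not happen for contact forms). -/
def sharp (η : Module.Dual ℝ V) (Ω : V →ₗ[ℝ] V →ₗ[ℝ] ℝ) : Module.Dual ℝ V →ₗ[ℝ] V :=
  if h : Function.Bijective (flat η Ω) then
    ((LinearEquiv.ofBijective (flat η Ω) h).symm : Module.Dual ℝ V →ₗ[ℝ] V)
  else 0

/-- The Reeb vector, `♭ R = η`. -/
def reeb (η : Module.Dual ℝ V) (Ω : V →ₗ[ℝ] V →ₗ[ℝ] ℝ) : V := sharp η Ω η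

/-- The bivector `Λ(α, β) = - Ω(♯α, ♯β)`. -/
def bivector (η : Module.Dual ℝ V) (Ω : V →ₗ[ℝ] V →ₗ[ℝ] ℝ) :
    Module.Dual ℝ V →ₗ[ℝ] Module.Dual ℝ V →ₗ[ℝ] ℝ :=
  -(Ω.compl₁₂ (sharp η Ω) (sharp η Ω))

variable [Module.Finite ℝ V]

/-- `♯_Λ α = Λ(α, ·)`, an element of the bidual of `V`, read as a vector. -/
def sharpLambda (η : Module.Dual ℝ V) (Ω : V →ₗ[ℝ] V →ₗ[ℝ] ℝ) : Module.Dual ℝ V →ₗ[ℝ] V :=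
  ((Module.evalEquiv ℝ V).symm : Module.Dual ℝ (Module.Dual ℝ V) →ₗ[ℝ] V) ∘ₗ bivector η Ω

/-- The contact complement `Δ^⊥ = ♯_Λ(Δ°)`. -/
def complement (η : Module.Dual ℝ V) (Ω : V →ₗ[ℝ] V →ₗ[ℝ] ℝ) (Δ : Submodule ℝ V) :
    Submodule ℝ V :=
  Δ.dualAnnihilator.map (sharpLambda η Ω)

end Linear

/-! ### One-forms and contact forms on manifolds -/

/-- The model space `ℝ^m`. -/
abbrev Euc (m : ℕ) : Type := EuclideanSpace ℝ (Fin m)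

instance tangentSpaceFinite {m : ℕ} {M : Type*} [TopologicalSpace M] [ChartedSpace (Euc m) M]
    (x : M) : Module.Finite ℝ (TangentSpace (𝓡 m) x) :=
  inferInstanceAs (Module.Finite ℝ (Euc m))

section Forms

variable {m : ℕ} {M : Type*} [TopologicalSpace M] [ChartedSpace (Euc m) M]

/-- The expression of the one-form `η` in the chart at `x₀`: the pullback of `η` by the inverse
of that chart. -/
def chartForm (η : ∀ x : M, TangentSpace (𝓡 m) x →L[ℝ] ℝ) (x₀ : M) (e : Euc m) :
    Euc m →L[ℝ] ℝ :=
  (η ((extChartAt (𝓡 m) x₀).symm e)).comp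
    (mfderiv 𝓘(ℝ, Euc m) (𝓡 m) (extChartAt (𝓡 m) x₀).symm e)

/-- `η` is a smooth one-form. -/
def IsSmoothForm (η : ∀ x : M, TangentSpace (𝓡 m) x →L[ℝ] ℝ) : Prop :=
  ∀ x₀ : M, ContDiffOn ℝ ∞ (chartForm η x₀) (extChartAt (𝓡 m) x₀).target

/-- The derivative `A` of the chart expression of `η` at the point `x`, in the chart at `x`. -/
def chartDeriv (η : ∀ x : M, TangentSpace (𝓡 m) x →L[ℝ] ℝ) (x : M) :
    Euc m →L[ℝ] Euc m →L[ℝ] ℝ :=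
  fderiv ℝ (chartForm η x) (extChartAt (𝓡 m) x x)

/-- The exterior derivative of a one-form: `dη(v, w) = A(v)(w) - A(w)(v)` in the chart at `x`. -/
def extD (η : ∀ x : M, TangentSpace (𝓡 m) x →L[ℝ] ℝ) (x : M) :
    TangentSpace (𝓡 m) x →ₗ[ℝ] TangentSpace (𝓡 m) x →ₗ[ℝ] ℝ :=
  (LinearMap.mk₂ ℝ (fun v w : Euc m => chartDeriv η x v w - chartDeriv η x w v)
    (by intros; simp; ring) (by intros; simp; ring)
    (by intros; simp; ring) (by intros; simp; ring)).compl₁₂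
    (mfderiv (𝓡 m) 𝓘(ℝ, Euc m) (extChartAt (𝓡 m) x) x).toLinearMap
    (mfderiv (𝓡 m) 𝓘(ℝ, Euc m) (extChartAt (𝓡 m) x) x).toLinearMap

/-- `η` is a contact form: `M` has odd dimension `2 n + 1`, `η` is a smooth one-form, and
`η ∧ (dη)^n` vanishes at no point. -/
def IsContactForm (η : ∀ x : M, TangentSpace (𝓡 m) x →L[ℝ] ℝ) : Prop :=
  IsSmoothForm η ∧ ∃ n : ℕ, m = 2 * n + 1 ∧
    ∀ x : M, ∃ v : Fin (2 * n + 1) → TangentSpace (𝓡 m) x,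
      wedgePow n (η x).toLinearMap (extD η x) v ≠ 0

/-- The contact complement of a subspace of `T_x M`. -/
def contactCompl (η : ∀ x : M, TangentSpace (𝓡 m) x →L[ℝ] ℝ) (x : M)
    (Δ : Submodule ℝ (TangentSpace (𝓡 m) x)) : Submodule ℝ (TangentSpace (𝓡 m) x) :=
  complement (η x).toLinearMap (extD η x) Δ

/-- `Δ ⊆ T_x M` is horizontal: `Δ = Δ ∩ ker η`. -/
def IsHorizontal (η : ∀ x : M, TangentSpace (𝓡 m) x →L[ℝ] ℝ) (x : M)
    (Δ : Submodule ℝ (TangentSpace (𝓡 m) x)) : Prop :=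
  Δ = Δ ⊓ LinearMap.ker (η x).toLinearMap

/-- `Δ ⊆ T_x M` is vertical: `Δ = (Δ ∩ ker η) ⊕ ⟨R⟩` (the sum is direct since `η(R) = 1`). -/
def IsVertical (η : ∀ x : M, TangentSpace (𝓡 m) x →L[ℝ] ℝ) (x : M)
    (Δ : Submodule ℝ (TangentSpace (𝓡 m) x)) : Prop :=
  Δ = (Δ ⊓ LinearMap.ker (η x).toLinearMap) ⊔ Submodule.span ℝ {reeb (η x).toLinearMap (extD η x)}

/-! ### Submanifolds -/

/-- `S` is an embedded submanifold of `M`: near each of its points it is a linear slice in some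
smooth chart of `M`. Its components may have different dimensions. -/
def IsSubmanifold (m : ℕ) {M : Type*} [TopologicalSpace M] [ChartedSpace (Euc m) M]
    (S : Set M) : Prop :=
  ∀ x ∈ S, ∃ φ ∈ IsManifold.maximalAtlas (𝓡 m) ∞ M, x ∈ φ.source ∧
    ∃ W : Submodule ℝ (Euc m), ∀ y ∈ φ.source, y ∈ S ↔ φ y ∈ W

/-- The tangent space `T_x S`, spanned by the velocities at `x` of the smooth curves in `S`
(for a submanifold these velocities already form a subspace). -/
def tangentTo (m : ℕ) {M : Type*} [TopologicalSpace M] [ChartedSpace (Euc m) M]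
    (S : Set M) (x : M) : Submodule ℝ (TangentSpace (𝓡 m) x) :=
  Submodule.span ℝ {v | ∃ γ : ℝ → M, γ 0 = x ∧ ContMDiffAt 𝓘(ℝ, ℝ) (𝓡 m) ∞ γ 0 ∧
    (∀ᶠ t in 𝓝 (0 : ℝ), γ t ∈ S) ∧
    HasMFDerivAt 𝓘(ℝ, ℝ) (𝓡 m) γ 0 (ContinuousLinearMap.toSpanSingleton ℝ v)}

/-- `S` is a Legendrian (embedded) submanifold: `T S = (T S)^⊥`. -/
def IsLegendrian (η : ∀ x : M, TangentSpace (𝓡 m) x →L[ℝ] ℝ) (S : Set M) : Prop :=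
  IsSubmanifold m S ∧ ∀ x ∈ S, tangentTo m S x = contactCompl η x (tangentTo m S x)

/-- `S` is a Legendrian immersed submanifold: the image of an immersion `f` of a manifold `P`
such that the subspaces `df(T_p P)` are equal to their contact complements. -/
def IsImmersedLegendrian (η : ∀ x : M, TangentSpace (𝓡 m) x →L[ℝ] ℝ) (S : Set M) : Prop :=
  ∃ (k : ℕ) (P : Type) (_ : TopologicalSpace P) (_ : ChartedSpace (Euc k) P),
    m = 2 * k + 1 ∧ IsManifold (𝓡 k) ∞ P ∧ T2Space P ∧ SecondCountableTopology P ∧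
    ∃ f : P → M, Manifold.IsImmersion (𝓡 k) (𝓡 m) ∞ f ∧ Set.range f = S ∧
      ∀ p : P, LinearMap.range (mfderiv (𝓡 k) (𝓡 m) f p).toLinearMap =
        contactCompl η (f p) (LinearMap.range (mfderiv (𝓡 k) (𝓡 m) f p).toLinearMap)

end Forms

/-! ### Coisotropic submanifolds and their reduction -/

section Reduction

variable {m d r : ℕ}
  {M : Type*} [TopologicalSpace M] [ChartedSpace (Euc m) M]
  {N : Type*} [TopologicalSpace N] [ChartedSpace (Euc d) N]
  {Q : Type*} [TopologicalSpace Q] [ChartedSpace (Euc r) Q]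

/-- The tangent space of the submanifold `ι : N → M` at `ι x`, as a subspace of `T_{ι x} M`. -/
def tangentOf (ι : N → M) (x : N) : Submodule ℝ (TangentSpace (𝓡 m) (ι x)) :=
  LinearMap.range (mfderiv (𝓡 d) (𝓡 m) ι x).toLinearMap

/-- The submanifold `ι : N → M` is coisotropic: `(T N)^⊥ ⊆ T N`. -/
def IsCoisotropic (η : ∀ x : M, TangentSpace (𝓡 m) x →L[ℝ] ℝ) (ι : N → M) : Prop :=
  Manifold.IsSmoothEmbedding (𝓡 d) (𝓡 m) ∞ ι ∧
    ∀ x : N, contactCompl η (ι x) (tangentOf (d := d) ι x) ≤ tangentOf (d := d) ι x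

/-- The characteristic distribution `(T N)^⊥` of a coisotropic submanifold, as a distribution
on `N`. -/
def charDistribution (η : ∀ x : M, TangentSpace (𝓡 m) x →L[ℝ] ℝ) (ι : N → M) (x : N) :
    Submodule ℝ (TangentSpace (𝓡 d) x) :=
  (contactCompl η (ι x) (tangentOf (d := d) ι x)).comap (mfderiv (𝓡 d) (𝓡 m) ι x).toLinearMap

/-- `π : N → Q` is the projection onto the manifold of leaves of the distribution `D`:
a smooth submersion onto `Q` whose fibres are connected and everywhere tangent to `D` (of full
dimension), that is, are the leaves of `D`. -/
structure IsLeafQuotient (D : ∀ x : N, Submodule ℝ (TangentSpace (𝓡 d) x)) (π : N → Q) :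
    Prop where
  submersion : Manifold.IsSubmersion (𝓡 d) (𝓡 r) ∞ π
  connected_fibre : ∀ q : Q, IsConnected (π ⁻¹' {q})
  ker_eq : ∀ x : N, LinearMap.ker (mfderiv (𝓡 d) (𝓡 r) π x).toLinearMap = D x

/-- `N` and `L` intersect cleanly: `N ∩ L` is a submanifold and `T(N ∩ L) = T N ∩ T L`. -/
def CleanIntersection (m : ℕ) {M : Type*} [TopologicalSpace M] [ChartedSpace (Euc m) M]
    {d : ℕ} {N : Type*} [TopologicalSpace N] [ChartedSpace (Euc d) N]
    (ι : N → M) (L : Set M) : Prop :=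
  IsSubmanifold m (Set.range ι ∩ L) ∧
    ∀ x : N, ι x ∈ L →
      tangentTo m (Set.range ι ∩ L) (ι x) = tangentOf (d := d) ι x ⊓ tangentTo m L (ι x)

/-- `ηQ` is a smooth one-form on `Q` with `π^* ηQ = f · ι^* η`, where `f` is a nowhere vanishing
smooth function on `N`. -/
structure IsReducedForm (η : ∀ x : M, TangentSpace (𝓡 m) x →L[ℝ] ℝ) (ι : N → M) (π : N → Q)
    (f : N → ℝ) (ηQ : ∀ q : Q, TangentSpace (𝓡 r) q →L[ℝ] ℝ) : Prop where
  smooth : IsSmoothForm ηQ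
  smooth_factor : ContMDiff (𝓡 d) 𝓘(ℝ, ℝ) ∞ f
  factor_ne_zero : ∀ x : N, f x ≠ 0
  pullback_eq : ∀ x : N, (ηQ (π x)).comp (mfderiv (𝓡 d) (𝓡 r) π x) =
    f x • (η (ι x)).comp (mfderiv (𝓡 d) (𝓡 m) ι x)

end Reduction

end ContactReduction

end

/-!
At a point, `η ∧ (dη)^n ≠ 0` means that `dη` is nondegenerate on `ker η`. The contact complement
`(T N)^⊥` is the kernel of `dη` on `T N ∩ ker η`, so that dividing `T N` by it is symplectic
reduction of `ker η`: the quotient is again contact, and it takes `T N ∩ T L` to a Legendrian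
subspace when `T L` is Legendrian.

The form `ι^* η` vanishes on `ker dπ` and hence induces at each `x` in `N` a covector on
`T_{π x} Q`. For `v` in `ker dπ` the form `ι_v dη` vanishes on `T N ∩ ker η`, so along a fibre the
covector moves inside the ray of its positive multiples; fibres are connected, so each of them
determines one ray. At vertical points the covector does not even move. The forms obtained from
local sections of `π` therefore differ by positive factors, and a partition of unity on `Q` turns
them into a reduced form. Its differential pulls back to `f · dη` on `ker η`, which is all that
linear reduction uses.

If `Q` has dimension `2 k + 1`, linear reduction shows that `π` has constant rank `k` on `N ∩ L`.
Locally its image is then that of an immersed disc through a transversal of the fibres, and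
countably many such discs form the immersed Legendrian `π(N ∩ L)`. When this set is embedded, its
tangent spaces contain those of the discs, and Hausdorff dimension excludes components of
dimension greater than `k`.
-/

noncomputable section

namespace ContactReduction

section WedgePower

variable {V : Type*} [AddCommGroup V] [Module ℝ V] {ι : Type*} [Fintype ι]
  {η : Module.Dual ℝ V} {Ω : V →ₗ[ℝ] V →ₗ[ℝ] ℝ}

lemma exists_linearMap_prod_update (Ω : V →ₗ[ℝ] V →ₗ[ℝ] ℝ)
    [DecidableEq (Option (ι × Fin 2))] (v : Option (ι × Fin 2) → V) (a : ι × Fin 2) :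
    ∃ φ : V →ₗ[ℝ] ℝ, ∀ z,
      ∏ i, Ω (Function.update v (some a) z (some (i, 0)))
        (Function.update v (some a) z (some (i, 1))) = φ z := by
  classical
  obtain ⟨i, s⟩ := a
  have hothers (z : V) : ∏ j ∈ Finset.univ.erase i,
      Ω (Function.update v (some (i, s)) z (some (j, 0)))
        (Function.update v (some (i, s)) z (some (j, 1))) =
      ∏ j ∈ Finset.univ.erase i, Ω (v (some (j, 0))) (v (some (j, 1))) :=
    Finset.prod_congr rfl fun j hj => by
      simp [Finset.ne_of_mem_erase hj]
  simp only [← Finset.mul_prod_erase Finset.univ _ (Finset.mem_univ i), hothers]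
  set c := ∏ j ∈ Finset.univ.erase i, Ω (v (some (j, 0))) (v (some (j, 1)))
  fin_cases s
  · exact ⟨c • Ω.flip (v (some (i, 1))), fun z => by simp [mul_comm]⟩
  · exact ⟨c • Ω (v (some (i, 0))), fun z => by simp [mul_comm]⟩

lemma exists_linearMap_tensor_update (η : Module.Dual ℝ V) (Ω : V →ₗ[ℝ] V →ₗ[ℝ] ℝ)
    [DecidableEq (Option (ι × Fin 2))] (v : Option (ι × Fin 2) → V) (a : Option (ι × Fin 2)) :
    ∃ φ : V →ₗ[ℝ] ℝ, ∀ z, η (Function.update v a z none) *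
      ∏ i, Ω (Function.update v a z (some (i, 0))) (Function.update v a z (some (i, 1))) =
        φ z := by
  rcases a with _ | a
  · exact ⟨(∏ i, Ω (v (some (i, 0))) (v (some (i, 1)))) • η, fun z => by simp [mul_comm]⟩
  · obtain ⟨φ, hφ⟩ := exists_linearMap_prod_update Ω v a
    exact ⟨η (v none) • φ, fun z => by simp [hφ]⟩

/-- The tensor `η ⊗ Ω ⊗ ⋯ ⊗ Ω` with one factor `Ω` for each element of `ι`. Its arguments are
indexed by `Option (ι × Fin 2)`: `none` is the slot of `η`, and `(i, 0)`, `(i, 1)` are the slots of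
the `i`-th factor `Ω`. -/
def tensorPow (ι : Type*) [Fintype ι] (η : Module.Dual ℝ V)
    (Ω : V →ₗ[ℝ] V →ₗ[ℝ] ℝ) :
    MultilinearMap ℝ (fun _ : Option (ι × Fin 2) => V) ℝ where
  toFun v := η (v none) * ∏ i, Ω (v (some (i, 0))) (v (some (i, 1)))
  map_update_add' v a x y := by
    obtain ⟨φ, hφ⟩ := exists_linearMap_tensor_update η Ω v a
    rw [hφ, hφ, hφ, map_add]
  map_update_smul' v a c x := by
    obtain ⟨φ, hφ⟩ := exists_linearMap_tensor_update η Ω v a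
    rw [hφ, hφ, map_smul]

lemma tensorPow_apply (v : Option (ι × Fin 2) → V) :
    tensorPow ι η Ω v = η (v none) * ∏ i, Ω (v (some (i, 0))) (v (some (i, 1))) := rfl

/-- The position `0`, `2 i + 1` or `2 i + 2` of a slot of `tensorPow` among the arguments of
`wedgePow`. -/
def slotPosition (n : ℕ) (a : Option (Fin n × Fin 2)) : Fin (2 * n + 1) :=
  a.elim ⟨0, by omega⟩ fun b => ⟨2 * (b.1 : ℕ) + 1 + (b.2 : ℕ), by omega⟩

lemma slotPosition_bijective (n : ℕ) : Function.Bijective (slotPosition n) := by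
  refine (Fintype.bijective_iff_injective_and_card _).mpr ⟨?_, by simp [mul_comm]⟩
  rintro (_ | ⟨a, s⟩) (_ | ⟨b, t⟩) h <;> simp only [slotPosition, Option.elim, reduceCtorEq,
    Option.some.injEq, Prod.mk.injEq, Fin.ext_iff] at h ⊢
  all_goals omega

/-- The reindexing that exhibits `wedgePow` as an alternatization of `tensorPow`. -/
def slotEquiv (n : ℕ) : Option (Fin n × Fin 2) ≃ Fin (2 * n + 1) :=
  Equiv.ofBijective _ (slotPosition_bijective n)

lemma wedgePow_eq_alternatization (n : ℕ) (v : Fin (2 * n + 1) → V) :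
    wedgePow n η Ω v =
      MultilinearMap.alternatization (tensorPow (Fin n) η Ω) (v ∘ slotEquiv n) := by
  rw [wedgePow, MultilinearMap.alternatization_apply, ← Equiv.sum_comp (slotEquiv n).permCongr]
  refine Finset.sum_congr rfl fun σ _ => ?_
  have hzero : (slotEquiv n).symm 0 = none := (Equiv.symm_apply_eq _).mpr rfl
  have hodd (i : Fin n) (h) : (slotEquiv n).symm ⟨2 * (i : ℕ) + 1, h⟩ = some (i, 0) :=
    (Equiv.symm_apply_eq _).mpr rfl
  have heven (i : Fin n) (h) : (slotEquiv n).symm ⟨2 * (i : ℕ) + 2, h⟩ = some (i, 1) :=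
    (Equiv.symm_apply_eq _).mpr rfl
  simp [tensorPow_apply, hzero, hodd, heven, Units.smul_def]

/-- `(η, Ω)` is the value at a point of a contact form and of its exterior derivative. -/
structure IsContactPair (η : Module.Dual ℝ V) (Ω : V →ₗ[ℝ] V →ₗ[ℝ] ℝ) : Prop where
  isAlt : Ω.IsAlt
  ne_zero : η ≠ 0
  separatingLeft_ker : (Ω.domRestrict₁₂ (LinearMap.ker η) (LinearMap.ker η)).SeparatingLeft

lemma IsContactPair.eq_zero (h : IsContactPair η Ω) {u : V} (hu : η u = 0)
    (hΩ : ∀ w, η w = 0 → Ω u w = 0) : u = 0 :=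
  congrArg Subtype.val (h.separatingLeft_ker ⟨u, hu⟩ fun w => hΩ w w.2)

lemma exists_basis_of_mem_ker (hη : η ≠ 0) {u : V} (hu : η u = 0) (hu₀ : u ≠ 0) :
    ∃ (J : Set V) (b : Module.Basis J ℝ V), u ∈ Set.range b ∧
      ∀ i j, η (b i) ≠ 0 → η (b j) ≠ 0 → i = j := by
  obtain ⟨v₀, hv₀⟩ := LinearMap.surjective hη 1
  have hindep : LinearIndepOn ℝ id {u} := LinearIndepOn.singleton hu₀
  have hsub : {u} ⊆ insert v₀ {w | η w = 0} := Set.singleton_subset_iff.mpr (Or.inr hu)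
  have hspan : ⊤ ≤ Submodule.span ℝ (insert v₀ {w | η w = 0}) := fun w _ => by
    rw [← add_sub_cancel (η w • v₀) w]
    exact add_mem (Submodule.smul_mem _ _ (Submodule.subset_span (Or.inl rfl)))
      (Submodule.subset_span (Or.inr (by simp [hv₀])))
  refine ⟨_, Module.Basis.extendLe hindep hsub hspan,
    Module.Basis.subset_extendLe hindep hsub hspan rfl, fun i j hi hj => ?_⟩
  have hmem := fun k => Module.Basis.extendLe_subset hindep hsub hspan (Set.mem_range_self k)
  exact Module.Basis.injective _
    (((hmem i).resolve_right hi).trans ((hmem j).resolve_right hj).symm)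

lemma tensorPow_eq_zero_of_mem_range (hΩ : Ω.IsAlt) {u : V} (hu : η u = 0)
    (hker : ∀ w, η w = 0 → Ω u w = 0) {v : Option (ι × Fin 2) → V} (huv : u ∈ Set.range v)
    (hv : ∀ a b, η (v a) ≠ 0 → η (v b) ≠ 0 → a = b) : tensorPow ι η Ω v = 0 := by
  rw [tensorPow_apply, mul_eq_zero, or_iff_not_imp_left]
  intro hnone
  have hsome (a : ι × Fin 2) : η (v (some a)) = 0 := by
    by_contra h
    cases hv _ _ hnone h
  obtain ⟨_ | ⟨i, s⟩, rfl⟩ := huv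
  · exact absurd hu hnone
  · refine Finset.prod_eq_zero (Finset.mem_univ i) ?_
    fin_cases s
    · exact hker _ (hsome _)
    · exact hΩ.eq_iff.mp (hker _ (hsome _))

lemma alternatization_tensorPow_eq_zero [DecidableEq ι]
    (hdim : Module.finrank ℝ V = 2 * Fintype.card ι + 1) (hΩ : Ω.IsAlt) {u : V} (hu₀ : u ≠ 0)
    (hu : η u = 0) (hker : ∀ w, η w = 0 → Ω u w = 0) :
    MultilinearMap.alternatization (tensorPow ι η Ω) = 0 := by
  by_cases hη : η = 0
  · ext v
    simp [MultilinearMap.alternatization_apply, tensorPow_apply, hη]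
  obtain ⟨J, b, hub, hb⟩ := exists_basis_of_mem_ker hη hu hu₀
  have : Module.Finite ℝ V := Module.finite_of_finrank_pos (by omega)
  have : Finite J := Module.Finite.finite_basis b
  refine Module.Basis.ext_alternating b fun e he => ?_
  have hbij : Function.Bijective e := he.bijective_of_nat_card_le <| by
    rw [← Module.finrank_eq_nat_card_basis b, hdim]
    simp [mul_comm]
  rw [MultilinearMap.alternatization_apply, AlternatingMap.zero_apply]
  refine Finset.sum_eq_zero fun σ _ => ?_
  have hbσ : Function.Bijective (e ∘ σ) := hbij.comp σ.bijective
  rw [MultilinearMap.domDomCongr_apply, tensorPow_eq_zero_of_mem_range hΩ hu hker, smul_zero]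
  · obtain ⟨j, rfl⟩ := hub
    exact (hbσ.surjective j).imp fun a ha => congrArg b ha
  · exact fun a c ha hc => hbσ.injective (hb _ _ ha hc)

lemma isContactPair_of_wedgePow_ne_zero {n : ℕ} (hdim : Module.finrank ℝ V = 2 * n + 1)
    (hΩ : Ω.IsAlt) {v : Fin (2 * n + 1) → V} (hv : wedgePow n η Ω v ≠ 0) :
    IsContactPair η Ω where
  isAlt := hΩ
  ne_zero := by
    rintro rfl
    simp [wedgePow] at hv
  separatingLeft_ker u hu := by
    by_contra hu₀
    refine hv ?_
    rw [wedgePow_eq_alternatization, alternatization_tensorPow_eq_zero (by simpa using hdim) hΩ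
      (u := u) (by simpa using hu₀) u.2 fun w hw => hu ⟨w, hw⟩, AlternatingMap.zero_apply]

end WedgePower

section SymplecticFamilies

/-- `e` is a symplectic family for `B`: a family of mutually orthogonal pairs `e (i, 0)`,
`e (i, 1)`. The value `t - s` encodes `B (e (i, 0)) (e (i, 1)) = 1`, antisymmetry and isotropy. -/
structure IsSymplecticFamily {ι W : Type*} [AddCommGroup W] [Module ℝ W]
    (B : W →ₗ[ℝ] W →ₗ[ℝ] ℝ) (e : ι × Fin 2 → W) : Prop where
  apply_same : ∀ i s t, B (e (i, s)) (e (i, t)) = (t : ℝ) - (s : ℝ)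
  apply_of_ne : ∀ i j s t, i ≠ j → B (e (i, s)) (e (j, t)) = 0

variable {W : Type*} [AddCommGroup W] [Module ℝ W] {B : W →ₗ[ℝ] W →ₗ[ℝ] ℝ}

lemma IsSymplecticFamily.cons (hB : B.IsAlt) {n : ℕ} {e : Fin n × Fin 2 → W}
    (he : IsSymplecticFamily B e) {x y : W} (hxy : B x y = 1) (hx : ∀ a, B x (e a) = 0)
    (hy : ∀ a, B y (e a) = 0) :
    IsSymplecticFamily B (fun a : Fin (n + 1) × Fin 2 =>
      (Fin.cons ![x, y] (fun i s => e (i, s)) : Fin (n + 1) → Fin 2 → W) a.1 a.2) where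
  apply_same i s t := by
    have hyx : B y x = -1 := by rw [← hB.neg, hxy]
    cases i using Fin.cases
    · fin_cases s <;> fin_cases t <;> simp [hB.self_eq_zero, hxy, hyx]
    · simpa using he.apply_same _ s t
  apply_of_ne i j s t hij := by
    cases i using Fin.cases <;> cases j using Fin.cases
    · exact absurd rfl hij
    · fin_cases s <;> simp [hx, hy]
    · fin_cases t <;> simp [hB.eq_iff.mp (hx _), hB.eq_iff.mp (hy _)]
    · simpa using he.apply_of_ne _ _ s t (by simpa using hij)

lemma separatingLeft_domRestrict_ker_pair (hB : B.IsAlt) (hsep : B.SeparatingLeft) {x y : W}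
    (hxy : B x y = 1) :
    (B.domRestrict₁₂ (LinearMap.ker ((B x).prod (B y)))
      (LinearMap.ker ((B x).prod (B y)))).SeparatingLeft := by
  have hyx : B y x = -1 := by rw [← hB.neg, hxy]
  rintro ⟨u, hu⟩ huK
  obtain ⟨hxu, hyu⟩ : B x u = 0 ∧ B y u = 0 := Prod.mk_eq_zero.mp hu
  refine Subtype.ext (hsep u fun w => ?_)
  have hw : w - B x w • y + B y w • x ∈ LinearMap.ker ((B x).prod (B y)) := by
    simp [hxy, hyx, hB.self_eq_zero]
  have hproj : B u (w - B x w • y + B y w • x) = 0 := huK ⟨_, hw⟩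
  simpa [hB.eq_iff.mp hxu, hB.eq_iff.mp hyu] using hproj

lemma finrank_ker_pair_add_two [Module.Finite ℝ W] (hB : B.IsAlt) {x y : W} (hxy : B x y = 1) :
    Module.finrank ℝ (LinearMap.ker ((B x).prod (B y))) + 2 = Module.finrank ℝ W := by
  have hyx : B y x = -1 := by rw [← hB.neg, hxy]
  have hsurj : Function.Surjective ((B x).prod (B y)) := fun c =>
    ⟨c.1 • y - c.2 • x, by simp [hxy, hyx, hB.self_eq_zero]⟩
  have hrank := LinearMap.finrank_range_add_finrank_ker ((B x).prod (B y))
  rw [LinearMap.range_eq_top.mpr hsurj, finrank_top, Module.finrank_prod,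
    Module.finrank_self] at hrank
  omega

theorem exists_isSymplecticFamily {W : Type*} [AddCommGroup W] [Module ℝ W] [Module.Finite ℝ W]
    {B : W →ₗ[ℝ] W →ₗ[ℝ] ℝ} (hB : B.IsAlt) (hsep : B.SeparatingLeft) :
    ∃ (n : ℕ) (e : Fin n × Fin 2 → W), Module.finrank ℝ W = 2 * n ∧ IsSymplecticFamily B e := by
  induction hN : Module.finrank ℝ W using Nat.strong_induction_on generalizing W with
  | _ N ih =>
    rcases Nat.eq_zero_or_pos N with hzero | hpos
    · exact ⟨0, fun a => a.1.elim0, hzero, fun i => i.elim0, fun i => i.elim0⟩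
    have : Nontrivial W := Module.nontrivial_of_finrank_pos (R := ℝ) (hN ▸ hpos)
    obtain ⟨x, hx⟩ := exists_ne (0 : W)
    obtain ⟨y, hxy⟩ := LinearMap.surjective (f := B x)
      (fun h => hx (hsep x (LinearMap.ext_iff.mp h))) 1
    have hdim := finrank_ker_pair_add_two hB hxy
    have hBK : (B.domRestrict₁₂ (LinearMap.ker ((B x).prod (B y)))
        (LinearMap.ker ((B x).prod (B y)))).IsAlt := fun v => hB v
    obtain ⟨n, e, hn, he⟩ := ih _ (by omega) hBK
      (separatingLeft_domRestrict_ker_pair hB hsep hxy) rfl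
    have horth (a) : B x (e a) = 0 ∧ B y (e a) = 0 := Prod.mk_eq_zero.mp (e a).2
    exact ⟨n + 1, _, by omega, IsSymplecticFamily.cons hB (e := fun a => e a)
      ⟨he.apply_same, he.apply_of_ne⟩ hxy (fun a => (horth a).1) fun a => (horth a).2⟩

end SymplecticFamilies

section BlockPermutations

variable {α β : Type*} [Finite α] [Finite β]

lemma exists_eq_prodCongr_of_preserves_fst [Nonempty β] (σ : Equiv.Perm (α × β))
    (hσ : ∀ a b b', (σ (a, b)).1 = (σ (a, b')).1) :
    ∃ (τ : Equiv.Perm α) (ρ : α → Equiv.Perm β), ∀ a b, σ (a, b) = (τ a, ρ a b) := by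
  obtain ⟨b₀⟩ := ‹Nonempty β›
  have hτ : Function.Bijective fun a => (σ (a, b₀)).1 :=
    Finite.surjective_iff_bijective.mp fun a =>
      ⟨(σ.symm (a, b₀)).1, by rw [hσ _ b₀ (σ.symm (a, b₀)).2, Prod.mk.eta, σ.apply_symm_apply]⟩
  have hρ (a) : Function.Bijective fun b => (σ (a, b)).2 :=
    Finite.injective_iff_bijective.mp fun b b' h =>
      congrArg Prod.snd (σ.injective (Prod.ext (hσ a b b') h))
  exact ⟨.ofBijective _ hτ, fun a => .ofBijective _ (hρ a), fun a b => Prod.ext (hσ a b b₀) rfl⟩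

lemma sign_of_preserves_pairs {ι : Type*} [Fintype ι] [DecidableEq ι]
    (σ : Equiv.Perm (ι × Fin 2)) (hσ : ∀ i, (σ (i, 0)).1 = (σ (i, 1)).1) :
    ((Equiv.Perm.sign σ : ℤ) : ℝ) * ∏ i, (((σ (i, 1)).2 : ℝ) - ((σ (i, 0)).2 : ℝ)) = 1 := by
  obtain ⟨τ, ρ, hτρ⟩ := exists_eq_prodCongr_of_preserves_fst σ fun i s t => by
    fin_cases s <;> fin_cases t <;> simp [hσ i]
  have hsign : Equiv.Perm.sign σ = ∏ i, Equiv.Perm.sign (ρ i) := by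
    have : σ = (Equiv.prodCongrLeft fun _ => τ) * Equiv.prodCongrRight ρ := Equiv.ext fun a =>
      hτρ a.1 a.2
    rw [this, map_mul, Equiv.Perm.sign_prodCongrLeft, Equiv.Perm.sign_prodCongrRight]
    simp
  have hfin (p : Equiv.Perm (Fin 2)) : ((p 1 : ℕ) : ℝ) - ((p 0 : ℕ) : ℝ) =
      ((Equiv.Perm.sign p : ℤ) : ℝ) := by
    have : ((p 1 : ℕ) : ℤ) - ((p 0 : ℕ) : ℤ) = (Equiv.Perm.sign p : ℤ) := by revert p; decide
    exact_mod_cast this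
  have hsq (p : Equiv.Perm (Fin 2)) :
      ((Equiv.Perm.sign p : ℤ) : ℝ) * ((Equiv.Perm.sign p : ℤ) : ℝ) = 1 := by
    rw [← Int.cast_mul, ← Units.val_mul, Int.units_mul_self, Units.val_one, Int.cast_one]
  simp only [hτρ, hfin, hsign, Units.coe_prod, Int.cast_prod, ← Finset.prod_mul_distrib, hsq,
    Finset.prod_const_one]

end BlockPermutations

section WedgePowerNonvanishing

variable {V : Type*} [AddCommGroup V] [Module ℝ V] {ι : Type*} [Fintype ι] [DecidableEq ι]
  {η : Module.Dual ℝ V} {Ω : V →ₗ[ℝ] V →ₗ[ℝ] ℝ} {v : Option (ι × Fin 2) → V}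

-- Only the permutations which fix `none` and permute the pairs contribute, and those contribute
-- `1` since the sign of such a permutation is the product of its signs inside the pairs.
lemma sign_mul_tensorPow_nonneg (hone : η (v none) = 1) (hzero : ∀ a, η (v (some a)) = 0)
    (hv : IsSymplecticFamily Ω (v ∘ some)) (σ : Equiv.Perm (Option (ι × Fin 2))) :
    0 ≤ ((Equiv.Perm.sign σ : ℤ) : ℝ) * tensorPow ι η Ω (v ∘ σ) := by
  rw [tensorPow_apply]
  rcases hσ : σ none with _ | a
  · obtain ⟨τ, rfl⟩ : ∃ τ : Equiv.Perm (ι × Fin 2), σ = τ.optionCongr :=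
      ⟨Equiv.removeNone σ, by
        rw [map_equiv_removeNone, hσ, Equiv.swap_self, ← Equiv.Perm.one_def, one_mul]⟩
    simp only [Equiv.optionCongr_sign, Function.comp_apply, Equiv.optionCongr_apply,
      Option.map_none, Option.map_some, hone, one_mul]
    by_cases hpairs : ∀ i, (τ (i, 0)).1 = (τ (i, 1)).1
    · have hvalue (i) : Ω (v (some (τ (i, 0)))) (v (some (τ (i, 1)))) =
          ((τ (i, 1)).2 : ℝ) - ((τ (i, 0)).2 : ℝ) := by
        rw [← hv.apply_same (τ (i, 0)).1]
        conv_rhs => rw [Prod.mk.eta, hpairs i]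
        rfl
      simp only [hvalue, sign_of_preserves_pairs τ hpairs, zero_le_one]
    · obtain ⟨i, hi⟩ := not_forall.mp hpairs
      rw [Finset.prod_eq_zero (Finset.mem_univ i) (hv.apply_of_ne _ _ _ _ hi), mul_zero]
  · simp [hσ, hzero]

lemma alternatization_tensorPow_pos (hone : η (v none) = 1) (hzero : ∀ a, η (v (some a)) = 0)
    (hv : IsSymplecticFamily Ω (v ∘ some)) :
    0 < MultilinearMap.alternatization (tensorPow ι η Ω) v := by
  rw [MultilinearMap.alternatization_apply]
  have hterm (σ : Equiv.Perm (Option (ι × Fin 2))) :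
      Equiv.Perm.sign σ • (tensorPow ι η Ω).domDomCongr σ v =
        ((Equiv.Perm.sign σ : ℤ) : ℝ) * tensorPow ι η Ω (v ∘ σ) := by
    simp [Units.smul_def, Function.comp_def]
  refine Finset.sum_pos' (fun σ _ => ?_) ⟨1, Finset.mem_univ _, ?_⟩
  · rw [hterm]
    exact sign_mul_tensorPow_nonneg hone hzero hv σ
  · have hpair (i) : Ω (v (some (i, 0))) (v (some (i, 1))) = 1 := by
      simpa using hv.apply_same i 0 1
    simp [tensorPow_apply, hone, hpair]

theorem IsContactPair.exists_wedgePow_ne_zero [Module.Finite ℝ V] (h : IsContactPair η Ω) :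
    ∃ n, Module.finrank ℝ V = 2 * n + 1 ∧
      ∃ v : Fin (2 * n + 1) → V, wedgePow n η Ω v ≠ 0 := by
  obtain ⟨v₀, hv₀⟩ := LinearMap.surjective h.ne_zero 1
  obtain ⟨n, e, hn, he⟩ := exists_isSymplecticFamily
    (B := Ω.domRestrict₁₂ (LinearMap.ker η) (LinearMap.ker η)) (fun v => h.isAlt v)
    h.separatingLeft_ker
  have hrank := LinearMap.finrank_range_add_finrank_ker η
  rw [LinearMap.range_eq_top.mpr (LinearMap.surjective h.ne_zero), finrank_top,
    Module.finrank_self] at hrank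
  let v : Option (Fin n × Fin 2) → V := fun a => a.elim v₀ fun b => e b
  refine ⟨n, by omega, v ∘ (slotEquiv n).symm, ?_⟩
  rw [wedgePow_eq_alternatization, Function.comp_assoc, Equiv.symm_comp_self, Function.comp_id]
  exact (alternatization_tensorPow_pos (v := v) hv₀ (fun a => (e a).2)
    ⟨he.apply_same, he.apply_of_ne⟩).ne'

end WedgePowerNonvanishing

section Complement

variable {V : Type*} [AddCommGroup V] [Module ℝ V]
  {η : Module.Dual ℝ V} {Ω : V →ₗ[ℝ] V →ₗ[ℝ] ℝ}

lemma flat_apply (v w : V) : flat η Ω v w = Ω v w + η v * η w := rfl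

lemma flat_sharp (h : Function.Bijective (flat η Ω)) (α : Module.Dual ℝ V) :
    flat η Ω (sharp η Ω α) = α := by
  rw [sharp, dif_pos h]
  exact (LinearEquiv.ofBijective (flat η Ω) h).apply_symm_apply α

lemma sharp_flat (h : Function.Bijective (flat η Ω)) (v : V) :
    sharp η Ω (flat η Ω v) = v :=
  h.1 (flat_sharp h _)

variable [Module.Finite ℝ V]

namespace IsContactPair

lemma flat_bijective (h : IsContactPair η Ω) : Function.Bijective (flat η Ω) := by
  have hinj : Function.Injective (flat η Ω) := by
    refine (injective_iff_map_eq_zero _).mpr fun u hu => ?_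
    have hu' : ∀ w, Ω u w + η u * η w = 0 := LinearMap.congr_fun hu
    have hηu : η u = 0 := by simpa [h.isAlt u] using hu' u
    exact h.eq_zero hηu fun w _ => by simpa [hηu] using hu' w
  exact ⟨hinj, (LinearMap.injective_iff_surjective_of_finrank_eq_finrank
    Subspace.dual_finrank_eq.symm).mp hinj⟩

lemma reeb_spec (h : IsContactPair η Ω) :
    η (reeb η Ω) = 1 ∧ ∀ w, Ω (reeb η Ω) w = 0 := by
  have hflat : flat η Ω (reeb η Ω) = η := flat_sharp h.flat_bijective η
  have hR : ∀ w, Ω (reeb η Ω) w + η (reeb η Ω) * η w = η w := LinearMap.congr_fun hflat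
  have hη : η (reeb η Ω) ≠ 0 := fun h0 => h.ne_zero <| by
    rw [← hflat, h.eq_zero h0 fun w hw => by simpa [hw] using hR w, map_zero]
  have hη1 : η (reeb η Ω) = 1 := by simpa [h.isAlt _, hη] using hR (reeb η Ω)
  exact ⟨hη1, fun w => by simpa [hη1] using hR w⟩

lemma sharpLambda_flat (h : IsContactPair η Ω) (v : V) :
    sharpLambda η Ω (flat η Ω v) = v - η v • reeb η Ω := by
  obtain ⟨hR, hΩR⟩ := h.reeb_spec
  rw [sharpLambda, LinearMap.comp_apply, LinearEquiv.coe_coe, LinearEquiv.symm_apply_eq]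
  ext β
  obtain ⟨w, rfl⟩ := h.flat_bijective.2 β
  have hwR : Ω w (reeb η Ω) = 0 := by rw [← h.isAlt.neg, hΩR, neg_zero]
  simp only [bivector, LinearMap.neg_apply, LinearMap.compl₁₂_apply, sharp_flat h.flat_bijective,
    Module.evalEquiv_apply, Module.Dual.eval_apply]
  rw [flat_apply, map_sub, map_sub, map_smul, map_smul, hwR, hR, h.isAlt.neg]
  simp

lemma sharpLambda_self (h : IsContactPair η Ω) : sharpLambda η Ω η = 0 := by
  have hR := h.sharpLambda_flat (reeb η Ω)
  rwa [reeb, flat_sharp h.flat_bijective, ← reeb, h.reeb_spec.1, one_smul, sub_self] at hR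

lemma sharpLambda_apply (h : IsContactPair η Ω) {u : V} (hu : η u = 0) :
    sharpLambda η Ω (Ω u) = u := by
  have hflat : flat η Ω u = Ω u := by ext w; simp [flat_apply, hu]
  rw [← hflat, h.sharpLambda_flat, hu, zero_smul, sub_zero]

end IsContactPair

lemma finrank_map_add_finrank_ker {K W W' : Type*} [Field K] [AddCommGroup W] [Module K W]
    [Module.Finite K W] [AddCommGroup W'] [Module K W'] {f : W →ₗ[K] W'} {P : Submodule K W}
    (hf : LinearMap.ker f ≤ P) :
    Module.finrank K (P.map f) + Module.finrank K (LinearMap.ker f) = Module.finrank K P := by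
  rw [← LinearMap.range_domRestrict, ← (Submodule.comapSubtypeEquivOfLe hf).finrank_eq]
  exact LinearMap.finrank_range_add_finrank_ker (f.domRestrict P)

lemma complement_inf (Δ Γ : Submodule ℝ V) :
    complement η Ω (Δ ⊓ Γ) = complement η Ω Δ ⊔ complement η Ω Γ := by
  rw [complement, Subspace.dualAnnihilator_inf_eq, Submodule.map_sup, complement, complement]

namespace IsContactPair

lemma mem_complement_iff (h : IsContactPair η Ω) {Δ : Submodule ℝ V} {u : V} :
    u ∈ complement η Ω Δ ↔ η u = 0 ∧ ∀ w ∈ Δ, η w = 0 → Ω u w = 0 := by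
  constructor
  · rintro ⟨α, hα, rfl⟩
    obtain ⟨v, rfl⟩ := h.flat_bijective.2 α
    obtain ⟨hR, hΩR⟩ := h.reeb_spec
    rw [h.sharpLambda_flat]
    refine ⟨by simp [hR], fun w hw hηw => ?_⟩
    simpa [flat_apply, hηw, hΩR] using (Submodule.mem_dualAnnihilator _).mp hα w hw
  · rintro ⟨hηu, hΩu⟩
    have hmem : Ω u ∈ (Δ ⊓ LinearMap.ker η).dualAnnihilator :=
      (Submodule.mem_dualAnnihilator _).mpr fun w hw => hΩu w hw.1 hw.2
    have hker : complement η Ω (LinearMap.ker η) = ⊥ := by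
      rw [complement, ← LinearMap.range_dualMap_eq_dualAnnihilator_ker, Submodule.eq_bot_iff]
      rintro _ ⟨_, ⟨a, rfl⟩, rfl⟩
      have ha : η.dualMap a = a 1 • η := by
        ext v
        simpa [mul_comm] using a.map_smul (η v) 1
      rw [ha, map_smul, h.sharpLambda_self, smul_zero]
    rw [← sup_bot_eq (complement η Ω Δ), ← hker, ← complement_inf]
    exact ⟨Ω u, hmem, h.sharpLambda_apply hηu⟩

lemma ker_sharpLambda (h : IsContactPair η Ω) :
    LinearMap.ker (sharpLambda η Ω) = Submodule.span ℝ {η} := by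
  refine le_antisymm (fun α hα => ?_) ?_
  · obtain ⟨v, rfl⟩ := h.flat_bijective.2 α
    rw [LinearMap.mem_ker, h.sharpLambda_flat, sub_eq_zero] at hα
    rw [hα, map_smul, reeb, flat_sharp h.flat_bijective]
    exact Submodule.smul_mem _ _ (Submodule.mem_span_singleton_self η)
  · rw [Submodule.span_singleton_le_iff_mem]
    exact h.sharpLambda_self

lemma finrank_of_eq_complement (h : IsContactPair η Ω) {Δ : Submodule ℝ V}
    (hΔ : Δ = complement η Ω Δ) : Module.finrank ℝ V = 2 * Module.finrank ℝ Δ + 1 := by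
  have hker : LinearMap.ker (sharpLambda η Ω) ≤ Δ.dualAnnihilator := by
    rw [h.ker_sharpLambda, Submodule.span_singleton_le_iff_mem, Submodule.mem_dualAnnihilator]
    exact fun u hu => (h.mem_complement_iff.mp (hΔ.le hu)).1
  have hrank := finrank_map_add_finrank_ker hker
  have hspan : Module.finrank ℝ (Submodule.span ℝ {η}) = 1 := finrank_span_singleton h.ne_zero
  rw [h.ker_sharpLambda, hspan] at hrank
  have hmap : Module.finrank ℝ (Δ.dualAnnihilator.map (sharpLambda η Ω)) = Module.finrank ℝ Δ :=
    congrArg (fun Γ : Submodule ℝ V => Module.finrank ℝ Γ) hΔ.symm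
  have hann := Subspace.finrank_add_finrank_dualAnnihilator_eq Δ
  omega

end IsContactPair

end Complement

section LinearReduction

variable {V T U : Type*} [AddCommGroup V] [Module ℝ V] [Module.Finite ℝ V]
  [AddCommGroup T] [Module ℝ T] [AddCommGroup U] [Module ℝ U]

/-- The linear data of a contact reduction at a point: `i` is the inclusion of the tangent space
of a coisotropic submanifold, `p` the projection to the tangent space of the quotient, `(η, Ω)`
and `(η', Ω')` are the values of the contact form and its derivative upstairs and downstairs, and
`c` is the value of the factor. Only on `ker η` does `Ω'` pull back to a multiple of `Ω`. -/
structure IsLinearReduction (η : Module.Dual ℝ V) (Ω : V →ₗ[ℝ] V →ₗ[ℝ] ℝ)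
    (i : T →ₗ[ℝ] V) (p : T →ₗ[ℝ] U) (η' : Module.Dual ℝ U) (Ω' : U →ₗ[ℝ] U →ₗ[ℝ] ℝ)
    (c : ℝ) : Prop where
  contact : IsContactPair η Ω
  isAlt : Ω'.IsAlt
  coisotropic : complement η Ω (LinearMap.range i) ≤ LinearMap.range i
  nonhorizontal : ∃ u, η (i u) ≠ 0
  surjective : Function.Surjective p
  ker_eq : LinearMap.ker p = (complement η Ω (LinearMap.range i)).comap i
  ne_zero : c ≠ 0
  form_eq : ∀ u, η' (p u) = c * η (i u)
  deriv_eq : ∀ u w, η (i u) = 0 → η (i w) = 0 → Ω' (p u) (p w) = c * Ω (i u) (i w)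

variable {η : Module.Dual ℝ V} {Ω : V →ₗ[ℝ] V →ₗ[ℝ] ℝ} {i : T →ₗ[ℝ] V} {p : T →ₗ[ℝ] U}
  {η' : Module.Dual ℝ U} {Ω' : U →ₗ[ℝ] U →ₗ[ℝ] ℝ} {c : ℝ}

namespace IsLinearReduction

lemma form_eq_zero_iff (h : IsLinearReduction η Ω i p η' Ω' c) (u : T) :
    η' (p u) = 0 ↔ η (i u) = 0 := by
  rw [h.form_eq, mul_eq_zero, or_iff_right h.ne_zero]

lemma deriv_eq_zero_iff (h : IsLinearReduction η Ω i p η' Ω' c) {u w : T}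
    (hu : η (i u) = 0) (hw : η (i w) = 0) : Ω' (p u) (p w) = 0 ↔ Ω (i u) (i w) = 0 := by
  rw [h.deriv_eq u w hu hw, mul_eq_zero, or_iff_right h.ne_zero]

lemma isContactPair (h : IsLinearReduction η Ω i p η' Ω' c) : IsContactPair η' Ω' := by
  refine ⟨h.isAlt, ?_, fun ⟨q, hq⟩ hΩq => Subtype.ext ?_⟩
  · rintro rfl
    obtain ⟨u, hu⟩ := h.nonhorizontal
    exact hu ((h.form_eq_zero_iff u).mp rfl)
  · obtain ⟨u, rfl⟩ := h.surjective q
    have hu : η (i u) = 0 := (h.form_eq_zero_iff u).mp hq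
    change u ∈ LinearMap.ker p
    rw [h.ker_eq, Submodule.mem_comap, h.contact.mem_complement_iff]
    refine ⟨hu, ?_⟩
    rintro _ ⟨w, rfl⟩ hw
    exact (h.deriv_eq_zero_iff hu hw).mp (hΩq ⟨p w, (h.form_eq_zero_iff w).mpr hw⟩)

lemma map_comap_eq_complement [Module.Finite ℝ U] (h : IsLinearReduction η Ω i p η' Ω' c)
    {Λ : Submodule ℝ V} (hΛ : Λ = complement η Ω Λ) :
    (Λ.comap i).map p = complement η' Ω' ((Λ.comap i).map p) := by
  have hc := h.contact
  have mem_Λ : ∀ {u}, u ∈ Λ → η u = 0 ∧ ∀ w ∈ Λ, η w = 0 → Ω u w = 0 := fun hu =>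
    hc.mem_complement_iff.mp (hΛ.le hu)
  refine le_antisymm ?_ fun q hq => ?_
  · rintro _ ⟨u, hu, rfl⟩
    obtain ⟨hu0, huΛ⟩ := mem_Λ hu
    refine h.isContactPair.mem_complement_iff.mpr ⟨(h.form_eq_zero_iff u).mpr hu0, ?_⟩
    rintro _ ⟨w, hw, rfl⟩ -
    exact (h.deriv_eq_zero_iff hu0 (mem_Λ hw).1).mpr (huΛ _ hw (mem_Λ hw).1)
  · obtain ⟨u, rfl⟩ := h.surjective q
    rw [h.isContactPair.mem_complement_iff, h.form_eq_zero_iff] at hq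
    obtain ⟨hu0, huΩ⟩ := hq
    have hu : i u ∈ complement η Ω (Λ ⊓ LinearMap.range i) := by
      refine hc.mem_complement_iff.mpr ⟨hu0, ?_⟩
      rintro _ ⟨hw, w, rfl⟩ hw0
      exact (h.deriv_eq_zero_iff hu0 hw0).mp
        (huΩ (p w) ⟨w, hw, rfl⟩ ((h.form_eq_zero_iff w).mpr hw0))
    rw [complement_inf, ← hΛ] at hu
    obtain ⟨a, ha, b, hb, hab⟩ := Submodule.mem_sup.mp hu
    obtain ⟨z, rfl⟩ := h.coisotropic hb
    have hpz : z ∈ LinearMap.ker p := by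
      rw [h.ker_eq]
      exact hb
    have hia : i (u - z) = a := by rw [map_sub, ← hab, add_sub_cancel_right]
    exact ⟨u - z, by simpa [hia] using ha, by rw [map_sub, LinearMap.mem_ker.mp hpz, sub_zero]⟩

end IsLinearReduction

end LinearReduction

section PullForm

variable {m : ℕ} {M : Type*} [TopologicalSpace M] [ChartedSpace (Euc m) M]
  {E E' : Type*} [NormedAddCommGroup E] [NormedSpace ℝ E]
  [NormedAddCommGroup E'] [NormedSpace ℝ E']
  {η : ∀ x : M, TangentSpace (𝓡 m) x →L[ℝ] ℝ}

/-- The pullback of a one-form by a map from a vector space, written as a covector field on that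
space so that the calculus of Fréchet derivatives applies. -/
def pullForm (η : ∀ x : M, TangentSpace (𝓡 m) x →L[ℝ] ℝ) (g : E → M) (e : E) : E →L[ℝ] ℝ :=
  (η (g e)).comp (mfderiv 𝓘(ℝ, E) (𝓡 m) g e)

lemma pullForm_congr {g g' : E → M} {e : E} (h : g =ᶠ[𝓝 e] g') :
    pullForm η g =ᶠ[𝓝 e] pullForm η g' := by
  filter_upwards [h.eventuallyEq_nhds] with e' he'
  have hderiv : (mfderiv 𝓘(ℝ, E) (𝓡 m) g e' : E →L[ℝ] Euc m) = mfderiv 𝓘(ℝ, E) (𝓡 m) g' e' :=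
    he'.mfderiv_eq
  exact congrArg₂ (fun (x : M) (A : E →L[ℝ] Euc m) => (η x : Euc m →L[ℝ] ℝ).comp A)
    he'.self_of_nhds hderiv

lemma pullForm_comp {g : E → M} {h : E' → E} {e : E'}
    (hg : MDifferentiableAt 𝓘(ℝ, E) (𝓡 m) g (h e)) (hh : DifferentiableAt ℝ h e) :
    pullForm η (g ∘ h) e = (pullForm η g (h e)).comp (fderiv ℝ h e) := by
  rw [pullForm, mfderiv_comp e hg hh.mdifferentiableAt, mfderiv_eq_fderiv]
  rfl

lemma extD_apply (x : M) (v w : TangentSpace (𝓡 m) x) : extD η x v w =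
    chartDeriv η x (mfderiv (𝓡 m) 𝓘(ℝ, Euc m) (extChartAt (𝓡 m) x) x v)
        (mfderiv (𝓡 m) 𝓘(ℝ, Euc m) (extChartAt (𝓡 m) x) x w) -
      chartDeriv η x (mfderiv (𝓡 m) 𝓘(ℝ, Euc m) (extChartAt (𝓡 m) x) x w)
        (mfderiv (𝓡 m) 𝓘(ℝ, Euc m) (extChartAt (𝓡 m) x) x v) := rfl

lemma extD_isAlt (x : M) : (extD η x).IsAlt := fun _ => sub_self _

lemma IsSmoothForm.contDiffAt_chartForm (hη : IsSmoothForm η) (x : M) :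
    ContDiffAt ℝ ∞ (chartForm η x) (extChartAt (𝓡 m) x x) :=
  (hη x).contDiffAt (extChartAt_target_mem_nhds x)

lemma contDiffAt_extChartAt_comp {g : E → M} {e : E}
    (hg : ContMDiffAt 𝓘(ℝ, E) (𝓡 m) ∞ g e) :
    ContDiffAt ℝ ∞ (fun e' => extChartAt (𝓡 m) (g e) (g e')) e :=
  ((contMDiffAt_extChartAt (n := ∞)).comp e hg).contDiffAt

lemma mfderiv_extChartAt_mfderiv {g : E → M} {e : E} (hg : ContMDiffAt 𝓘(ℝ, E) (𝓡 m) ∞ g e)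
    (v : E) :
    (mfderiv (𝓡 m) 𝓘(ℝ, Euc m) (extChartAt (𝓡 m) (g e)) (g e)
      (mfderiv 𝓘(ℝ, E) (𝓡 m) g e v) : Euc m) =
      fderiv ℝ (fun e' => extChartAt (𝓡 m) (g e) (g e')) e v := by
  have hchart : MDifferentiableAt (𝓡 m) 𝓘(ℝ, Euc m) (extChartAt (𝓡 m) (g e)) (g e) :=
    (contMDiffAt_extChartAt (n := ∞)).mdifferentiableAt (by simp)
  have hcomp := mfderiv_comp e hchart (hg.mdifferentiableAt (by simp))
  rw [mfderiv_eq_fderiv] at hcomp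
  exact (congrArg (fun A : E →L[ℝ] Euc m => A v) hcomp).symm

variable [IsManifold (𝓡 m) ∞ M]

lemma pullForm_eventuallyEq_chart {g : E → M} {e : E}
    (hg : ContMDiffAt 𝓘(ℝ, E) (𝓡 m) ∞ g e) :
    pullForm η g =ᶠ[𝓝 e] fun e' =>
      (chartForm η (g e) (extChartAt (𝓡 m) (g e) (g e'))).comp
        (fderiv ℝ (fun e' => extChartAt (𝓡 m) (g e) (g e')) e') := by
  have hsource : ∀ᶠ e' in 𝓝 e, g e' ∈ (extChartAt (𝓡 m) (g e)).source :=
    hg.continuousAt (extChartAt_source_mem_nhds _)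
  have hG := contDiffAt_extChartAt_comp hg
  have heq : g =ᶠ[𝓝 e] (extChartAt (𝓡 m) (g e)).symm ∘
      fun e' => extChartAt (𝓡 m) (g e) (g e') := by
    filter_upwards [hsource] with e' he'
    exact ((extChartAt (𝓡 m) (g e)).left_inv he').symm
  have hdiff : ∀ᶠ e' in 𝓝 e, DifferentiableAt ℝ (fun e' => extChartAt (𝓡 m) (g e) (g e')) e' := by
    filter_upwards [(hG.of_le (by exact_mod_cast le_top : (1 : ℕ∞ω) ≤ ∞)).eventually (by simp)]
      with e' he' using he'.differentiableAt one_ne_zero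
  filter_upwards [pullForm_congr (η := η) heq, hsource, hdiff] with e' h1 h2 h3
  rw [h1, pullForm_comp _ h3]
  · rfl
  · have ht := (extChartAt (𝓡 m) (g e)).map_source h2
    exact ((contMDiffOn_extChartAt_symm (n := ∞) (g e)).contMDiffAt
      ((isOpen_extChartAt_target (g e)).mem_nhds ht)).mdifferentiableAt (by simp)

lemma IsSmoothForm.contDiffAt_pullForm (hη : IsSmoothForm η) {g : E → M} {e : E}
    (hg : ContMDiffAt 𝓘(ℝ, E) (𝓡 m) ∞ g e) : ContDiffAt ℝ ∞ (pullForm η g) e := by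
  refine ContDiffAt.congr_of_eventuallyEq ?_ (pullForm_eventuallyEq_chart hg)
  have hG := contDiffAt_extChartAt_comp hg
  exact ((hη.contDiffAt_chartForm (g e)).comp e hG).clm_comp
    (hG.fderiv_right (by simp))

/-- The second derivative of the chart expression of `g` drops out by symmetry. -/
lemma IsSmoothForm.fderiv_pullForm_sub (hη : IsSmoothForm η) {g : E → M} {e : E}
    (hg : ContMDiffAt 𝓘(ℝ, E) (𝓡 m) ∞ g e) (v w : E) :
    fderiv ℝ (pullForm η g) e v w - fderiv ℝ (pullForm η g) e w v =
      extD η (g e) (mfderiv 𝓘(ℝ, E) (𝓡 m) g e v) (mfderiv 𝓘(ℝ, E) (𝓡 m) g e w) := by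
  set G : E → Euc m := fun e' => extChartAt (𝓡 m) (g e) (g e')
  have hG : ContDiffAt ℝ ∞ G e := contDiffAt_extChartAt_comp hg
  have hform : DifferentiableAt ℝ (chartForm η (g e)) (G e) :=
    (hη.contDiffAt_chartForm (g e)).differentiableAt (by simp)
  have hG1 : DifferentiableAt ℝ G e := hG.differentiableAt (by simp)
  have hG2 : DifferentiableAt ℝ (fderiv ℝ G) e :=
    (hG.fderiv_right (m := ∞) (by simp)).differentiableAt (by simp)
  have hsymm : fderiv ℝ (fderiv ℝ G) e v w = fderiv ℝ (fderiv ℝ G) e w v :=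
    hG.isSymmSndFDerivAt (by
      rw [minSmoothness_of_isRCLikeNormedField]
      exact WithTop.coe_le_coe.mpr le_top) v w
  have hpull : HasFDerivAt (fun e' => (chartForm η (g e) (G e')).comp (fderiv ℝ G e')) _ e :=
    (hform.hasFDerivAt.comp e hG1.hasFDerivAt).clm_comp hG2.hasFDerivAt
  rw [(hpull.congr_of_eventuallyEq (pullForm_eventuallyEq_chart hg)).fderiv, extD_apply]
  refine Eq.trans ?_ (congrArg₂ (fun a b : Euc m =>
    fderiv ℝ (chartForm η (g e)) (G e) a b - fderiv ℝ (chartForm η (g e)) (G e) b a)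
    (mfderiv_extChartAt_mfderiv hg v) (mfderiv_extChartAt_mfderiv hg w)).symm
  simp only [add_apply, ContinuousLinearMap.comp_apply, ContinuousLinearMap.compL_apply,
    ContinuousLinearMap.flip_apply, hsymm]
  ring

end PullForm

section LocalForms

variable {m d r : ℕ}
  {M : Type*} [TopologicalSpace M] [ChartedSpace (Euc m) M]
  {N : Type*} [TopologicalSpace N] [ChartedSpace (Euc d) N]
  {Q : Type*} [TopologicalSpace Q] [ChartedSpace (Euc r) Q]
  {E : Type*} [NormedAddCommGroup E] [NormedSpace ℝ E]

lemma mfderiv_comp_apply_of_contMDiffAt {ι : N → M} {g : E → N} {e : E}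
    (hι : ContMDiffAt (𝓡 d) (𝓡 m) ∞ ι (g e)) (hg : ContMDiffAt 𝓘(ℝ, E) (𝓡 d) ∞ g e) (v : E) :
    (mfderiv 𝓘(ℝ, E) (𝓡 m) (ι ∘ g) e v : Euc m) =
      mfderiv (𝓡 d) (𝓡 m) ι (g e) (mfderiv 𝓘(ℝ, E) (𝓡 d) g e v) :=
  mfderiv_comp_apply e (hι.mdifferentiableAt (by simp)) (hg.mdifferentiableAt (by simp)) v

lemma pullForm_comp_apply {η : ∀ x : M, TangentSpace (𝓡 m) x →L[ℝ] ℝ} {ι : N → M} {g : E → N}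
    {e : E} (hι : ContMDiffAt (𝓡 d) (𝓡 m) ∞ ι (g e)) (hg : ContMDiffAt 𝓘(ℝ, E) (𝓡 d) ∞ g e)
    (v : E) : pullForm η (ι ∘ g) e v =
      η (ι (g e)) (mfderiv (𝓡 d) (𝓡 m) ι (g e) (mfderiv 𝓘(ℝ, E) (𝓡 d) g e v)) :=
  congrArg (η (ι (g e))) (mfderiv_comp_apply_of_contMDiffAt hι hg v)

lemma mfderiv_mfderiv_of_comp_eventuallyEq_id {g : M → N} {f : N → M} {x : N}
    (hg : ContMDiffAt (𝓡 m) (𝓡 d) ∞ g (f x)) (hf : ContMDiffAt (𝓡 d) (𝓡 m) ∞ f x)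
    (hgf : g ∘ f =ᶠ[𝓝 x] id) (v : Euc d) :
    (mfderiv (𝓡 m) (𝓡 d) g (f x) (mfderiv (𝓡 d) (𝓡 m) f x v) : Euc d) = v := by
  have hcomp := mfderiv_comp x (hg.mdifferentiableAt (by simp)) (hf.mdifferentiableAt (by simp))
  rw [hgf.mfderiv_eq, mfderiv_id] at hcomp
  exact (congrArg (fun A : Euc d →L[ℝ] Euc d => A v) hcomp).symm

lemma exists_local_retraction {ι : N → M} {x : N}
    (h : Manifold.IsImmersionAt (𝓡 d) (𝓡 m) ∞ ι x) :
    ∃ ρ : M → N, ContMDiffAt (𝓡 m) (𝓡 d) ∞ ρ (ι x) ∧ ρ ∘ ι =ᶠ[𝓝 x] id := by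
  have hx := h.mem_domChart_source
  have hcoord : ∀ y ∈ h.domChart.source, (h.equiv.symm (h.codChart (ι y))).1 = h.domChart y := by
    intro y hy
    have hy' : h.domChart y ∈ (h.domChart.extend (𝓡 d)).target := by
      simpa using h.domChart.map_source hy
    have hw : h.codChart (ι y) = h.equiv (h.domChart y, 0) := by
      simpa [h.domChart.left_inv hy] using h.writtenInCharts hy'
    rw [hw, h.equiv.symm_apply_apply]
  refine ⟨fun z => h.domChart.symm (h.equiv.symm (h.codChart z)).1, ?_, ?_⟩
  · have hfst : ContMDiff 𝓘(ℝ, Euc m) 𝓘(ℝ, Euc d) ∞ fun e => (h.equiv.symm e).1 :=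
      contMDiff_iff_contDiff.mpr (contDiff_fst.comp h.equiv.symm.contDiff)
    have hcod : ContMDiffAt (𝓡 m) 𝓘(ℝ, Euc m) ∞ h.codChart (ι x) :=
      contMDiffAt_of_mem_maximalAtlas h.codChart_mem_maximalAtlas h.mem_codChart_source
    have hdom : ContMDiffAt 𝓘(ℝ, Euc d) (𝓡 d) ∞ h.domChart.symm
        (h.equiv.symm (h.codChart (ι x))).1 := by
      rw [hcoord x hx]
      exact contMDiffAt_symm_of_mem_maximalAtlas h.domChart_mem_maximalAtlas
        (h.domChart.map_source hx)
    exact hdom.comp (ι x) (hfst.contMDiffAt.comp (ι x) hcod)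
  · filter_upwards [h.domChart.open_source.mem_nhds hx] with y hy
    rw [Function.comp_apply, hcoord y hy, h.domChart.left_inv hy, id]

lemma mfderiv_injective_of_isImmersionAt {ι : N → M} {x : N}
    (h : Manifold.IsImmersionAt (𝓡 d) (𝓡 m) ∞ ι x) :
    Function.Injective (mfderiv (𝓡 d) (𝓡 m) ι x) := by
  obtain ⟨ρ, hρ, hρι⟩ := exists_local_retraction h
  have hinv := mfderiv_mfderiv_of_comp_eventuallyEq_id hρ h.contMDiffAt hρι
  exact fun u v huv => (hinv u).symm.trans ((congrArg _ huv).trans (hinv v))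

/-- Coordinates `φ` on the source and `ψ` on the target of `π` in which `π` is the projection to
the first factor. Of `φ` only the smoothness of its inverse is recorded. -/
structure IsSubmersionChart {F : Type*} [NormedAddCommGroup F] [NormedSpace ℝ F] (π : N → Q)
    (φ : OpenPartialHomeomorph N (Euc r × F)) (ψ : OpenPartialHomeomorph Q (Euc r)) : Prop where
  contMDiffOn_symm : ContMDiffOn 𝓘(ℝ, Euc r × F) (𝓡 d) ∞ φ.symm φ.target
  mem_maximalAtlas : ψ ∈ IsManifold.maximalAtlas (𝓡 r) ∞ Q
  mapsTo_source : Set.MapsTo π φ.source ψ.source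
  apply_projection : ∀ x ∈ φ.source, ψ (π x) = (φ x).1

lemma exists_isSubmersionChart {π : N → Q} {x₀ : N}
    (h : Manifold.IsSubmersionAt (𝓡 d) (𝓡 r) ∞ π x₀) :
    ∃ (F : Type) (_ : NormedAddCommGroup F) (_ : NormedSpace ℝ F)
      (φ : OpenPartialHomeomorph N (Euc r × F)) (ψ : OpenPartialHomeomorph Q (Euc r)),
      x₀ ∈ φ.source ∧ IsSubmersionChart (d := d) π φ ψ := by
  refine ⟨h.complement, inferInstance, inferInstance,
    h.domChart.transHomeomorph h.equiv.toHomeomorph, h.codChart, h.mem_domChart_source,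
    ?_, h.codChart_mem_maximalAtlas, fun x hx => h.source_subset_preimage_source hx, ?_⟩
  · have he : ContMDiff 𝓘(ℝ, Euc r × h.complement) 𝓘(ℝ, Euc d) ∞ h.equiv.symm :=
      contMDiff_iff_contDiff.mpr h.equiv.symm.contDiff
    exact (contMDiffOn_symm_of_mem_maximalAtlas h.domChart_mem_maximalAtlas).comp
      he.contMDiffOn (fun c hc => by simpa using hc)
  · intro x (hx : x ∈ h.domChart.source)
    have hx' : h.domChart x ∈ (h.domChart.extend (𝓡 d)).target := by
      simpa using h.domChart.map_source hx
    have := h.writtenInCharts hx'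
    simpa [h.domChart.left_inv hx] using this

namespace IsSubmersionChart

variable {F : Type*} [NormedAddCommGroup F] [NormedSpace ℝ F] {π : N → Q}
  {φ : OpenPartialHomeomorph N (Euc r × F)} {ψ : OpenPartialHomeomorph Q (Euc r)} {c : Euc r × F}

lemma contMDiffAt_symm (h : IsSubmersionChart (d := d) π φ ψ) (hc : c ∈ φ.target) :
    ContMDiffAt 𝓘(ℝ, Euc r × F) (𝓡 d) ∞ φ.symm c :=
  h.contMDiffOn_symm.contMDiffAt (φ.open_target.mem_nhds hc)

lemma fst_mem_target (h : IsSubmersionChart (d := d) π φ ψ) (hc : c ∈ φ.target) :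
    c.1 ∈ ψ.target := by
  have hx := φ.map_target hc
  rw [← φ.right_inv hc, ← h.apply_projection _ hx]
  exact ψ.map_source (h.mapsTo_source hx)

lemma projection_symm_apply (h : IsSubmersionChart (d := d) π φ ψ) (hc : c ∈ φ.target) :
    π (φ.symm c) = ψ.symm c.1 := by
  have hx := φ.map_target hc
  rw [← congrArg Prod.fst (φ.right_inv hc), ← h.apply_projection _ hx,
    ψ.left_inv (h.mapsTo_source hx)]

lemma contMDiffAt_base_symm (h : IsSubmersionChart (d := d) π φ ψ) (hc : c ∈ φ.target) :
    ContMDiffAt 𝓘(ℝ, Euc r) (𝓡 r) ∞ ψ.symm c.1 :=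
  contMDiffAt_symm_of_mem_maximalAtlas h.mem_maximalAtlas (h.fst_mem_target hc)

lemma mfderiv_projection_mfderiv_symm (h : IsSubmersionChart (d := d) π φ ψ)
    (hc : c ∈ φ.target) (hπ : MDifferentiableAt (𝓡 d) (𝓡 r) π (φ.symm c)) (w : Euc r × F) :
    (mfderiv (𝓡 d) (𝓡 r) π (φ.symm c) (mfderiv 𝓘(ℝ, Euc r × F) (𝓡 d) φ.symm c w) : Euc r) =
      mfderiv 𝓘(ℝ, Euc r) (𝓡 r) ψ.symm c.1 w.1 := by
  have hcoord : π ∘ φ.symm =ᶠ[𝓝 c] ψ.symm ∘ Prod.fst := by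
    filter_upwards [φ.open_target.mem_nhds hc] with c' hc' using h.projection_symm_apply hc'
  have hφ := mfderiv_comp_apply c hπ
    ((h.contMDiffAt_symm hc).mdifferentiableAt (by simp)) w
  have hψ := mfderiv_comp_apply c ((h.contMDiffAt_base_symm hc).mdifferentiableAt (by simp))
    (f := (Prod.fst : Euc r × F → Euc r)) differentiableAt_fst.mdifferentiableAt w
  rw [mfderiv_eq_fderiv, fderiv_fst] at hψ
  refine hφ.symm.trans (Eq.trans ?_ hψ)
  exact congrArg (fun A : Euc r × F →L[ℝ] Euc r => A w) hcoord.mfderiv_eq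

lemma mfderiv_base_symm_surjective
    (h : IsSubmersionChart (d := d) π φ ψ) (hc : c ∈ φ.target) :
    Function.Surjective (mfderiv 𝓘(ℝ, Euc r) (𝓡 r) ψ.symm c.1) := by
  have ht := h.fst_mem_target hc
  have hs := ψ.map_target ht
  have hinv := mfderiv_mfderiv_of_comp_eventuallyEq_id (g := ψ.symm) (f := ψ) (x := ψ.symm c.1)
    (contMDiffAt_symm_of_mem_maximalAtlas h.mem_maximalAtlas (ψ.map_source hs))
    (contMDiffAt_of_mem_maximalAtlas h.mem_maximalAtlas hs)
    (Filter.eventually_of_mem (ψ.open_source.mem_nhds hs) fun q hq => ψ.left_inv hq)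
  rw [ψ.right_inv ht] at hinv
  exact fun v => ⟨_, hinv v⟩

end IsSubmersionChart

lemma exists_local_section {π : N → Q} {x₀ : N}
    (h : Manifold.IsSubmersionAt (𝓡 d) (𝓡 r) ∞ π x₀) :
    ∃ (U : Set Q) (s : Q → N), IsOpen U ∧ π x₀ ∈ U ∧ s (π x₀) = x₀ ∧
      ContMDiffOn (𝓡 r) (𝓡 d) ∞ s U ∧ ∀ q ∈ U, π (s q) = q := by
  obtain ⟨F, _, _, φ, ψ, hx₀, hφψ⟩ := exists_isSubmersionChart h
  let slice : Euc r → Euc r × F := fun e => (e, (φ x₀).2)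
  have hslice : Continuous slice := by fun_prop
  have hslice₀ : slice (ψ (π x₀)) = φ x₀ := by simp only [slice, hφψ.apply_projection x₀ hx₀]
  refine ⟨ψ.source ∩ ψ ⁻¹' (slice ⁻¹' φ.target), fun q => φ.symm (slice (ψ q)),
    ψ.isOpen_inter_preimage (φ.open_target.preimage hslice), ⟨hφψ.mapsTo_source hx₀, ?_⟩,
    ?_, ?_, ?_⟩
  · rw [Set.mem_preimage, Set.mem_preimage, hslice₀]
    exact φ.map_source hx₀
  · simp only [hslice₀, φ.left_inv hx₀]
  · refine hφψ.contMDiffOn_symm.comp (t := φ.target) ?_ (fun q hq => hq.2)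
    have hslice' : ContMDiff 𝓘(ℝ, Euc r) 𝓘(ℝ, Euc r × F) ∞ slice :=
      contMDiff_iff_contDiff.mpr (by fun_prop)
    exact hslice'.comp_contMDiffOn
      ((contMDiffOn_of_mem_maximalAtlas hφψ.mem_maximalAtlas).mono Set.inter_subset_left)
  · rintro q ⟨hq, hq'⟩
    rw [hφψ.projection_symm_apply hq', ψ.left_inv hq]

lemma mfderiv_surjective_of_isSubmersionAt {π : N → Q} {x : N}
    (h : Manifold.IsSubmersionAt (𝓡 d) (𝓡 r) ∞ π x) :
    Function.Surjective (mfderiv (𝓡 d) (𝓡 r) π x) := by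
  obtain ⟨U, s, hU, hx, hsx, hs, hπs⟩ := exists_local_section h
  have hinv := mfderiv_mfderiv_of_comp_eventuallyEq_id (g := π) (f := s) (x := π x)
    (by rw [hsx]; exact h.contMDiffAt) (hs.contMDiffAt (hU.mem_nhds hx))
    (Filter.eventually_of_mem (hU.mem_nhds hx) hπs)
  rw [hsx] at hinv
  exact fun v => ⟨_, hinv v⟩

end LocalForms

section Rays

variable {E F : Type*} [NormedAddCommGroup E] [NormedSpace ℝ E]
  [NormedAddCommGroup F] [NormedSpace ℝ F]

lemma eq_of_fderiv_inr_eq_zero {G : Type*} [NormedAddCommGroup G] [NormedSpace ℝ G]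
    {b : E × F → G} {e : E} {B : Set F} (hB : IsOpen B)
    (hB' : IsPreconnected B) (hb : ∀ z ∈ B, DifferentiableAt ℝ b (e, z))
    (hd : ∀ z ∈ B, ∀ z', fderiv ℝ b (e, z) (0, z') = 0) {z z' : F} (hz : z ∈ B) (hz' : z' ∈ B) :
    b (e, z) = b (e, z') := by
  have hd' : ∀ z ∈ B, HasFDerivAt (fun z => b (e, z)) (0 : F →L[ℝ] G) z := by
    intro z hz
    have hslice := (hb z hz).hasFDerivAt.comp z (hasFDerivAt_prodMk_right e z)
    have hzero : (fderiv ℝ b (e, z)).comp (ContinuousLinearMap.inr ℝ E F) = 0 :=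
      ContinuousLinearMap.ext fun z' => by simpa using hd z hz z'
    rwa [hzero] at hslice
  exact hB.is_const_of_fderiv_eq_zero hB'
    (fun z hz => (hd' z hz).differentiableAt.differentiableWithinAt)
    (fun z hz => (hd' z hz).fderiv) hz hz'

lemma fderiv_apply_eq_zero {α : E → E →L[ℝ] ℝ} {c v : E} (hα : DifferentiableAt ℝ α c)
    (h : ∀ᶠ c' in 𝓝 c, α c' v = 0) (w : E) : fderiv ℝ α c w v = 0 := by
  have hflip : HasFDerivAt (fun c' => α c' v) ((fderiv ℝ α c).flip v) c :=
    (ContinuousLinearMap.apply ℝ ℝ v).hasFDerivAt.comp c hα.hasFDerivAt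
  have hzero : HasFDerivAt (fun c' => α c' v) (0 : E →L[ℝ] ℝ) c :=
    (hasFDerivAt_const (0 : ℝ) c).congr_of_eventuallyEq h
  exact congrArg (fun A : E →L[ℝ] ℝ => A w) (hflip.unique hzero)

lemma fderiv_inv_smul_apply {α : E → E →L[ℝ] ℝ} {c w₀ : E} (hα : DifferentiableAt ℝ α c)
    (h : α c w₀ ≠ 0) (v w : E) :
    fderiv ℝ (fun c => (α c w₀)⁻¹ • α c) c v w =
      (α c w₀)⁻¹ * (fderiv ℝ α c v w - fderiv ℝ α c v w₀ * (α c w / α c w₀)) := by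
  have heval : HasFDerivAt (fun c => α c w₀) ((fderiv ℝ α c).flip w₀) c :=
    (ContinuousLinearMap.apply ℝ ℝ w₀).hasFDerivAt.comp c hα.hasFDerivAt
  have hinv : HasFDerivAt (fun c => (α c w₀)⁻¹) _ c := (hasDerivAt_inv h).comp_hasFDerivAt c heval
  have hsmul : HasFDerivAt (fun c => (α c w₀)⁻¹ • α c) _ c := hinv.smul hα.hasFDerivAt
  rw [hsmul.fderiv]
  simp only [add_apply, smul_apply, ContinuousLinearMap.smulRight_apply,
    ContinuousLinearMap.flip_apply, smul_eq_mul]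
  field_simp
  ring

lemma exists_nhds_form_eq {α : E × F → E × F →L[ℝ] ℝ} {c₀ : E × F}
    (hα : ∀ᶠ c in 𝓝 c₀, DifferentiableAt ℝ α c)
    (hker : ∀ᶠ c in 𝓝 c₀, ∀ z, α c (0, z) = 0)
    (hd : ∀ᶠ c in 𝓝 c₀, ∀ z w, fderiv ℝ α c (0, z) w - fderiv ℝ α c w (0, z) = 0) :
    ∃ O ∈ 𝓝 c₀, ∀ c ∈ O, ∀ c' ∈ O, c.1 = c'.1 → α c = α c' := by
  obtain ⟨ε, hε, hball⟩ :=
    Metric.eventually_nhds_iff_ball.mp (hα.and (hker.eventually_nhds.and hd))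
  refine ⟨Metric.ball c₀ ε, Metric.ball_mem_nhds c₀ hε, ?_⟩
  rintro ⟨e, z⟩ hz ⟨_, z'⟩ hz' rfl
  rw [← ball_prod_same] at hz hz'
  have hslice : ∀ y ∈ Metric.ball c₀.2 ε, (e, y) ∈ Metric.ball c₀ ε := fun y hy => by
    rw [← ball_prod_same]
    exact ⟨hz.1, hy⟩
  refine eq_of_fderiv_inr_eq_zero Metric.isOpen_ball (convex_ball c₀.2 ε).isPreconnected
    (fun y hy => (hball _ (hslice y hy)).1) (fun y hy v => ?_) hz.2 hz'.2
  obtain ⟨hdiff, hzero, hclosed⟩ := hball _ (hslice y hy)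
  refine ContinuousLinearMap.ext fun w => ?_
  have hvw := hclosed v w
  rwa [fderiv_apply_eq_zero hdiff (hzero.mono fun c hc => hc v), sub_zero] at hvw

lemma exists_apply_pos {α : E →L[ℝ] ℝ} (hα : α ≠ 0) : ∃ w, 0 < α w :=
  (LinearMap.surjective (f := α.toLinearMap)
    (fun h => hα (ContinuousLinearMap.ext (LinearMap.congr_fun h))) 1).imp fun _ hw =>
    one_pos.trans_eq hw.symm

/-- Dividing `α` by its value on a fixed vector turns the hypothesis on `ker α` into that of
`exists_nhds_form_eq`. -/
lemma exists_nhds_form_eq_smul {α : E × F → E × F →L[ℝ] ℝ} {c₀ : E × F}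
    (hα : ∀ᶠ c in 𝓝 c₀, DifferentiableAt ℝ α c) (hα₀ : α c₀ ≠ 0)
    (hker : ∀ᶠ c in 𝓝 c₀, ∀ z, α c (0, z) = 0)
    (hd : ∀ᶠ c in 𝓝 c₀, ∀ z w, α c w = 0 →
      fderiv ℝ α c (0, z) w - fderiv ℝ α c w (0, z) = 0) :
    ∃ O ∈ 𝓝 c₀, ∀ c ∈ O, ∀ c' ∈ O, c.1 = c'.1 → ∃ t : ℝ, 0 < t ∧ α c = t • α c' := by
  obtain ⟨w₀, hw₀⟩ := exists_apply_pos hα₀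
  have hcont : ContinuousAt (fun c => α c w₀) c₀ :=
    hα.self_of_nhds.continuousAt.clm_apply continuousAt_const
  have hpos : ∀ᶠ c in 𝓝 c₀, 0 < α c w₀ := hcont.eventually (lt_mem_nhds hw₀)
  obtain ⟨O, hO, hconst⟩ : ∃ O ∈ 𝓝 c₀, ∀ c ∈ O, ∀ c' ∈ O, c.1 = c'.1 →
      (α c w₀)⁻¹ • α c = (α c' w₀)⁻¹ • α c' := by
    refine exists_nhds_form_eq (α := fun c => (α c w₀)⁻¹ • α c) ?_ ?_ ?_
    · filter_upwards [hα, hpos] with c hc hcw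
      exact ((hc.clm_apply (differentiableAt_const w₀)).inv hcw.ne').smul hc
    · filter_upwards [hker] with c hc z
      simp [hc z]
    · filter_upwards [hα, hpos, hker.eventually_nhds, hd] with c hc hcw hkerc hdc z w
      have hzero (v) : fderiv ℝ α c v (0, z) = 0 :=
        fderiv_apply_eq_zero hc (hkerc.mono fun c' hc' => hc' z) v
      have hproj := hdc z (w - (α c w / α c w₀) • w₀) (by simp [hcw.ne'])
      rw [hzero, sub_zero, map_sub, map_smul, smul_eq_mul, mul_comm] at hproj
      rw [fderiv_inv_smul_apply hc hcw.ne', fderiv_inv_smul_apply hc hcw.ne', hproj, hzero,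
        hkerc.self_of_nhds z]
      simp
  refine ⟨O ∩ {c | 0 < α c w₀}, Filter.inter_mem hO hpos, ?_⟩
  rintro c ⟨hc, hcw : 0 < α c w₀⟩ c' ⟨hc', hcw' : 0 < α c' w₀⟩ hcc'
  refine ⟨α c w₀ * (α c' w₀)⁻¹, by positivity, ?_⟩
  rw [mul_smul, ← hconst c hc c' hc' hcc', smul_inv_smul₀ hcw.ne']

end Rays

section Covectors

variable {m d r : ℕ}
  {M : Type*} [TopologicalSpace M] [ChartedSpace (Euc m) M]
  {N : Type*} [TopologicalSpace N] [ChartedSpace (Euc d) N]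
  {Q : Type*} [TopologicalSpace Q] [ChartedSpace (Euc r) Q]
  {η : ∀ x : M, TangentSpace (𝓡 m) x →L[ℝ] ℝ} {ι : N → M} {π : N → Q}

lemma finrank_tangentSpace (x : M) : Module.finrank ℝ (TangentSpace (𝓡 m) x) = m := by
  change Module.finrank ℝ (Euc m) = m
  simp

lemma IsContactForm.isContactPair (hη : IsContactForm η) (x : M) :
    IsContactPair (η x).toLinearMap (extD η x) := by
  obtain ⟨-, n, hn, h⟩ := hη
  obtain ⟨v, hv⟩ := h x
  exact isContactPair_of_wedgePow_ne_zero ((finrank_tangentSpace x).trans hn) (extD_isAlt x) hv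

lemma isContactForm_of_isContactPair [Nonempty M] (hη : IsSmoothForm η)
    (h : ∀ x, IsContactPair (η x).toLinearMap (extD η x)) : IsContactForm η := by
  refine ⟨hη, ?_⟩
  obtain ⟨n, hn, -⟩ := (h (Classical.arbitrary M)).exists_wedgePow_ne_zero
  rw [finrank_tangentSpace] at hn
  refine ⟨n, hn, fun x => ?_⟩
  obtain ⟨n', hn', hv⟩ := (h x).exists_wedgePow_ne_zero
  rw [finrank_tangentSpace] at hn'
  obtain rfl : n = n' := by omega
  exact hv

/-- The hypotheses of contact reduction: `ι : N → M` is a coisotropic submanifold without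
horizontal points of a contact manifold and `π : N → Q` is the quotient by its characteristic
distribution. -/
structure IsContactReduction (η : ∀ x : M, TangentSpace (𝓡 m) x →L[ℝ] ℝ) (ι : N → M)
    (π : N → Q) : Prop where
  contactForm : IsContactForm η
  coisotropic : IsCoisotropic (d := d) η ι
  nonhorizontal : ∀ x : N, ¬ IsHorizontal η (ι x) (tangentOf (d := d) ι x)
  leafQuotient : IsLeafQuotient (d := d) (r := r) (charDistribution η ι) π

namespace IsContactReduction

lemma contact (h : IsContactReduction (d := d) (r := r) η ι π) (x : M) :
    IsContactPair (η x).toLinearMap (extD η x) := h.contactForm.isContactPair x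

lemma exists_ne_zero (h : IsContactReduction (d := d) (r := r) η ι π) (x : N) :
    ∃ u, η (ι x) (mfderiv (𝓡 d) (𝓡 m) ι x u) ≠ 0 := by
  by_contra! hc
  refine h.nonhorizontal x (le_antisymm (fun v hv => ⟨hv, ?_⟩) inf_le_left)
  obtain ⟨u, rfl⟩ := hv
  exact hc u

lemma contMDiff_inclusion (h : IsContactReduction (d := d) (r := r) η ι π) :
    ContMDiff (𝓡 d) (𝓡 m) ∞ ι := h.coisotropic.1.contMDiff

lemma contMDiff_projection (h : IsContactReduction (d := d) (r := r) η ι π) :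
    ContMDiff (𝓡 d) (𝓡 r) ∞ π := h.leafQuotient.submersion.contMDiff

lemma mfderiv_projection_surjective (h : IsContactReduction (d := d) (r := r) η ι π) (x : N) :
    Function.Surjective (mfderiv (𝓡 d) (𝓡 r) π x) :=
  mfderiv_surjective_of_isSubmersionAt (h.leafQuotient.submersion.isSubmersionAt x)

lemma projection_surjective (h : IsContactReduction (d := d) (r := r) η ι π) :
    Function.Surjective π := fun q => (h.leafQuotient.connected_fibre q).1

lemma mfderiv_projection_eq_zero_iff (h : IsContactReduction (d := d) (r := r) η ι π) (x : N)
    (u : TangentSpace (𝓡 d) x) : mfderiv (𝓡 d) (𝓡 r) π x u = 0 ↔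
      η (ι x) (mfderiv (𝓡 d) (𝓡 m) ι x u) = 0 ∧
      ∀ w, η (ι x) (mfderiv (𝓡 d) (𝓡 m) ι x w) = 0 →
        extD η (ι x) (mfderiv (𝓡 d) (𝓡 m) ι x u) (mfderiv (𝓡 d) (𝓡 m) ι x w) = 0 := by
  have h1 : mfderiv (𝓡 d) (𝓡 r) π x u = 0 ↔
      u ∈ LinearMap.ker (mfderiv (𝓡 d) (𝓡 r) π x).toLinearMap := Iff.rfl
  rw [h1, h.leafQuotient.ker_eq x, charDistribution, Submodule.mem_comap, contactCompl,
    (h.contact (ι x)).mem_complement_iff]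
  refine and_congr Iff.rfl ⟨fun H w => H _ ⟨w, rfl⟩, ?_⟩
  rintro H _ ⟨w, rfl⟩
  exact H w

lemma extD_eq_zero_of_isVertical (h : IsContactReduction (d := d) (r := r) η ι π) {x : N}
    (hv : IsVertical η (ι x) (tangentOf (d := d) ι x)) {u : TangentSpace (𝓡 d) x}
    (hu : mfderiv (𝓡 d) (𝓡 r) π x u = 0) (w : TangentSpace (𝓡 d) x) :
    extD η (ι x) (mfderiv (𝓡 d) (𝓡 m) ι x u) (mfderiv (𝓡 d) (𝓡 m) ι x w) = 0 := by
  obtain ⟨hR, hΩR⟩ := (h.contact (ι x)).reeb_spec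
  have hmem : reeb (η (ι x)).toLinearMap (extD η (ι x)) ∈ tangentOf (d := d) ι x := by
    rw [hv]
    exact Submodule.mem_sup_right (Submodule.mem_span_singleton_self _)
  obtain ⟨ρ, hρ⟩ := hmem
  have hρ' : mfderiv (𝓡 d) (𝓡 m) ι x ρ = reeb (η (ι x)).toLinearMap (extD η (ι x)) := hρ
  set a := η (ι x) (mfderiv (𝓡 d) (𝓡 m) ι x w) with ha
  have hR' : η (ι x) (reeb (η (ι x)).toLinearMap (extD η (ι x))) = 1 := hR
  have h1 := ((h.mfderiv_projection_eq_zero_iff x u).mp hu).2 (w - a • ρ) (by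
    rw [map_sub, map_smul, hρ', map_sub, map_smul, hR', ← ha]
    simp)
  rw [map_sub, map_smul, hρ', map_sub, map_smul, ← (extD_isAlt (ι x)).neg (reeb _ _) _,
    hΩR, neg_zero, smul_zero, sub_zero] at h1
  exact h1

lemma exists_covector (h : IsContactReduction (d := d) (r := r) η ι π) :
    ∃ β : N → Euc r →L[ℝ] ℝ, ∀ x u, β x (mfderiv (𝓡 d) (𝓡 r) π x u) =
      η (ι x) (mfderiv (𝓡 d) (𝓡 m) ι x u) := by
  have hx (x) : ∃ β : Euc r →L[ℝ] ℝ, ∀ u, β (mfderiv (𝓡 d) (𝓡 r) π x u) =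
      η (ι x) (mfderiv (𝓡 d) (𝓡 m) ι x u) := by
    obtain ⟨s, hs⟩ := (mfderiv (𝓡 d) (𝓡 r) π x).toLinearMap.exists_rightInverse_of_surjective
      (LinearMap.range_eq_top.mpr (h.mfderiv_projection_surjective x))
    refine ⟨LinearMap.toContinuousLinearMap (E := Euc r) (((η (ι x)).comp
      (mfderiv (𝓡 d) (𝓡 m) ι x)).toLinearMap ∘ₗ s), fun u => ?_⟩
    have hsu : mfderiv (𝓡 d) (𝓡 r) π x (s (mfderiv (𝓡 d) (𝓡 r) π x u) - u) = 0 := by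
      rw [map_sub, sub_eq_zero]
      exact LinearMap.congr_fun hs _
    have hη := ((h.mfderiv_projection_eq_zero_iff x _).mp hsu).1
    rwa [map_sub, map_sub, sub_eq_zero] at hη
  choose β hβ using hx
  exact ⟨β, hβ⟩

section Coordinates

variable {F : Type*} [NormedAddCommGroup F] [NormedSpace ℝ F] {β : N → Euc r →L[ℝ] ℝ}
  {φ : OpenPartialHomeomorph N (Euc r × F)} {ψ : OpenPartialHomeomorph Q (Euc r)} {c : Euc r × F}

lemma pullForm_comp_symm_apply (h : IsContactReduction (d := d) (r := r) η ι π)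
    (hφψ : IsSubmersionChart (d := d) π φ ψ) (hc : c ∈ φ.target) (w : Euc r × F) :
    pullForm η (ι ∘ φ.symm) c w =
      η (ι (φ.symm c)) (mfderiv (𝓡 d) (𝓡 m) ι (φ.symm c)
        (mfderiv 𝓘(ℝ, Euc r × F) (𝓡 d) φ.symm c w)) :=
  pullForm_comp_apply (h.contMDiff_inclusion _) (hφψ.contMDiffAt_symm hc) w

lemma pullForm_comp_symm_apply_eq_covector (h : IsContactReduction (d := d) (r := r) η ι π)
    (hβ : ∀ x u, β x (mfderiv (𝓡 d) (𝓡 r) π x u) = η (ι x) (mfderiv (𝓡 d) (𝓡 m) ι x u))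
    (hφψ : IsSubmersionChart (d := d) π φ ψ) (hc : c ∈ φ.target) (w : Euc r × F) :
    pullForm η (ι ∘ φ.symm) c w =
      β (φ.symm c) (mfderiv 𝓘(ℝ, Euc r) (𝓡 r) ψ.symm c.1 w.1) := by
  rw [h.pullForm_comp_symm_apply hφψ hc, ← hβ]
  exact congrArg (β (φ.symm c)) (hφψ.mfderiv_projection_mfderiv_symm hc
    ((h.contMDiff_projection _).mdifferentiableAt (by simp)) w)

lemma covector_eq_smul_of_pullForm_eq_smul (h : IsContactReduction (d := d) (r := r) η ι π)
    (hβ : ∀ x u, β x (mfderiv (𝓡 d) (𝓡 r) π x u) = η (ι x) (mfderiv (𝓡 d) (𝓡 m) ι x u))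
    (hφψ : IsSubmersionChart (d := d) π φ ψ) {x y : N} (hx : x ∈ φ.source) (hy : y ∈ φ.source)
    (hxy : (φ x).1 = (φ y).1) {t : ℝ}
    (ht : pullForm η (ι ∘ φ.symm) (φ x) = t • pullForm η (ι ∘ φ.symm) (φ y)) :
    β x = t • β y := by
  refine ContinuousLinearMap.ext fun v => ?_
  obtain ⟨w, rfl⟩ := hφψ.mfderiv_base_symm_surjective (φ.map_source hx) v
  have hw := congrArg (fun A : Euc r × F →L[ℝ] ℝ => A (w, 0)) ht
  simp only [smul_apply] at hw
  rw [h.pullForm_comp_symm_apply_eq_covector hβ hφψ (φ.map_source hx),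
    h.pullForm_comp_symm_apply_eq_covector hβ hφψ (φ.map_source hy), φ.left_inv hx,
    φ.left_inv hy, ← hxy] at hw
  exact hw

lemma mfderiv_projection_mfderiv_symm_inr (h : IsContactReduction (d := d) (r := r) η ι π)
    (hφψ : IsSubmersionChart (d := d) π φ ψ) (hc : c ∈ φ.target) (z : F) :
    mfderiv (𝓡 d) (𝓡 r) π (φ.symm c) (mfderiv 𝓘(ℝ, Euc r × F) (𝓡 d) φ.symm c (0, z)) = 0 :=
  (hφψ.mfderiv_projection_mfderiv_symm hc
    ((h.contMDiff_projection _).mdifferentiableAt (by simp)) (0, z)).trans (map_zero _)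

lemma pullForm_comp_symm_apply_inr (h : IsContactReduction (d := d) (r := r) η ι π)
    (hφψ : IsSubmersionChart (d := d) π φ ψ) (hc : c ∈ φ.target) (z : F) :
    pullForm η (ι ∘ φ.symm) c (0, z) = 0 := by
  rw [h.pullForm_comp_symm_apply hφψ hc]
  exact ((h.mfderiv_projection_eq_zero_iff _ _).mp
    (h.mfderiv_projection_mfderiv_symm_inr hφψ hc z)).1

lemma pullForm_comp_symm_ne_zero (h : IsContactReduction (d := d) (r := r) η ι π)
    (hφψ : IsSubmersionChart (d := d) π φ ψ) {x : N} (hx : x ∈ φ.source) :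
    pullForm η (ι ∘ φ.symm) (φ x) ≠ 0 := by
  intro hzero
  obtain ⟨β, hβ⟩ := h.exists_covector
  have hβx : β x = (0 : ℝ) • β x := h.covector_eq_smul_of_pullForm_eq_smul hβ hφψ hx hx rfl
    (by rw [hzero, smul_zero])
  obtain ⟨u, hu⟩ := h.exists_ne_zero x
  rw [← hβ, hβx, zero_smul] at hu
  exact hu rfl

variable [IsManifold (𝓡 m) ∞ M]

lemma differentiableAt_pullForm_comp_symm (h : IsContactReduction (d := d) (r := r) η ι π)
    (hφψ : IsSubmersionChart (d := d) π φ ψ) (hc : c ∈ φ.target) :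
    DifferentiableAt ℝ (pullForm η (ι ∘ φ.symm)) c :=
  (h.contactForm.1.contDiffAt_pullForm
    ((h.contMDiff_inclusion _).comp c (hφψ.contMDiffAt_symm hc))).differentiableAt (by simp)

lemma fderiv_pullForm_comp_symm_sub (h : IsContactReduction (d := d) (r := r) η ι π)
    (hφψ : IsSubmersionChart (d := d) π φ ψ) (hc : c ∈ φ.target) (v w : Euc r × F) :
    fderiv ℝ (pullForm η (ι ∘ φ.symm)) c v w - fderiv ℝ (pullForm η (ι ∘ φ.symm)) c w v =
      extD η (ι (φ.symm c))
        (mfderiv (𝓡 d) (𝓡 m) ι (φ.symm c) (mfderiv 𝓘(ℝ, Euc r × F) (𝓡 d) φ.symm c v))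
        (mfderiv (𝓡 d) (𝓡 m) ι (φ.symm c) (mfderiv 𝓘(ℝ, Euc r × F) (𝓡 d) φ.symm c w)) := by
  rw [h.contactForm.1.fderiv_pullForm_sub
    ((h.contMDiff_inclusion _).comp c (hφψ.contMDiffAt_symm hc))]
  exact congrArg₂ (fun a b => extD η (ι (φ.symm c)) a b)
    (mfderiv_comp_apply_of_contMDiffAt (h.contMDiff_inclusion _) (hφψ.contMDiffAt_symm hc) v)
    (mfderiv_comp_apply_of_contMDiffAt (h.contMDiff_inclusion _) (hφψ.contMDiffAt_symm hc) w)

end Coordinates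

variable [IsManifold (𝓡 m) ∞ M] {β : N → Euc r →L[ℝ] ℝ}

lemma eventually_covector_eq_smul (h : IsContactReduction (d := d) (r := r) η ι π)
    (hβ : ∀ x u, β x (mfderiv (𝓡 d) (𝓡 r) π x u) = η (ι x) (mfderiv (𝓡 d) (𝓡 m) ι x u))
    (x₀ : N) : ∀ᶠ x in 𝓝 x₀, π x = π x₀ → ∃ t : ℝ, 0 < t ∧ β x = t • β x₀ := by
  obtain ⟨F, _, _, φ, ψ, hx₀, hφψ⟩ :=
    exists_isSubmersionChart (h.leafQuotient.submersion.isSubmersionAt x₀)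
  have htarget := φ.open_target.mem_nhds (φ.map_source hx₀)
  obtain ⟨O, hO, hray⟩ := exists_nhds_form_eq_smul
    (Filter.eventually_of_mem htarget fun c hc => h.differentiableAt_pullForm_comp_symm hφψ hc)
    (h.pullForm_comp_symm_ne_zero hφψ hx₀)
    (Filter.eventually_of_mem htarget fun c hc => h.pullForm_comp_symm_apply_inr hφψ hc)
    (Filter.eventually_of_mem htarget fun c hc z w hw => by
      rw [h.pullForm_comp_symm_apply hφψ hc] at hw
      rw [h.fderiv_pullForm_comp_symm_sub hφψ hc]
      exact ((h.mfderiv_projection_eq_zero_iff _ _).mp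
        (h.mfderiv_projection_mfderiv_symm_inr hφψ hc z)).2 _ hw)
  filter_upwards [φ.open_source.mem_nhds hx₀, (φ.continuousAt hx₀) hO] with x hx hxO hπx
  have hfst : (φ x).1 = (φ x₀).1 := by
    rw [← hφψ.apply_projection x hx, ← hφψ.apply_projection x₀ hx₀, hπx]
  obtain ⟨t, ht, hαt⟩ := hray _ hxO _ (mem_of_mem_nhds hO) hfst
  exact ⟨t, ht, h.covector_eq_smul_of_pullForm_eq_smul hβ hφψ hx hx₀ hfst hαt⟩

lemma eventually_covector_eq_of_isVertical (h : IsContactReduction (d := d) (r := r) η ι π)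
    (hβ : ∀ x u, β x (mfderiv (𝓡 d) (𝓡 r) π x u) = η (ι x) (mfderiv (𝓡 d) (𝓡 m) ι x u))
    (hv : ∀ x : N, IsVertical η (ι x) (tangentOf (d := d) ι x)) (x₀ : N) :
    ∀ᶠ x in 𝓝 x₀, π x = π x₀ → β x = β x₀ := by
  obtain ⟨F, _, _, φ, ψ, hx₀, hφψ⟩ :=
    exists_isSubmersionChart (h.leafQuotient.submersion.isSubmersionAt x₀)
  have htarget := φ.open_target.mem_nhds (φ.map_source hx₀)
  obtain ⟨O, hO, hconst⟩ := exists_nhds_form_eq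
    (Filter.eventually_of_mem htarget fun c hc => h.differentiableAt_pullForm_comp_symm hφψ hc)
    (Filter.eventually_of_mem htarget fun c hc => h.pullForm_comp_symm_apply_inr hφψ hc)
    (Filter.eventually_of_mem htarget fun c hc z w => by
      rw [h.fderiv_pullForm_comp_symm_sub hφψ hc]
      exact h.extD_eq_zero_of_isVertical (hv _) (h.mfderiv_projection_mfderiv_symm_inr hφψ hc z) _)
  filter_upwards [φ.open_source.mem_nhds hx₀, (φ.continuousAt hx₀) hO] with x hx hxO hπx
  have hfst : (φ x).1 = (φ x₀).1 := by
    rw [← hφψ.apply_projection x hx, ← hφψ.apply_projection x₀ hx₀, hπx]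
  have hα := hconst _ hxO _ (mem_of_mem_nhds hO) hfst
  rw [← one_smul ℝ (β x₀)]
  exact h.covector_eq_smul_of_pullForm_eq_smul hβ hφψ hx hx₀ hfst (by rw [hα, one_smul])

lemma exists_covector_eq_smul (h : IsContactReduction (d := d) (r := r) η ι π)
    (hβ : ∀ x u, β x (mfderiv (𝓡 d) (𝓡 r) π x u) = η (ι x) (mfderiv (𝓡 d) (𝓡 m) ι x u))
    {x y : N} (hxy : π x = π y) : ∃ t : ℝ, 0 < t ∧ β x = t • β y := by
  have hsymm {x y : N} : (∃ t : ℝ, 0 < t ∧ β x = t • β y) → ∃ t : ℝ, 0 < t ∧ β y = t • β x := by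
    rintro ⟨t, ht, hxy⟩
    exact ⟨t⁻¹, by positivity, by rw [hxy, inv_smul_smul₀ ht.ne']⟩
  refine (h.leafQuotient.connected_fibre (π y)).isPreconnected.induction₂
    (fun x y => ∃ t : ℝ, 0 < t ∧ β x = t • β y) (fun x hx => ?_) (fun x y z _ _ _ => ?_)
    (fun x y _ _ => hsymm) hxy rfl
  · filter_upwards [mem_nhdsWithin_of_mem_nhds (h.eventually_covector_eq_smul hβ x),
      self_mem_nhdsWithin] with z hz hzf
    exact hsymm (hz (Eq.trans hzf (Eq.symm hx)))
  · rintro ⟨t, ht, hxy⟩ ⟨t', ht', hyz⟩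
    exact ⟨t * t', by positivity, by rw [hxy, hyz, smul_smul]⟩

lemma covector_eq_of_isVertical (h : IsContactReduction (d := d) (r := r) η ι π)
    (hβ : ∀ x u, β x (mfderiv (𝓡 d) (𝓡 r) π x u) = η (ι x) (mfderiv (𝓡 d) (𝓡 m) ι x u))
    (hv : ∀ x : N, IsVertical η (ι x) (tangentOf (d := d) ι x))
    {x y : N} (hxy : π x = π y) : β x = β y := by
  refine (h.leafQuotient.connected_fibre (π y)).isPreconnected.induction₂
    (fun x y => β x = β y) (fun x hx => ?_) (fun x y z _ _ _ => Eq.trans)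
    (fun x y _ _ => Eq.symm) hxy rfl
  filter_upwards [mem_nhdsWithin_of_mem_nhds (h.eventually_covector_eq_of_isVertical hβ hv x),
    self_mem_nhdsWithin] with z hz hzf
  exact (hz (Eq.trans hzf (Eq.symm hx))).symm

end IsContactReduction

end Covectors

section ReducedForms

variable {m d r : ℕ}
  {M : Type*} [TopologicalSpace M] [ChartedSpace (Euc m) M]
  {N : Type*} [TopologicalSpace N] [ChartedSpace (Euc d) N]
  {Q : Type*} [TopologicalSpace Q] [ChartedSpace (Euc r) Q]
  {η : ∀ x : M, TangentSpace (𝓡 m) x →L[ℝ] ℝ} {ι : N → M} {π : N → Q}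
  {β : N → Euc r →L[ℝ] ℝ} {θ θ' ηQ : ∀ q : Q, TangentSpace (𝓡 r) q →L[ℝ] ℝ} {q : Q} {f : N → ℝ}
  {E : Type*} [NormedAddCommGroup E] [NormedSpace ℝ E]

/-- The one-form `θ` is smooth near `q`, in every preferred chart around `q`. It serves to check
locally that a one-form is smooth. -/
def IsSmoothFormAt (θ : ∀ q : Q, TangentSpace (𝓡 r) q →L[ℝ] ℝ) (q : Q) : Prop :=
  ∀ q₀ : Q, q ∈ (extChartAt (𝓡 r) q₀).source →
    ContDiffAt ℝ ∞ (chartForm θ q₀) (extChartAt (𝓡 r) q₀ q)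

lemma isSmoothForm_of_isSmoothFormAt (h : ∀ q, IsSmoothFormAt θ q) : IsSmoothForm θ := by
  intro q₀ e he
  have hsmooth := h _ q₀ ((extChartAt (𝓡 r) q₀).map_target he)
  rw [(extChartAt (𝓡 r) q₀).right_inv he] at hsmooth
  exact hsmooth.contDiffWithinAt

lemma contMDiffAt_extChartAt_symm [IsManifold (𝓡 r) ∞ Q] {q₀ : Q} {e : Euc r}
    (he : e ∈ (extChartAt (𝓡 r) q₀).target) :
    ContMDiffAt 𝓘(ℝ, Euc r) (𝓡 r) ∞ (extChartAt (𝓡 r) q₀).symm e :=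
  (contMDiffOn_extChartAt_symm q₀).contMDiffAt ((isOpen_extChartAt_target q₀).mem_nhds he)

lemma eventually_extChartAt_symm {q₀ : Q} (hq : q ∈ (extChartAt (𝓡 r) q₀).source)
    {p : Q → Prop} (hp : ∀ᶠ q' in 𝓝 q, p q') :
    ∀ᶠ e in 𝓝 (extChartAt (𝓡 r) q₀ q), p ((extChartAt (𝓡 r) q₀).symm e) := by
  have hcont := continuousAt_extChartAt_symm' hq
  rw [ContinuousAt, (extChartAt (𝓡 r) q₀).left_inv hq] at hcont
  exact hcont.eventually hp

lemma IsSmoothFormAt.congr (h : IsSmoothFormAt θ q) (hθ : ∀ᶠ q' in 𝓝 q, θ' q' = θ q') :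
    IsSmoothFormAt θ' q := by
  intro q₀ hq
  refine (h q₀ hq).congr_of_eventuallyEq ?_
  filter_upwards [eventually_extChartAt_symm hq hθ] with e he
  rw [chartForm, he, chartForm]

lemma isSmoothFormAt_finsum_smul [IsManifold (𝓡 r) ∞ Q] {κ : Type*}
    (ρ : SmoothPartitionOfUnity κ (𝓡 r) Q) {θ : κ → ∀ q : Q, TangentSpace (𝓡 r) q →L[ℝ] ℝ}
    (hθ : ∀ i, q ∈ tsupport (ρ i) → IsSmoothFormAt (θ i) q) :
    IsSmoothFormAt (fun q => ∑ᶠ i, ρ i q • θ i q) q := by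
  intro q₀ hq
  have he := (extChartAt (𝓡 r) q₀).map_source hq
  have hchart : ContMDiffAt (𝓡 r) 𝓘(ℝ, Euc r) ∞ (extChartAt (𝓡 r) q₀) q :=
    contMDiffAt_extChartAt' (by simpa using hq)
  have hsum : ContMDiffAt (𝓡 r) 𝓘(ℝ, Euc r →L[ℝ] ℝ) ∞
      (fun q' => ∑ᶠ i, ρ i q' • chartForm (θ i) q₀ (extChartAt (𝓡 r) q₀ q'))
      ((extChartAt (𝓡 r) q₀).symm (extChartAt (𝓡 r) q₀ q)) := by
    rw [(extChartAt (𝓡 r) q₀).left_inv hq]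
    exact ρ.contMDiffAt_finsum fun i hi => (hθ i hi q₀ hq).contMDiffAt.comp q hchart
  refine (hsum.comp _ (contMDiffAt_extChartAt_symm he)).contDiffAt.congr_of_eventuallyEq ?_
  filter_upwards [(isOpen_extChartAt_target q₀).mem_nhds he] with e he
  let precomp : (Euc r →L[ℝ] ℝ) →L[ℝ] (Euc r →L[ℝ] ℝ) := (ContinuousLinearMap.compL ℝ (Euc r)
    (Euc r) ℝ).flip (mfderiv 𝓘(ℝ, Euc r) (𝓡 r) (extChartAt (𝓡 r) q₀).symm e)
  have hfinite : (Function.support fun i => (ρ i ((extChartAt (𝓡 r) q₀).symm e) •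
      θ i ((extChartAt (𝓡 r) q₀).symm e) : Euc r →L[ℝ] ℝ)).Finite :=
    (ρ.locallyFinite.point_finite _).subset fun i hi h0 => hi (smul_eq_zero_of_left h0 _)
  refine (map_finsum precomp hfinite).trans (finsum_congr fun i => ?_)
  rw [(extChartAt (𝓡 r) q₀).right_inv he]
  exact map_smul precomp _ _

lemma IsSmoothForm.isSmoothFormAt_comp_mfderiv [IsManifold (𝓡 m) ∞ M] [IsManifold (𝓡 r) ∞ Q]
    (hη : IsSmoothForm η) {k : Q → M} {U : Set Q} (hU : IsOpen U)
    (hk : ContMDiffOn (𝓡 r) (𝓡 m) ∞ k U) (hq : q ∈ U) :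
    IsSmoothFormAt (fun q => (η (k q)).comp (mfderiv (𝓡 r) (𝓡 m) k q)) q := by
  intro q₀ hq₀
  have he := (extChartAt (𝓡 r) q₀).map_source hq₀
  have hkq := eventually_extChartAt_symm hq₀ (hU.eventually_mem hq)
  have hkat {q : Q} (hq : q ∈ U) := hk.contMDiffAt (hU.mem_nhds hq)
  refine (hη.contDiffAt_pullForm ((hkat hkq.self_of_nhds).comp _
    (contMDiffAt_extChartAt_symm he))).congr_of_eventuallyEq ?_
  filter_upwards [(isOpen_extChartAt_target q₀).mem_nhds he, hkq] with e he heU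
  exact ContinuousLinearMap.ext fun v =>
    (pullForm_comp_apply (hkat heU) (contMDiffAt_extChartAt_symm he) v).symm

lemma IsReducedForm.apply_eq (h : IsReducedForm (d := d) η ι π f ηQ) (x : N)
    (u : TangentSpace (𝓡 d) x) : ηQ (π x) (mfderiv (𝓡 d) (𝓡 r) π x u) =
      f x * η (ι x) (mfderiv (𝓡 d) (𝓡 m) ι x u) :=
  congrArg (fun A : TangentSpace (𝓡 d) x →L[ℝ] ℝ => A u) (h.pullback_eq x)

lemma mfderiv_extChartAt_symm_surjective [IsManifold (𝓡 r) ∞ Q] {q₀ : Q} {e : Euc r}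
    (he : e ∈ (extChartAt (𝓡 r) q₀).target) :
    Function.Surjective (mfderiv 𝓘(ℝ, Euc r) (𝓡 r) (extChartAt (𝓡 r) q₀).symm e) := by
  have hinvertible := isInvertible_mfderivWithin_extChartAt_symm (I := 𝓡 r) he
  rw [modelWithCornersSelf_coe, Set.range_id, mfderivWithin_univ] at hinvertible
  exact hinvertible.bijective.surjective

lemma exists_local_parametrization [IsManifold (𝓡 d) ∞ N] (x : N) :
    ∃ (g : Euc d → N) (e : Euc d), g e = x ∧
      (∀ᶠ e' in 𝓝 e, ContMDiffAt 𝓘(ℝ, Euc d) (𝓡 d) ∞ g e') ∧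
      Function.Surjective (mfderiv 𝓘(ℝ, Euc d) (𝓡 d) g e) :=
  ⟨(extChartAt (𝓡 d) x).symm, extChartAt (𝓡 d) x x, extChartAt_to_inv x,
    Filter.eventually_of_mem (extChartAt_target_mem_nhds x)
      fun _ he => contMDiffAt_extChartAt_symm he,
    mfderiv_extChartAt_symm_surjective (mem_extChartAt_target x)⟩

lemma convex_setOf_eq_pos_smul (v : E) : Convex ℝ {w : E | ∃ t : ℝ, 0 < t ∧ w = t • v} := by
  rintro _ ⟨t, ht, rfl⟩ _ ⟨t', ht', rfl⟩ a b ha hb hab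
  refine ⟨a * t + b * t', ?_, by rw [smul_smul, smul_smul, add_smul]⟩
  exact convex_Ioi (0 : ℝ) ht ht' ha hb hab

lemma fderiv_sub_of_eventuallyEq_smul {α α' : E → E →L[ℝ] ℝ} {c : E → ℝ} {e a b : E}
    (hα : DifferentiableAt ℝ α e) (hc : DifferentiableAt ℝ c e)
    (hα' : α' =ᶠ[𝓝 e] fun e' => c e' • α e') (ha : α e a = 0) (hb : α e b = 0) :
    fderiv ℝ α' e a b - fderiv ℝ α' e b a = c e * (fderiv ℝ α e a b - fderiv ℝ α e b a) := by
  have hsmul : HasFDerivAt (fun e' => c e' • α e') _ e := hc.hasFDerivAt.smul hα.hasFDerivAt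
  rw [(hsmul.congr_of_eventuallyEq hα').fderiv]
  simp only [add_apply, smul_apply, ContinuousLinearMap.smulRight_apply, smul_eq_mul, ha, hb,
    mul_zero, add_zero, mul_sub]

variable [IsManifold (𝓡 m) ∞ M] [IsManifold (𝓡 r) ∞ Q]

lemma IsContactReduction.isSmoothFormAt_covector_section
    (h : IsContactReduction (d := d) (r := r) η ι π)
    (hβ : ∀ x u, β x (mfderiv (𝓡 d) (𝓡 r) π x u) = η (ι x) (mfderiv (𝓡 d) (𝓡 m) ι x u))
    {s : Q → N} {U : Set Q} (hU : IsOpen U) (hs : ContMDiffOn (𝓡 r) (𝓡 d) ∞ s U)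
    (hπs : ∀ q ∈ U, π (s q) = q) (hq : q ∈ U) :
    IsSmoothFormAt (fun q => (β (s q) : TangentSpace (𝓡 r) q →L[ℝ] ℝ)) q := by
  refine (h.contactForm.1.isSmoothFormAt_comp_mfderiv hU
    (h.contMDiff_inclusion.comp_contMDiffOn hs) hq).congr ?_
  filter_upwards [hU.mem_nhds hq] with q hq
  have hsq := hs.contMDiffAt (hU.mem_nhds hq)
  refine ContinuousLinearMap.ext fun v => ?_
  have hv : mfderiv (𝓡 d) (𝓡 r) π (s q) (mfderiv (𝓡 r) (𝓡 d) s q v) = v :=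
    mfderiv_mfderiv_of_comp_eventuallyEq_id (h.contMDiff_projection _) hsq
      (Filter.eventually_of_mem (hU.mem_nhds hq) hπs) v
  calc β (s q) v
      = β (s q) (mfderiv (𝓡 d) (𝓡 r) π (s q) (mfderiv (𝓡 r) (𝓡 d) s q v)) :=
        congrArg (β (s q)) hv.symm
    _ = η (ι (s q)) (mfderiv (𝓡 d) (𝓡 m) ι (s q) (mfderiv (𝓡 r) (𝓡 d) s q v)) := hβ _ _
    _ = η (ι (s q)) (mfderiv (𝓡 r) (𝓡 m) (ι ∘ s) q v) :=
        congrArg (η (ι (s q))) (mfderiv_comp_apply q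
          ((h.contMDiff_inclusion (s q)).mdifferentiableAt (by simp))
          (hsq.mdifferentiableAt (by simp)) v).symm

variable [IsManifold (𝓡 d) ∞ N]

lemma contMDiff_factor (hη : IsSmoothForm η) (hηQ : IsSmoothForm ηQ)
    (hι : ContMDiff (𝓡 d) (𝓡 m) ∞ ι) (hπ : ContMDiff (𝓡 d) (𝓡 r) ∞ π)
    (hne : ∀ x, ∃ u, η (ι x) (mfderiv (𝓡 d) (𝓡 m) ι x u) ≠ 0)
    (hf : ∀ x u, ηQ (π x) (mfderiv (𝓡 d) (𝓡 r) π x u) =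
      f x * η (ι x) (mfderiv (𝓡 d) (𝓡 m) ι x u)) :
    ContMDiff (𝓡 d) 𝓘(ℝ, ℝ) ∞ f := by
  intro x
  have hx := mem_extChartAt_target (I := 𝓡 d) x
  rw [contMDiffAt_iff_source, modelWithCornersSelf_coe, Set.range_id, contMDiffWithinAt_univ]
  set e := extChartAt (𝓡 d) x x
  let g := (extChartAt (𝓡 d) x).symm
  obtain ⟨u, hu⟩ := hne (g e)
  obtain ⟨w, rfl⟩ := mfderiv_extChartAt_symm_surjective hx u
  have hw : pullForm η (ι ∘ g) e w ≠ 0 :=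
    (pullForm_comp_apply (hι _) (contMDiffAt_extChartAt_symm hx) w).trans_ne hu
  have hnum : ContDiffAt ℝ ∞ (fun e' => pullForm ηQ (π ∘ g) e' w) e :=
    (hηQ.contDiffAt_pullForm ((hπ _).comp _ (contMDiffAt_extChartAt_symm hx))).clm_apply
      contDiffAt_const
  have hdenom : ContDiffAt ℝ ∞ (fun e' => pullForm η (ι ∘ g) e' w) e :=
    (hη.contDiffAt_pullForm ((hι _).comp _ (contMDiffAt_extChartAt_symm hx))).clm_apply
      contDiffAt_const
  refine ((hnum.div hdenom hw).congr_of_eventuallyEq ?_).contMDiffAt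
  filter_upwards [extChartAt_target_mem_nhds x, hdenom.continuousAt.eventually_ne hw]
    with e' he' hne'
  have hge' := contMDiffAt_extChartAt_symm he'
  exact eq_div_of_mul_eq hne' (((congrArg (f (g e') * ·) (pullForm_comp_apply (hι _) hge' w)).trans
    (hf _ _).symm).trans (pullForm_comp_apply (hπ _) hge' w).symm)

lemma IsReducedForm.extD_eq (h : IsReducedForm (d := d) η ι π f ηQ) (hη : IsSmoothForm η)
    (hι : ContMDiff (𝓡 d) (𝓡 m) ∞ ι) (hπ : ContMDiff (𝓡 d) (𝓡 r) ∞ π)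
    (x : N) (u w : TangentSpace (𝓡 d) x)
    (hu : η (ι x) (mfderiv (𝓡 d) (𝓡 m) ι x u) = 0)
    (hw : η (ι x) (mfderiv (𝓡 d) (𝓡 m) ι x w) = 0) :
    extD ηQ (π x) (mfderiv (𝓡 d) (𝓡 r) π x u) (mfderiv (𝓡 d) (𝓡 r) π x w) =
      f x * extD η (ι x) (mfderiv (𝓡 d) (𝓡 m) ι x u) (mfderiv (𝓡 d) (𝓡 m) ι x w) := by
  obtain ⟨g, e, rfl, hg, hsurj⟩ := exists_local_parametrization (d := d) x
  obtain ⟨a, rfl⟩ := hsurj u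
  obtain ⟨b, rfl⟩ := hsurj w
  have hge := hg.self_of_nhds
  have hιg := (hι (g e)).comp e hge
  have hπg := (hπ (g e)).comp e hge
  have hform : pullForm ηQ (π ∘ g) =ᶠ[𝓝 e] fun e' => f (g e') • pullForm η (ι ∘ g) e' := by
    filter_upwards [hg] with e' he'
    refine ContinuousLinearMap.ext fun v => ?_
    rw [pullForm_comp_apply (hπ _) he', smul_apply, pullForm_comp_apply (hι _) he',
      h.apply_eq, smul_eq_mul]
  have hdform := fderiv_sub_of_eventuallyEq_smul
    ((hη.contDiffAt_pullForm hιg).differentiableAt (by simp))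
    (((h.smooth_factor (g e)).comp e hge).contDiffAt.differentiableAt (by simp)) hform
    ((pullForm_comp_apply (hι _) hge a).trans hu) ((pullForm_comp_apply (hι _) hge b).trans hw)
  replace hdform := (h.smooth.fderiv_pullForm_sub hπg a b).symm.trans
    (hdform.trans (congrArg (f (g e) * ·) (hη.fderiv_pullForm_sub hιg a b)))
  have hleft := congrArg₂ (fun a b => extD ηQ (π (g e)) a b)
    (mfderiv_comp_apply_of_contMDiffAt (hπ _) hge a)
    (mfderiv_comp_apply_of_contMDiffAt (hπ _) hge b)
  have hright := congrArg₂ (fun a b => extD η (ι (g e)) a b)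
    (mfderiv_comp_apply_of_contMDiffAt (hι _) hge a)
    (mfderiv_comp_apply_of_contMDiffAt (hι _) hge b)
  exact (hleft.symm.trans hdform).trans (congrArg (f (g e) * ·) hright)

namespace IsContactReduction

lemma isLinearReduction (h : IsContactReduction (d := d) (r := r) η ι π)
    (hQ : IsReducedForm (d := d) η ι π f ηQ) (x : N) :
    IsLinearReduction (η (ι x)).toLinearMap (extD η (ι x))
      (mfderiv (𝓡 d) (𝓡 m) ι x).toLinearMap (mfderiv (𝓡 d) (𝓡 r) π x).toLinearMap
      (ηQ (π x)).toLinearMap (extD ηQ (π x)) (f x) where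
  contact := h.contact (ι x)
  isAlt := extD_isAlt (π x)
  coisotropic := h.coisotropic.2 x
  nonhorizontal := h.exists_ne_zero x
  surjective := h.mfderiv_projection_surjective x
  ker_eq := h.leafQuotient.ker_eq x
  ne_zero := hQ.factor_ne_zero x
  form_eq := hQ.apply_eq x
  deriv_eq := hQ.extD_eq h.contactForm.1 h.contMDiff_inclusion h.contMDiff_projection x

lemma isContactPair_reduced (h : IsContactReduction (d := d) (r := r) η ι π)
    (hQ : IsReducedForm (d := d) η ι π f ηQ) (q : Q) :
    IsContactPair (ηQ q).toLinearMap (extD ηQ q) := by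
  obtain ⟨x, rfl⟩ := h.projection_surjective q
  exact (h.isLinearReduction hQ x).isContactPair

lemma isContactForm_reduced [Nonempty N] (h : IsContactReduction (d := d) (r := r) η ι π)
    (hQ : IsReducedForm (d := d) η ι π f ηQ) : IsContactForm ηQ := by
  have : Nonempty Q := ⟨π (Classical.arbitrary N)⟩
  exact isContactForm_of_isContactPair hQ.smooth (h.isContactPair_reduced hQ)

lemma isReducedForm_of_apply_eq (h : IsContactReduction (d := d) (r := r) η ι π)
    (hηQ : IsSmoothForm ηQ) (hne : ∀ x, f x ≠ 0)
    (hf : ∀ x u, ηQ (π x) (mfderiv (𝓡 d) (𝓡 r) π x u) =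
      f x * η (ι x) (mfderiv (𝓡 d) (𝓡 m) ι x u)) :
    IsReducedForm (d := d) η ι π f ηQ where
  smooth := hηQ
  smooth_factor := contMDiff_factor h.contactForm.1 hηQ h.contMDiff_inclusion
    h.contMDiff_projection h.exists_ne_zero hf
  factor_ne_zero := hne
  pullback_eq x := ContinuousLinearMap.ext (hf x)

lemma existsUnique_reduced_of_isVertical (h : IsContactReduction (d := d) (r := r) η ι π)
    (hv : ∀ x : N, IsVertical η (ι x) (tangentOf (d := d) ι x)) :
    ∃! ηQ : ∀ q : Q, TangentSpace (𝓡 r) q →L[ℝ] ℝ,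
      IsReducedForm (d := d) η ι π (fun _ => 1) ηQ := by
  obtain ⟨β, hβ⟩ := h.exists_covector
  choose σ hσ using h.projection_surjective
  have hβσ (x) : β (σ (π x)) = β x := h.covector_eq_of_isVertical hβ hv (hσ (π x))
  refine ⟨fun q => β (σ q), h.isReducedForm_of_apply_eq
    (isSmoothForm_of_isSmoothFormAt fun q => ?_) (fun _ => one_ne_zero) (fun x u => ?_),
    fun ηQ hηQ => ?_⟩
  · obtain ⟨U, s, hU, hqU, -, hs, hπs⟩ :=
      exists_local_section (h.leafQuotient.submersion.isSubmersionAt (σ q))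
    rw [hσ] at hqU
    refine (h.isSmoothFormAt_covector_section hβ hU hs hπs hqU).congr ?_
    filter_upwards [hU.mem_nhds hqU] with q' hq'
    exact h.covector_eq_of_isVertical hβ hv ((hσ q').trans (hπs q' hq').symm)
  · rw [one_mul, ← hβ x u]
    exact congrArg (fun A : Euc r →L[ℝ] ℝ => A (mfderiv (𝓡 d) (𝓡 r) π x u)) (hβσ x)
  · funext q
    obtain ⟨x, rfl⟩ := h.projection_surjective q
    refine ContinuousLinearMap.ext fun v => ?_
    obtain ⟨u, rfl⟩ := h.mfderiv_projection_surjective x v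
    rw [hηQ.apply_eq, one_mul, ← hβ x u]
    exact (congrArg (fun A : Euc r →L[ℝ] ℝ => A (mfderiv (𝓡 d) (𝓡 r) π x u)) (hβσ x)).symm

lemma exists_reduced [T2Space Q] [SecondCountableTopology Q]
    (h : IsContactReduction (d := d) (r := r) η ι π) :
    ∃ (f : N → ℝ) (ηQ : ∀ q : Q, TangentSpace (𝓡 r) q →L[ℝ] ℝ),
      IsReducedForm (d := d) η ι π f ηQ := by
  obtain ⟨β, hβ⟩ := h.exists_covector
  have hsection (q : Q) : ∃ (U : Set Q) (s : Q → N), IsOpen U ∧ q ∈ U ∧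
      ContMDiffOn (𝓡 r) (𝓡 d) ∞ s U ∧ ∀ q ∈ U, π (s q) = q := by
    obtain ⟨x, rfl⟩ := h.projection_surjective q
    obtain ⟨U, s, hU, hxU, -, hs, hπs⟩ :=
      exists_local_section (h.leafQuotient.submersion.isSubmersionAt x)
    exact ⟨U, s, hU, hxU, hs, hπs⟩
  choose U s hU hqU hs hπs using hsection
  have : LocallyCompactSpace Q := ChartedSpace.locallyCompactSpace (Euc r) Q
  obtain ⟨ρ, hρ⟩ := SmoothPartitionOfUnity.exists_isSubordinate (𝓡 r) isClosed_univ U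
    hU (fun q _ => Set.mem_iUnion.mpr ⟨q, hqU q⟩)
  have hray (x : N) : ∃ t : ℝ, 0 < t ∧ ∑ᶠ i, ρ i (π x) • β (s i (π x)) = t • β x :=
    ρ.finsum_smul_mem_convex (g := fun i q => β (s i q)) (Set.mem_univ (π x))
      (fun i hi => h.exists_covector_eq_smul hβ (hπs i _ (hρ i (subset_tsupport _ hi))))
      (convex_setOf_eq_pos_smul (β x))
  choose f hf hfβ using hray
  refine ⟨f, fun q => ∑ᶠ i, ρ i q • β (s i q), h.isReducedForm_of_apply_eq
    (isSmoothForm_of_isSmoothFormAt fun q => isSmoothFormAt_finsum_smul ρ fun i hi =>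
      h.isSmoothFormAt_covector_section hβ (hU i) (hs i) (hπs i) (hρ i hi))
    (fun x => (hf x).ne') (fun x u => ?_)⟩
  rw [← hβ x u]
  exact congrArg (fun A : Euc r →L[ℝ] ℝ => A (mfderiv (𝓡 d) (𝓡 r) π x u)) (hfβ x)

end IsContactReduction

end ReducedForms

section ConstantRank

variable {E F G K : Type*} [NormedAddCommGroup E] [NormedSpace ℝ E]
  [NormedAddCommGroup F] [NormedSpace ℝ F] [NormedAddCommGroup G] [NormedSpace ℝ G]
  [NormedAddCommGroup K] [NormedSpace ℝ K]

lemma fderiv_injective_of_comp {f : E → F} {g : F → G} {x : E}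
    (hg : DifferentiableAt ℝ g (f x)) (hf : DifferentiableAt ℝ f x)
    (h : Function.Injective (fderiv ℝ (g ∘ f) x)) : Function.Injective (fderiv ℝ f x) := by
  rw [fderiv_comp x hg hf] at h
  exact Function.Injective.of_comp (f := fderiv ℝ g (f x)) h

lemma fderiv_univBall_injective {V : Type*} [NormedAddCommGroup V] [InnerProductSpace ℝ V]
    (c : V) {ε : ℝ} (hε : 0 < ε) (y : V) :
    Function.Injective (fderiv ℝ (OpenPartialHomeomorph.univBall c ε) y) := by
  have hmem : OpenPartialHomeomorph.univBall c ε y ∈ Metric.ball c ε := by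
    rw [← OpenPartialHomeomorph.univBall_target c hε]
    exact (OpenPartialHomeomorph.univBall c ε).map_source (by simp)
  have hid : (OpenPartialHomeomorph.univBall c ε).symm ∘ OpenPartialHomeomorph.univBall c ε = id :=
    funext fun z => (OpenPartialHomeomorph.univBall c ε).left_inv (by simp)
  refine fderiv_injective_of_comp
    ((OpenPartialHomeomorph.contDiffOn_univBall_symm.contDiffAt
      (Metric.isOpen_ball.mem_nhds hmem)).differentiableAt one_ne_zero)
    (OpenPartialHomeomorph.contDiff_univBall.differentiable one_ne_zero y) ?_
  rw [hid, fderiv_id]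
  exact Function.injective_id

lemma exists_smooth_openPartialHomeomorph [CompleteSpace E] {g : E → F} {U : Set E}
    (hU : IsOpen U) (hg : ∀ w ∈ U, ContDiffAt ℝ ∞ g w) {w₀ : E} (hw₀ : w₀ ∈ U) {T : E ≃L[ℝ] F}
    (hT : HasFDerivAt g (T : E →L[ℝ] F) w₀) :
    ∃ Θ : OpenPartialHomeomorph E F, w₀ ∈ Θ.source ∧ Θ.source ⊆ U ∧ (∀ w, Θ w = g w) ∧
      ∀ p ∈ Θ.target, ContDiffAt ℝ ∞ Θ.symm p := by
  let Θ := (hg w₀ hw₀).toOpenPartialHomeomorph g hT (by simp)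
  have hinvertible :
      ∀ᶠ w in 𝓝 w₀, fderiv ℝ g w ∈ Set.range ((↑) : (E ≃L[ℝ] F) → E →L[ℝ] F) := by
    refine ((hg w₀ hw₀).fderiv_right (m := ∞) (by simp)).continuousAt ?_
    rw [hT.fderiv]
    exact ContinuousLinearEquiv.nhds T
  obtain ⟨V, hV, hVo, hwV⟩ := eventually_nhds_iff.mp ((hU.eventually_mem hw₀).and hinvertible)
  refine ⟨Θ.restrOpen V hVo,
    ⟨(hg w₀ hw₀).mem_toOpenPartialHomeomorph_source hT (by simp), hwV⟩,
    fun w hw => (hV w hw.2).1, fun w => rfl, fun p hp => ?_⟩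
  obtain ⟨hpU, S, hS⟩ := hV _ ((Θ.restrOpen V hVo).map_target hp).2
  refine (Θ.restrOpen V hVo).contDiffAt_symm (f₀' := S) hp ?_ (hg _ hpU)
  rw [hS]
  exact ((hg _ hpU).differentiableAt (by simp)).hasFDerivAt

lemma exists_equiv_prod_ker [FiniteDimensional ℝ E] [FiniteDimensional ℝ F]
    [FiniteDimensional ℝ G] (A : E →L[ℝ] F)
    (hA : Module.finrank ℝ (LinearMap.range A.toLinearMap) = Module.finrank ℝ G) :
    ∃ (R : F →L[ℝ] G) (P : E →L[ℝ] LinearMap.ker A.toLinearMap)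
      (T : E ≃L[ℝ] G × LinearMap.ker A.toLinearMap),
      (T : E →L[ℝ] G × LinearMap.ker A.toLinearMap) = (R.comp A).prod P := by
  let R₀ : LinearMap.range A.toLinearMap ≃ₗ[ℝ] G := LinearEquiv.ofFinrankEq _ _ hA
  obtain ⟨R, hR⟩ := LinearMap.exists_extend R₀.toLinearMap
  obtain ⟨P, hP⟩ := (LinearMap.ker A.toLinearMap).subtype.exists_leftInverse_of_injective
    (Submodule.ker_subtype _)
  have hinj : Function.Injective ((R ∘ₗ A.toLinearMap).prod P) := by
    refine (injective_iff_map_eq_zero _).mpr fun v hv => ?_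
    obtain ⟨hRv, hPv⟩ := Prod.mk_eq_zero.mp hv
    have hR₀v : R₀ ⟨A v, v, rfl⟩ = 0 :=
      (LinearMap.congr_fun hR ⟨A v, v, rfl⟩).symm.trans hRv
    have hAv : A v = 0 := congrArg Subtype.val ((LinearEquiv.map_eq_zero_iff R₀).mp hR₀v)
    exact congrArg Subtype.val ((LinearMap.congr_fun hP ⟨v, hAv⟩).symm.trans hPv)
  have hdim : Module.finrank ℝ E = Module.finrank ℝ (G × LinearMap.ker A.toLinearMap) := by
    rw [Module.finrank_prod, ← hA, LinearMap.finrank_range_add_finrank_ker]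
  exact ⟨LinearMap.toContinuousLinearMap R, LinearMap.toContinuousLinearMap P,
    (LinearEquiv.ofInjectiveOfFinrankEq _ hinj hdim).toContinuousLinearEquiv, rfl⟩

lemma eq_zero_of_mem_range_of_finrank_eq [FiniteDimensional ℝ F] [FiniteDimensional ℝ G]
    {A : E →ₗ[ℝ] F} {R : F →ₗ[ℝ] G}
    (hA : Module.finrank ℝ (LinearMap.range A) = Module.finrank ℝ G)
    (hR : Function.Surjective (R ∘ₗ A)) {y : F} (hy : y ∈ LinearMap.range A) (hRy : R y = 0) :
    y = 0 := by
  have hsurj : Function.Surjective (R.domRestrict (LinearMap.range A)) := fun z =>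
    (hR z).imp' (fun v => ⟨A v, v, rfl⟩) fun _ hv => hv
  have hinj := (LinearMap.injective_iff_surjective_of_finrank_eq_finrank hA).mpr hsurj
  exact congrArg Subtype.val (hinj (a₁ := ⟨y, hy⟩) (a₂ := 0) (hRy.trans (map_zero R).symm))

/-- Coordinates `Θ` adapted to a map `g` of constant rank `dim G`: the first coordinate `Θ w` is
read off `g w` by the linear map `R`. It will follow that `g` does not depend on the second
coordinate. -/
structure IsRankChart (g : E → F) (R : F →L[ℝ] G) (Θ : OpenPartialHomeomorph E (G × K)) :
    Prop where
  contDiffAt : ∀ w ∈ Θ.source, ContDiffAt ℝ ∞ g w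
  contDiffAt_symm : ∀ p ∈ Θ.target, ContDiffAt ℝ ∞ Θ.symm p
  apply_eq_fst : ∀ w ∈ Θ.source, R (g w) = (Θ w).1
  finrank_range : ∀ w ∈ Θ.source,
    Module.finrank ℝ (LinearMap.range (fderiv ℝ g w).toLinearMap) = Module.finrank ℝ G

lemma exists_isRankChart [FiniteDimensional ℝ E] [FiniteDimensional ℝ F] [FiniteDimensional ℝ G]
    {g : E → F} {U : Set E} (hU : IsOpen U) (hg : ∀ w ∈ U, ContDiffAt ℝ ∞ g w)
    (hrank : ∀ w ∈ U,
      Module.finrank ℝ (LinearMap.range (fderiv ℝ g w).toLinearMap) = Module.finrank ℝ G)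
    {w₀ : E} (hw₀ : w₀ ∈ U) :
    ∃ (R : F →L[ℝ] G)
      (Θ : OpenPartialHomeomorph E (G × LinearMap.ker (fderiv ℝ g w₀).toLinearMap)),
      w₀ ∈ Θ.source ∧ Θ.source ⊆ U ∧ IsRankChart g R Θ := by
  have : CompleteSpace E := FiniteDimensional.complete ℝ E
  obtain ⟨R, P, T, hT⟩ := exists_equiv_prod_ker (G := G) (fderiv ℝ g w₀) (hrank w₀ hw₀)
  have hderiv : HasFDerivAt (fun w => (R (g w), P w))
      (T : E →L[ℝ] G × LinearMap.ker (fderiv ℝ g w₀).toLinearMap) w₀ := by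
    rw [hT]
    exact (R.hasFDerivAt.comp w₀ ((hg w₀ hw₀).differentiableAt (by simp)).hasFDerivAt).prodMk
      P.hasFDerivAt
  obtain ⟨Θ, hw₀Θ, hΘU, hΘ, hsymm⟩ := exists_smooth_openPartialHomeomorph hU
    (fun w hw => (R.contDiff.contDiffAt.comp w (hg w hw)).prodMk P.contDiff.contDiffAt) hw₀ hderiv
  exact ⟨R, Θ, hw₀Θ, hΘU, fun w hw => hg w (hΘU hw), hsymm,
    fun w _ => (congrArg Prod.fst (hΘ w)).symm, fun w hw => hrank w (hΘU hw)⟩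

namespace IsRankChart

variable {g : E → F} {R : F →L[ℝ] G} {Θ : OpenPartialHomeomorph E (G × K)} {p : G × K}

lemma apply_symm_eq_fst (h : IsRankChart g R Θ) (hp : p ∈ Θ.target) : R (g (Θ.symm p)) = p.1 := by
  rw [h.apply_eq_fst _ (Θ.map_target hp), Θ.right_inv hp]

lemma contDiffAt_comp_symm (h : IsRankChart g R Θ) (hp : p ∈ Θ.target) :
    ContDiffAt ℝ ∞ (g ∘ Θ.symm) p :=
  (h.contDiffAt _ (Θ.map_target hp)).comp p (h.contDiffAt_symm p hp)

lemma apply_fderiv_eq_fst (h : IsRankChart g R Θ) (hp : p ∈ Θ.target) (v : G × K) :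
    R (fderiv ℝ (g ∘ Θ.symm) p v) = v.1 := by
  have hfst : R ∘ (g ∘ Θ.symm) =ᶠ[𝓝 p] Prod.fst := by
    filter_upwards [Θ.open_target.mem_nhds hp] with p' hp' using h.apply_symm_eq_fst hp'
  have hchain := (R.hasFDerivAt.comp p
    ((h.contDiffAt_comp_symm hp).differentiableAt (by simp)).hasFDerivAt).fderiv
  rw [hfst.fderiv_eq, fderiv_fst] at hchain
  exact (DFunLike.congr_fun hchain v).symm

lemma fderiv_inr_eq_zero [FiniteDimensional ℝ F] [FiniteDimensional ℝ G]
    (h : IsRankChart g R Θ) (hp : p ∈ Θ.target) (z : K) :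
    fderiv ℝ (g ∘ Θ.symm) p (0, z) = 0 := by
  have hchain : fderiv ℝ (g ∘ Θ.symm) p =
      (fderiv ℝ g (Θ.symm p)).comp (fderiv ℝ Θ.symm p) :=
    fderiv_comp p ((h.contDiffAt _ (Θ.map_target hp)).differentiableAt (by simp))
      ((h.contDiffAt_symm p hp).differentiableAt (by simp))
  have hrange (v : G × K) : fderiv ℝ (g ∘ Θ.symm) p v =
      fderiv ℝ g (Θ.symm p) (fderiv ℝ Θ.symm p v) := DFunLike.congr_fun hchain v
  refine eq_zero_of_mem_range_of_finrank_eq (A := (fderiv ℝ g (Θ.symm p)).toLinearMap)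
    (R := R.toLinearMap) (h.finrank_range _ (Θ.map_target hp))
    (fun c => ⟨fderiv ℝ Θ.symm p (c, 0), ?_⟩) ⟨_, (hrange (0, z)).symm⟩
    (h.apply_fderiv_eq_fst hp (0, z))
  exact (congrArg R (hrange (c, 0))).symm.trans (h.apply_fderiv_eq_fst hp (c, 0))

lemma apply_symm_eq_apply_symm [FiniteDimensional ℝ F] [FiniteDimensional ℝ G]
    (h : IsRankChart g R Θ) {c : G} {B : Set K} (hB : IsOpen B) (hB' : IsPreconnected B)
    (hcB : ∀ z ∈ B, (c, z) ∈ Θ.target) {z z' : K} (hz : z ∈ B) (hz' : z' ∈ B) :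
    g (Θ.symm (c, z)) = g (Θ.symm (c, z')) :=
  eq_of_fderiv_inr_eq_zero (b := g ∘ Θ.symm) hB hB'
    (fun z hz => (h.contDiffAt_comp_symm (hcB z hz)).differentiableAt (by simp))
    (fun z hz z' => h.fderiv_inr_eq_zero (hcB z hz) z') hz hz'

lemma range_comp_symm_eq_image [FiniteDimensional ℝ F] [FiniteDimensional ℝ G]
    (h : IsRankChart g R Θ) {A : Set G} {B : Set K} (hB : IsOpen B) (hB' : IsPreconnected B)
    (hAB : A ×ˢ B ⊆ Θ.target) {z₀ : K} (hz₀ : z₀ ∈ B) {Y : Type*} {b : Y → G}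
    (hb : Set.range b = A) :
    Set.range (g ∘ fun y => Θ.symm (b y, z₀)) = g '' (Θ.source ∩ Θ ⁻¹' (A ×ˢ B)) := by
  subst hb
  refine Set.Subset.antisymm ?_ ?_
  · rintro _ ⟨y, rfl⟩
    have hy : (b y, z₀) ∈ Set.range b ×ˢ B := ⟨⟨y, rfl⟩, hz₀⟩
    refine ⟨Θ.symm (b y, z₀), ⟨Θ.map_target (hAB hy), ?_⟩, rfl⟩
    rwa [Set.mem_preimage, Θ.right_inv (hAB hy)]
  · rintro _ ⟨w, ⟨hw, ⟨y, hy⟩, hwB⟩, rfl⟩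
    refine ⟨y, (h.apply_symm_eq_apply_symm hB hB' (fun z hz => hAB ⟨⟨y, rfl⟩, hz⟩) hz₀ hwB).trans
      (congrArg g ?_)⟩
    rw [hy, Θ.left_inv hw]

lemma exists_transversal [FiniteDimensional ℝ F] {V : Type*} [NormedAddCommGroup V]
    [InnerProductSpace ℝ V] [FiniteDimensional ℝ V] {R : F →L[ℝ] V}
    {Θ : OpenPartialHomeomorph E (V × K)} (hΘ : IsRankChart g R Θ) {w₀ : E}
    (hw₀ : w₀ ∈ Θ.source) :
    ∃ (O : Set E) (h : V → E), IsOpen O ∧ w₀ ∈ O ∧ O ⊆ Θ.source ∧ ContDiff ℝ ∞ h ∧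
      (∀ y, h y ∈ O) ∧ Set.range (g ∘ h) = g '' O ∧
      ∀ y, Function.Injective (fderiv ℝ (g ∘ h) y) := by
  obtain ⟨ε, hε, hball⟩ := Metric.mem_nhds_iff.mp
    (Θ.open_target.mem_nhds (Θ.map_source hw₀))
  rw [← Prod.mk.eta (p := Θ w₀), ← ball_prod_same] at hball
  set c₀ := (Θ w₀).1
  set z₀ := (Θ w₀).2
  let b := OpenPartialHomeomorph.univBall c₀ ε
  have hb : Set.range b = Metric.ball c₀ ε := by
    rw [← OpenPartialHomeomorph.univBall_target c₀ hε, ← b.image_source_eq_target,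
      OpenPartialHomeomorph.univBall_source, Set.image_univ]
  have hbz (y) : (b y, z₀) ∈ Metric.ball c₀ ε ×ˢ Metric.ball z₀ ε :=
    ⟨hb ▸ Set.mem_range_self y, Metric.mem_ball_self hε⟩
  let h : V → E := fun y => Θ.symm (b y, z₀)
  have hh : ContDiff ℝ ∞ h := contDiff_iff_contDiffAt.mpr fun y =>
    (hΘ.contDiffAt_symm _ (hball (hbz y))).comp y
      (OpenPartialHomeomorph.contDiff_univBall.prodMk contDiff_const).contDiffAt
  have hhO (y) : h y ∈ Θ.source ∩ Θ ⁻¹' (Metric.ball c₀ ε ×ˢ Metric.ball z₀ ε) := by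
    refine ⟨Θ.map_target (hball (hbz y)), ?_⟩
    rw [Set.mem_preimage, Θ.right_inv (hball (hbz y))]
    exact hbz y
  refine ⟨_, h, Θ.isOpen_inter_preimage (Metric.isOpen_ball.prod Metric.isOpen_ball),
    ⟨hw₀, Metric.mem_ball_self hε, Metric.mem_ball_self hε⟩, Set.inter_subset_left, hh, hhO,
    hΘ.range_comp_symm_eq_image Metric.isOpen_ball (convex_ball z₀ ε).isPreconnected hball
      (Metric.mem_ball_self hε) hb, fun y => ?_⟩
  have hRgh : R ∘ (g ∘ h) = b := funext fun y => hΘ.apply_symm_eq_fst (hball (hbz y))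
  refine fderiv_injective_of_comp R.differentiableAt
    (((hΘ.contDiffAt _ (hhO y).1).comp y hh.contDiffAt).differentiableAt (by simp)) ?_
  rw [hRgh]
  exact fderiv_univBall_injective c₀ hε y

end IsRankChart

theorem exists_transversal_of_constant_rank [FiniteDimensional ℝ E] [FiniteDimensional ℝ F]
    {g : E → F} {U : Set E} (hU : IsOpen U) (hg : ContDiffOn ℝ ∞ g U) {k : ℕ}
    (hrank : ∀ w ∈ U, Module.finrank ℝ (LinearMap.range (fderiv ℝ g w).toLinearMap) = k)
    {w₀ : E} (hw₀ : w₀ ∈ U) :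
    ∃ (O : Set E) (h : Euc k → E), IsOpen O ∧ w₀ ∈ O ∧ O ⊆ U ∧ ContDiff ℝ ∞ h ∧
      (∀ y, h y ∈ O) ∧ Set.range (g ∘ h) = g '' O ∧
      ∀ y, Function.Injective (fderiv ℝ (g ∘ h) y) := by
  obtain ⟨R, Θ, hw₀Θ, hΘU, hΘ⟩ := exists_isRankChart (G := Euc k) hU
    (fun w hw => hg.contDiffAt (hU.mem_nhds hw))
    (fun w hw => (hrank w hw).trans finrank_euclideanSpace_fin.symm) hw₀
  obtain ⟨O, h, hO, hw₀O, hOΘ, hrest⟩ := hΘ.exists_transversal hw₀Θ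
  exact ⟨O, h, hO, hw₀O, hOΘ.trans hΘU, hrest⟩

end ConstantRank

section Charts

variable {r : ℕ} {E : Type*} [NormedAddCommGroup E] [NormedSpace ℝ E]
  {Q : Type*} [TopologicalSpace Q] [ChartedSpace (Euc r) Q] {ψ : OpenPartialHomeomorph Q (Euc r)}
  {G : E → Q} {e : E}

lemma mdifferentiable_of_mem_maximalAtlas (hψ : ψ ∈ IsManifold.maximalAtlas (𝓡 r) ∞ Q) :
    ψ.MDifferentiable (𝓡 r) 𝓘(ℝ, Euc r) :=
  ⟨(contMDiffOn_of_mem_maximalAtlas hψ).mdifferentiableOn (by simp),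
    (contMDiffOn_symm_of_mem_maximalAtlas hψ).mdifferentiableOn (by simp)⟩

lemma contDiffAt_chart_comp (hψ : ψ ∈ IsManifold.maximalAtlas (𝓡 r) ∞ Q)
    (hG : ContMDiffAt 𝓘(ℝ, E) (𝓡 r) ∞ G e) (he : G e ∈ ψ.source) :
    ContDiffAt ℝ ∞ (ψ ∘ G) e :=
  contMDiffAt_iff_contDiffAt.mp ((contMDiffAt_of_mem_maximalAtlas hψ he).comp e hG)

lemma fderiv_chart_comp (hψ : ψ ∈ IsManifold.maximalAtlas (𝓡 r) ∞ Q)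
    (hG : MDifferentiableAt 𝓘(ℝ, E) (𝓡 r) G e) (he : G e ∈ ψ.source) (v : E) :
    fderiv ℝ (ψ ∘ G) e v =
      mfderiv (𝓡 r) 𝓘(ℝ, Euc r) ψ (G e) (mfderiv 𝓘(ℝ, E) (𝓡 r) G e v) := by
  rw [← mfderiv_eq_fderiv]
  exact mfderiv_comp_apply e ((mdifferentiable_of_mem_maximalAtlas hψ).mdifferentiableAt he) hG v

lemma trans_mem_maximalAtlas [IsManifold (𝓡 r) ∞ Q]
    (hψ : ψ ∈ IsManifold.maximalAtlas (𝓡 r) ∞ Q) {Φ : OpenPartialHomeomorph (Euc r) (Euc r)}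
    (hΦ : ∀ e ∈ Φ.source, ContDiffAt ℝ ∞ Φ e) (hΦ' : ∀ e ∈ Φ.target, ContDiffAt ℝ ∞ Φ.symm e) :
    ψ.trans Φ ∈ IsManifold.maximalAtlas (𝓡 r) ∞ Q := by
  refine OpenPartialHomeomorph.mem_maximalAtlas_of_contMDiffOn _ (fun y hy => ?_) fun e he => ?_
  · rw [OpenPartialHomeomorph.trans_source] at hy
    exact ((hΦ _ hy.2).contMDiffAt.comp y
      (contMDiffAt_of_mem_maximalAtlas hψ hy.1)).contMDiffWithinAt
  · rw [OpenPartialHomeomorph.trans_target] at he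
    exact ((contMDiffAt_symm_of_mem_maximalAtlas hψ he.2).comp e
      (hΦ' _ he.1).contMDiffAt).contMDiffWithinAt

end Charts

section Immersions

variable {E F K : Type*} [NormedAddCommGroup E] [NormedSpace ℝ E] [FiniteDimensional ℝ E]
  [NormedAddCommGroup F] [NormedSpace ℝ F] [FiniteDimensional ℝ F]
  [NormedAddCommGroup K] [NormedSpace ℝ K]

lemma exists_coprod_equiv [FiniteDimensional ℝ K] (A : E →L[ℝ] F) (hA : Function.Injective A)
    (hdim : Module.finrank ℝ E + Module.finrank ℝ K = Module.finrank ℝ F) :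
    ∃ (B : K →L[ℝ] F) (J : (E × K) ≃L[ℝ] F), (J : E × K →L[ℝ] F) = A.coprod B := by
  obtain ⟨C, hC⟩ := Submodule.exists_isCompl (LinearMap.range A.toLinearMap)
  have hKC : Module.finrank ℝ K = Module.finrank ℝ C := by
    have hAC := Submodule.finrank_add_eq_of_isCompl hC
    rw [LinearMap.finrank_range_of_inj hA] at hAC
    omega
  let B : K →ₗ[ℝ] F := C.subtype ∘ₗ (LinearEquiv.ofFinrankEq K C hKC).toLinearMap
  have hB : Function.Injective B :=
    C.injective_subtype.comp (LinearEquiv.ofFinrankEq K C hKC).injective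
  have hinj : Function.Injective (A.toLinearMap.coprod B) := by
    rw [← LinearMap.ker_eq_bot, LinearMap.ker_coprod_of_disjoint_range,
      LinearMap.ker_eq_bot.mpr hA, LinearMap.ker_eq_bot.mpr hB, Submodule.prod_bot]
    refine hC.disjoint.mono_right ?_
    rintro _ ⟨z, rfl⟩
    exact (LinearEquiv.ofFinrankEq K C hKC z).2
  refine ⟨LinearMap.toContinuousLinearMap B, (LinearEquiv.ofInjectiveOfFinrankEq _ hinj
    (by rw [Module.finrank_prod, hdim])).toContinuousLinearEquiv, ?_⟩
  ext v <;> rfl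

lemma exists_smooth_openPartialHomeomorph_extending [FiniteDimensional ℝ K] {G : E → F}
    {U : Set E} (hU : IsOpen U) (hG : ∀ e ∈ U, ContDiffAt ℝ ∞ G e) {e₀ : E} (he₀ : e₀ ∈ U)
    (hinj : Function.Injective (fderiv ℝ G e₀))
    (hdim : Module.finrank ℝ E + Module.finrank ℝ K = Module.finrank ℝ F) :
    ∃ Θ : OpenPartialHomeomorph (E × K) F, (e₀, 0) ∈ Θ.source ∧ Θ.source ⊆ U ×ˢ Set.univ ∧
      (∀ w ∈ Θ.source, ContDiffAt ℝ ∞ Θ w) ∧ (∀ p ∈ Θ.target, ContDiffAt ℝ ∞ Θ.symm p) ∧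
      ∀ e, Θ (e, 0) = G e := by
  obtain ⟨B, J, hJ⟩ := exists_coprod_equiv (K := K) (fderiv ℝ G e₀) hinj hdim
  let g : E × K → F := fun w => G w.1 + B w.2
  have hg : ∀ w ∈ U ×ˢ (Set.univ : Set K), ContDiffAt ℝ ∞ g w := fun w hw =>
    ((hG w.1 hw.1).comp w contDiffAt_fst).add (B.contDiff.contDiffAt.comp w contDiffAt_snd)
  have hgJ : HasFDerivAt g (J : E × K →L[ℝ] F) (e₀, 0) := by
    have hG₀ : HasFDerivAt G (fderiv ℝ G e₀) (e₀, (0 : K)).1 :=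
      ((hG e₀ he₀).differentiableAt (by simp)).hasFDerivAt
    rw [hJ]
    exact (hG₀.comp (e₀, (0 : K)) hasFDerivAt_fst).add
      (B.hasFDerivAt.comp (e₀, (0 : K)) hasFDerivAt_snd)
  obtain ⟨Θ, hΘ₀, hΘU, hΘg, hΘs⟩ := exists_smooth_openPartialHomeomorph
    (hU.prod isOpen_univ) hg ⟨he₀, Set.mem_univ _⟩ hgJ
  refine ⟨Θ, hΘ₀, hΘU, fun w hw => ?_, hΘs, fun e => ?_⟩
  · rw [funext hΘg]
    exact hg w (hΘU hw)
  · simp only [hΘg, g, map_zero, add_zero]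

variable {k r : ℕ} {P : Type*} [TopologicalSpace P] [ChartedSpace (Euc k) P]
  {Q : Type*} [TopologicalSpace Q] [ChartedSpace (Euc r) Q]
  {f : P → Q} {φ : OpenPartialHomeomorph P (Euc k)} {ψ : OpenPartialHomeomorph Q (Euc r)} {p : P}

lemma fderiv_chart_comp_comp_symm_injective (hφ : φ ∈ IsManifold.maximalAtlas (𝓡 k) ∞ P)
    (hψ : ψ ∈ IsManifold.maximalAtlas (𝓡 r) ∞ Q) (hf : MDifferentiableAt (𝓡 k) (𝓡 r) f p)
    (hp : p ∈ φ.source) (hfp : f p ∈ ψ.source)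
    (hinj : Function.Injective (mfderiv (𝓡 k) (𝓡 r) f p)) :
    Function.Injective (fderiv ℝ (ψ ∘ f ∘ φ.symm) (φ p)) := by
  have hφd := (mdifferentiable_of_mem_maximalAtlas hφ).symm
  have hp' : φ p ∈ φ.target := φ.map_source hp
  obtain ⟨e, he⟩ : ∃ e, φ p = e := ⟨_, rfl⟩
  obtain rfl : φ.symm e = p := he ▸ φ.left_inv hp
  rw [he] at hp' ⊢
  have hfφ := mfderiv_comp_apply e hf (hφd.mdifferentiableAt hp')
  intro u v huv
  rw [fderiv_chart_comp hψ (hf.comp e (hφd.mdifferentiableAt hp')) hfp,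
    fderiv_chart_comp hψ (hf.comp e (hφd.mdifferentiableAt hp')) hfp] at huv
  have hfuv := (mdifferentiable_of_mem_maximalAtlas hψ).mfderiv_injective hfp huv
  exact hφd.mfderiv_injective hp' (hinj ((hfφ u).symm.trans (hfuv.trans (hfφ v))))

variable [IsManifold (𝓡 r) ∞ Q]

lemma isImmersionAtOfComplement_of_eq_chart_comp (hφ : φ ∈ IsManifold.maximalAtlas (𝓡 k) ∞ P)
    (hψ : ψ ∈ IsManifold.maximalAtlas (𝓡 r) ∞ Q) (hf : ContinuousAt f p) (hp : p ∈ φ.source)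
    {Θ : OpenPartialHomeomorph (Euc k × K) (Euc r)} (hpΘ : (φ p, 0) ∈ Θ.source)
    (hΘ : ∀ w ∈ Θ.source, ContDiffAt ℝ ∞ Θ w) (hΘ' : ∀ q ∈ Θ.target, ContDiffAt ℝ ∞ Θ.symm q)
    (hfψ : ∀ e, (e, 0) ∈ Θ.source → f (φ.symm e) ∈ ψ.source)
    (hfΘ : ∀ e, (e, 0) ∈ Θ.source → Θ (e, 0) = ψ (f (φ.symm e)))
    (J : (Euc k × K) ≃L[ℝ] Euc r) :
    Manifold.IsImmersionAtOfComplement K (𝓡 k) (𝓡 r) ∞ f p := by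
  let χ := ψ.trans (Θ.symm.trans J.toHomeomorph.toOpenPartialHomeomorph)
  let V := φ.source ∩ φ ⁻¹' {e | (e, (0 : K)) ∈ Θ.source}
  have hV : IsOpen V := φ.isOpen_inter_preimage (Θ.open_source.preimage (by fun_prop))
  have hχ : χ ∈ IsManifold.maximalAtlas (𝓡 r) ∞ Q := by
    refine trans_mem_maximalAtlas hψ (fun e he => ?_) fun e he => ?_
    · exact J.contDiff.contDiffAt.comp e (hΘ' e (by simpa using he))
    · exact (hΘ _ (by simpa using he)).comp e J.symm.contDiff.contDiffAt
  have hsource (e) (he : (e, (0 : K)) ∈ Θ.source) : f (φ.symm e) ∈ χ.source := by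
    have hmem := Θ.map_source he
    rw [hfΘ e he] at hmem
    simpa [χ] using ⟨hfψ e he, hmem⟩
  have hχf (e) (he : (e, (0 : K)) ∈ Θ.source) : χ (f (φ.symm e)) = J (e, 0) := by
    change J (Θ.symm (ψ (f (φ.symm e)))) = J (e, 0)
    rw [← hfΘ e he, Θ.left_inv he]
  refine Manifold.IsImmersionAtOfComplement.mk_of_continuousAt hf J (φ.restr V) χ ?_ ?_
    (restr_mem_maximalAtlas (contDiffGroupoid ∞ (𝓡 k)) hφ hV) hχ fun e he => hχf e ?_
  · rw [φ.restr_source' _ hV]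
    exact ⟨hp, hp, hpΘ⟩
  · simpa [φ.left_inv hp] using hsource (φ p) hpΘ
  · have he' : e ∈ (φ.restr V).target := by simpa using he
    have hmem := (φ.restr V).map_target he'
    rw [φ.restr_source' _ hV] at hmem
    have hright : φ ((φ.restr V).symm e) = e := (φ.restr V).right_inv he'
    rw [← hright]
    exact hmem.2.2

lemma isImmersionAtOfComplement_of_mfderiv_injective [FiniteDimensional ℝ K]
    [IsManifold (𝓡 k) ∞ P] (hf : ContMDiff (𝓡 k) (𝓡 r) ∞ f)
    (hinj : Function.Injective (mfderiv (𝓡 k) (𝓡 r) f p)) (hdim : k + Module.finrank ℝ K = r) :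
    Manifold.IsImmersionAtOfComplement K (𝓡 k) (𝓡 r) ∞ f p := by
  let φ := chartAt (Euc k) p
  let ψ := chartAt (Euc r) (f p)
  have hφ : φ ∈ IsManifold.maximalAtlas (𝓡 k) ∞ P := IsManifold.chart_mem_maximalAtlas p
  have hψ : ψ ∈ IsManifold.maximalAtlas (𝓡 r) ∞ Q := IsManifold.chart_mem_maximalAtlas (f p)
  have hp : p ∈ φ.source := mem_chart_source _ p
  have hfp : f p ∈ ψ.source := mem_chart_source _ (f p)
  have hU : IsOpen (φ.target ∩ φ.symm ⁻¹' (f ⁻¹' ψ.source)) :=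
    φ.isOpen_inter_preimage_symm (ψ.open_source.preimage hf.continuous)
  have hdim' : Module.finrank ℝ (Euc k) + Module.finrank ℝ K = Module.finrank ℝ (Euc r) := by
    simpa using hdim
  obtain ⟨Θ, hpΘ, hΘU, hΘ, hΘ', hΘf⟩ := exists_smooth_openPartialHomeomorph_extending hU
    (fun e he => contDiffAt_chart_comp hψ
      ((hf _).comp e (contMDiffAt_symm_of_mem_maximalAtlas hφ he.1)) he.2)
    ⟨φ.map_source hp, by rwa [Set.mem_preimage, φ.left_inv hp]⟩
    (fderiv_chart_comp_comp_symm_injective hφ hψ (hf.mdifferentiableAt (by simp)) hp hfp hinj) hdim'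
  exact isImmersionAtOfComplement_of_eq_chart_comp hφ hψ hf.continuous.continuousAt hp hpΘ hΘ hΘ'
    (fun e he => (hΘU he).1.2) (fun e _ => hΘf e)
    (ContinuousLinearEquiv.ofFinrankEq (by rw [Module.finrank_prod, hdim']))

end Immersions

section DiscreteUnion

variable {k r : ℕ} {I : Type*} [TopologicalSpace I] [DiscreteTopology I]
  {Q : Type*} [TopologicalSpace Q] [ChartedSpace (Euc r) Q]

/-- The chart of `I × ℝ^k`, for `I` discrete, given by the copy of `ℝ^k` with index `i`. -/
def sheetChart (k : ℕ) (i : I) : OpenPartialHomeomorph (I × Euc k) (Euc k) where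
  toFun := Prod.snd
  invFun y := (i, y)
  source := {i} ×ˢ Set.univ
  target := Set.univ
  map_source' _ _ := Set.mem_univ _
  map_target' _ _ := ⟨rfl, Set.mem_univ _⟩
  left_inv' _ hp := Prod.ext hp.1.symm rfl
  right_inv' _ _ := rfl
  open_source := (isOpen_discrete _).prod isOpen_univ
  open_target := isOpen_univ
  continuousOn_toFun := continuous_snd.continuousOn
  continuousOn_invFun := (Continuous.prodMk continuous_const continuous_id).continuousOn

/-- The disjoint union `I × ℝ^k` of copies of `ℝ^k`, as a space with charts in `ℝ^k` (the product
charts of Mathlib take values in another model space). -/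
@[reducible]
def sheetChartedSpace (k : ℕ) (I : Type*) [TopologicalSpace I] [DiscreteTopology I] :
    ChartedSpace (Euc k) (I × Euc k) where
  atlas := Set.range (sheetChart k)
  chartAt p := sheetChart k p.1
  mem_chart_source _ := ⟨rfl, Set.mem_univ _⟩
  chart_mem_atlas p := ⟨p.1, rfl⟩

attribute [local instance] sheetChartedSpace

lemma isManifold_sheets : IsManifold (𝓡 k) ∞ (I × Euc k) := by
  apply isManifold_of_contDiffOn
  rintro _ _ ⟨i, rfl⟩ ⟨j, rfl⟩
  exact contDiff_id.contDiffOn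

attribute [local instance] isManifold_sheets

lemma contMDiff_snd_sheets : ContMDiff (𝓡 k) 𝓘(ℝ, Euc k) ∞ (Prod.snd : I × Euc k → Euc k) :=
  fun p => contMDiffAt_of_mem_maximalAtlas (e := sheetChart k p.1)
    (IsManifold.subset_maximalAtlas ⟨p.1, rfl⟩) ⟨rfl, Set.mem_univ _⟩

lemma eventuallyEq_comp_snd_sheets {X : Type*} (F : I → Euc k → X) (p : I × Euc k) :
    (fun p : I × Euc k => F p.1 p.2) =ᶠ[𝓝 p] F p.1 ∘ Prod.snd := by
  filter_upwards [(sheetChart k p.1).open_source.mem_nhds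
    (⟨rfl, Set.mem_univ _⟩ : p ∈ ({p.1} : Set I) ×ˢ (Set.univ : Set (Euc k)))] with p' hp'
  rw [Function.comp_apply, show p'.1 = p.1 from hp'.1]

lemma contMDiff_sheets {F : I → Euc k → Q} (hF : ∀ i, ContMDiff 𝓘(ℝ, Euc k) (𝓡 r) ∞ (F i)) :
    ContMDiff (𝓡 k) (𝓡 r) ∞ (fun p : I × Euc k => F p.1 p.2) := fun p =>
  ((hF p.1 _).comp p (contMDiff_snd_sheets p)).congr_of_eventuallyEq
    (eventuallyEq_comp_snd_sheets F p)

lemma mfderiv_snd_sheets (p : I × Euc k) :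
    (mfderiv (𝓡 k) 𝓘(ℝ, Euc k) (Prod.snd : I × Euc k → Euc k) p : Euc k →L[ℝ] Euc k) =
      ContinuousLinearMap.id ℝ (Euc k) :=
  ((contMDiff_snd_sheets p).mdifferentiableAt (by simp)).mfderiv.trans
    (fderivWithin_id (𝓡 k).uniqueDiffWithinAt_image)

lemma mfderiv_sheets {F : I → Euc k → Q} {p : I × Euc k}
    (hF : MDifferentiableAt 𝓘(ℝ, Euc k) (𝓡 r) (F p.1) p.2) :
    (mfderiv (𝓡 k) (𝓡 r) (fun p : I × Euc k => F p.1 p.2) p : Euc k →L[ℝ] Euc r) =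
      mfderiv 𝓘(ℝ, Euc k) (𝓡 r) (F p.1) p.2 := by
  have hcomp := mfderiv_comp p hF ((contMDiff_snd_sheets p).mdifferentiableAt (by simp))
  rw [← (eventuallyEq_comp_snd_sheets F p).mfderiv_eq] at hcomp
  refine hcomp.trans ?_
  exact congrArg (fun A : Euc k →L[ℝ] Euc k =>
    (mfderiv 𝓘(ℝ, Euc k) (𝓡 r) (F p.1) p.2 : Euc k →L[ℝ] Euc r).comp A) (mfderiv_snd_sheets p)

end DiscreteUnion

section TangentSpaces

variable {m : ℕ} {E : Type*} [NormedAddCommGroup E] [NormedSpace ℝ E]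
  {M : Type*} [TopologicalSpace M] [ChartedSpace (Euc m) M] {S : Set M}

lemma mfderiv_mem_tangentTo {g : E → M} {e : E} (hg : ContMDiffAt 𝓘(ℝ, E) (𝓡 m) ∞ g e)
    (hS : ∀ᶠ w in 𝓝 e, g w ∈ S) (v : E) :
    mfderiv 𝓘(ℝ, E) (𝓡 m) g e v ∈ tangentTo m S (g e) := by
  let l : ℝ → E := fun t => e + t • v
  have hl0 : l 0 = e := by simp [l]
  have hl : ContDiff ℝ ∞ l := contDiff_const.add (contDiff_id.smul contDiff_const)
  have hl' : HasFDerivAt l (ContinuousLinearMap.toSpanSingleton ℝ v) 0 := by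
    have hderiv : HasDerivAt l ((1 : ℝ) • v) 0 :=
      ((hasDerivAt_id (0 : ℝ)).smul_const v).const_add e
    rw [one_smul] at hderiv
    exact hderiv.hasFDerivAt
  rw [← hl0] at hg hS
  have hgl : HasMFDerivAt 𝓘(ℝ, ℝ) (𝓡 m) (g ∘ l) 0
      (ContinuousLinearMap.toSpanSingleton ℝ (mfderiv 𝓘(ℝ, E) (𝓡 m) g (l 0) v)) := by
    have htoSpan (A : E →L[ℝ] Euc m) : A.comp (ContinuousLinearMap.toSpanSingleton ℝ v) =
        ContinuousLinearMap.toSpanSingleton ℝ (A v) := A.comp_toSpanSingleton v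
    have hcomp := (hg.mdifferentiableAt (by simp)).hasMFDerivAt.comp (0 : ℝ) hl'.hasMFDerivAt
    exact Eq.mp (congrArg (fun A : ℝ →L[ℝ] Euc m => HasMFDerivAt 𝓘(ℝ, ℝ) (𝓡 m) (g ∘ l) 0 A)
      (htoSpan (mfderiv 𝓘(ℝ, E) (𝓡 m) g (l 0)))) hcomp
  have hmem : mfderiv 𝓘(ℝ, E) (𝓡 m) g (l 0) v ∈ tangentTo m S (g (l 0)) :=
    Submodule.subset_span ⟨g ∘ l, rfl, hg.comp 0 hl.contMDiff.contMDiffAt,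
      hl.continuous.continuousAt.eventually hS, hgl⟩
  rwa [hl0] at hmem

variable {φ : OpenPartialHomeomorph M (Euc m)} {W : Submodule ℝ (Euc m)} {x : M}

lemma tangentTo_le_comap (hφ : φ ∈ IsManifold.maximalAtlas (𝓡 m) ∞ M)
    (hW : ∀ y ∈ φ.source, y ∈ S ↔ φ y ∈ W) (hx : x ∈ φ.source) (hxS : x ∈ S) :
    tangentTo m S x ≤ W.comap (mfderiv (𝓡 m) 𝓘(ℝ, Euc m) φ x).toLinearMap := by
  refine Submodule.span_le.mpr ?_
  rintro v ⟨γ, rfl, hγ, hγS, hγv⟩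
  have hd : fderiv ℝ (φ ∘ γ) 0 1 = mfderiv (𝓡 m) 𝓘(ℝ, Euc m) φ (γ 0) v := by
    rw [fderiv_chart_comp hφ hγv.mdifferentiableAt hx, hγv.mfderiv]
    exact congrArg (mfderiv (𝓡 m) 𝓘(ℝ, Euc m) φ (γ 0)) (one_smul ℝ v)
  have hderiv : HasDerivAt (φ ∘ γ) (fderiv ℝ (φ ∘ γ) 0 1) 0 :=
    ((contDiffAt_chart_comp hφ hγ hx).differentiableAt (by simp)).hasFDerivAt.hasDerivAt
  have hslope : ∀ᶠ t in 𝓝[≠] (0 : ℝ), slope (φ ∘ γ) 0 t ∈ (W : Set (Euc m)) := by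
    have hsource : ∀ᶠ t in 𝓝 (0 : ℝ), γ t ∈ φ.source :=
      hγ.continuousAt.eventually (φ.open_source.eventually_mem hx)
    filter_upwards [nhdsWithin_le_nhds hsource, nhdsWithin_le_nhds hγS] with t ht htS
    exact W.smul_mem _ (W.sub_mem ((hW _ ht).mp htS) ((hW _ hx).mp hxS))
  have hlim := (Submodule.closed_of_finiteDimensional W).mem_of_tendsto hderiv.tendsto_slope hslope
  rw [hd] at hlim
  exact hlim

lemma comap_le_tangentTo (hφ : φ ∈ IsManifold.maximalAtlas (𝓡 m) ∞ M)
    (hW : ∀ y ∈ φ.source, y ∈ S ↔ φ y ∈ W) (hx : x ∈ φ.source) (hxS : x ∈ S) :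
    W.comap (mfderiv (𝓡 m) 𝓘(ℝ, Euc m) φ x).toLinearMap ≤ tangentTo m S x := by
  intro v hv
  obtain ⟨e, he, rfl⟩ : ∃ e ∈ φ.target, φ.symm e = x := ⟨φ x, φ.map_source hx, φ.left_inv hx⟩
  have heW : e ∈ W := by
    rw [← φ.right_inv he]
    exact (hW _ hx).mp hxS
  let a : W := ⟨e, heW⟩
  let w : W := ⟨_, hv⟩
  let g : W → M := fun b => φ.symm b
  have hg : ContMDiffAt 𝓘(ℝ, W) (𝓡 m) ∞ g a :=
    ContMDiffAt.comp (g := φ.symm) (f := (Subtype.val : W → Euc m)) a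
      (contMDiffAt_symm_of_mem_maximalAtlas hφ he) W.subtypeL.contDiff.contMDiff.contMDiffAt
  have htarget : ∀ᶠ b : W in 𝓝 a, (b : Euc m) ∈ φ.target :=
    continuous_subtype_val.continuousAt.eventually (φ.open_target.eventually_mem he)
  have hgS : ∀ᶠ b in 𝓝 a, g b ∈ S := by
    filter_upwards [htarget] with b hb
    rw [hW _ (φ.map_target hb), φ.right_inv hb]
    exact b.2
  have hφg : φ ∘ g =ᶠ[𝓝 a] W.subtypeL := by
    filter_upwards [htarget] with b hb using φ.right_inv hb
  have hderiv := fderiv_chart_comp hφ (hg.mdifferentiableAt (by simp)) hx w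
  rw [hφg.fderiv_eq, ContinuousLinearMap.fderiv] at hderiv
  have hgw : (mfderiv 𝓘(ℝ, W) (𝓡 m) g a w : Euc m) = v :=
    (mdifferentiable_of_mem_maximalAtlas hφ).mfderiv_injective hx hderiv.symm
  exact hgw ▸ mfderiv_mem_tangentTo hg hgS w

lemma tangentTo_eq_comap (hφ : φ ∈ IsManifold.maximalAtlas (𝓡 m) ∞ M)
    (hW : ∀ y ∈ φ.source, y ∈ S ↔ φ y ∈ W) (hx : x ∈ φ.source) (hxS : x ∈ S) :
    tangentTo m S x = W.comap (mfderiv (𝓡 m) 𝓘(ℝ, Euc m) φ x).toLinearMap :=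
  le_antisymm (tangentTo_le_comap hφ hW hx hxS) (comap_le_tangentTo hφ hW hx hxS)

lemma finrank_tangentTo (hφ : φ ∈ IsManifold.maximalAtlas (𝓡 m) ∞ M)
    (hW : ∀ y ∈ φ.source, y ∈ S ↔ φ y ∈ W) (hx : x ∈ φ.source) (hxS : x ∈ S) :
    Module.finrank ℝ (tangentTo m S x) = Module.finrank ℝ W := by
  rw [tangentTo_eq_comap hφ hW hx hxS]
  let T := ((mdifferentiable_of_mem_maximalAtlas hφ).mfderiv hx).toLinearEquiv
  have hT : W.comap (mfderiv (𝓡 m) 𝓘(ℝ, Euc m) φ x).toLinearMap =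
      W.map T.symm.toLinearMap := Submodule.comap_equiv_eq_map_symm T W
  rw [hT]
  exact LinearEquiv.finrank_map_eq T.symm W

end TangentSpaces

section Discs

variable {k r : ℕ} {Q : Type*} [TopologicalSpace Q] [ChartedSpace (Euc r) Q]
  {ηQ : ∀ q : Q, TangentSpace (𝓡 r) q →L[ℝ] ℝ}

/-- A Legendrian immersion of `ℝ^k`. -/
structure IsLegendrianDisc (ηQ : ∀ q : Q, TangentSpace (𝓡 r) q →L[ℝ] ℝ) (F : Euc k → Q) :
    Prop where
  contMDiff : ContMDiff 𝓘(ℝ, Euc k) (𝓡 r) ∞ F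
  injective : ∀ y, Function.Injective (mfderiv 𝓘(ℝ, Euc k) (𝓡 r) F y)
  eq_contactCompl : ∀ y, LinearMap.range (mfderiv 𝓘(ℝ, Euc k) (𝓡 r) F y).toLinearMap =
    contactCompl ηQ (F y) (LinearMap.range (mfderiv 𝓘(ℝ, Euc k) (𝓡 r) F y).toLinearMap)

lemma isImmersedLegendrian_of_discs [IsManifold (𝓡 r) ∞ Q] (hr : r = 2 * k + 1) {I : Type}
    [Countable I] {F : I → Euc k → Q} (hF : ∀ i, IsLegendrianDisc ηQ (F i)) :
    IsImmersedLegendrian ηQ (⋃ i, Set.range (F i)) := by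
  let _ : TopologicalSpace I := ⊥
  have : DiscreteTopology I := ⟨rfl⟩
  let := sheetChartedSpace k I
  have := isManifold_sheets (k := k) (I := I)
  have hderiv (p : I × Euc k) :
      (mfderiv (𝓡 k) (𝓡 r) (fun p : I × Euc k => F p.1 p.2) p : Euc k →L[ℝ] Euc r) =
        mfderiv 𝓘(ℝ, Euc k) (𝓡 r) (F p.1) p.2 :=
    mfderiv_sheets ((hF p.1).contMDiff.mdifferentiableAt (by simp))
  have himm : Manifold.IsImmersionOfComplement (Euc (k + 1)) (𝓡 k) (𝓡 r) ∞
      (fun p : I × Euc k => F p.1 p.2) := by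
    refine fun p => isImmersionAtOfComplement_of_mfderiv_injective
      (contMDiff_sheets fun i => (hF i).contMDiff) ?_ (by rw [finrank_euclideanSpace_fin]; omega)
    exact (congrArg (fun A : Euc k →L[ℝ] Euc r => Function.Injective A) (hderiv p)).mpr
      ((hF p.1).injective p.2)
  refine ⟨k, I × Euc k, inferInstance, inferInstance, hr, inferInstance, inferInstance,
    inferInstance, fun p => F p.1 p.2, himm.isImmersion, ?_, fun p => ?_⟩
  · ext q
    simp
  · have hrange : LinearMap.range
        (mfderiv (𝓡 k) (𝓡 r) (fun p : I × Euc k => F p.1 p.2) p).toLinearMap =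
          LinearMap.range (mfderiv 𝓘(ℝ, Euc k) (𝓡 r) (F p.1) p.2).toLinearMap :=
      congrArg (fun A : Euc k →L[ℝ] Euc r => LinearMap.range A.toLinearMap) (hderiv p)
    rw [hrange]
    exact (hF p.1).eq_contactCompl p.2

lemma dimH_image_chart_comp_le {F : Euc k → Q} (hF : ContMDiff 𝓘(ℝ, Euc k) (𝓡 r) ∞ F)
    {ψ : OpenPartialHomeomorph Q (Euc r)} (hψ : ψ ∈ IsManifold.maximalAtlas (𝓡 r) ∞ Q) :
    dimH ((ψ ∘ F) '' (F ⁻¹' ψ.source)) ≤ k :=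
  calc
    dimH ((ψ ∘ F) '' (F ⁻¹' ψ.source)) ≤ dimH (F ⁻¹' ψ.source) := by
      refine dimH_image_le_of_locally_lipschitzOn fun y hy => ?_
      obtain ⟨C, t, ht, hC⟩ := ((contDiffAt_chart_comp hψ (hF y) hy).of_le
        (by simp : (1 : WithTop ℕ∞) ≤ ∞)).exists_lipschitzOnWith
      exact ⟨C, t, mem_nhdsWithin_of_mem_nhds ht, hC⟩
    _ ≤ dimH (Set.univ : Set (Euc k)) := dimH_mono (Set.subset_univ _)
    _ = k := by simp [Real.dimH_univ_eq_finrank]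

lemma finrank_le_of_subset_discs {I : Type*} [Countable I] {F : I → Euc k → Q}
    (hF : ∀ i, ContMDiff 𝓘(ℝ, Euc k) (𝓡 r) ∞ (F i)) {ψ : OpenPartialHomeomorph Q (Euc r)}
    (hψ : ψ ∈ IsManifold.maximalAtlas (𝓡 r) ∞ Q) {W : Submodule ℝ (Euc r)} {a : Euc r}
    (ha : a ∈ ψ.target) (haW : a ∈ W)
    (hW : ∀ e ∈ ψ.target, e ∈ W → ψ.symm e ∈ ⋃ i, Set.range (F i)) :
    Module.finrank ℝ W ≤ k := by
  let s : Set W := Subtype.val ⁻¹' ψ.target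
  have hs : s ∈ 𝓝 (⟨a, haW⟩ : W) :=
    (ψ.open_target.preimage continuous_subtype_val).mem_nhds ha
  have hcover : (Subtype.val '' s : Set (Euc r)) ⊆ ⋃ i, (ψ ∘ F i) '' (F i ⁻¹' ψ.source) := by
    rintro _ ⟨e, he, rfl⟩
    obtain ⟨i, y, hy⟩ := Set.mem_iUnion.mp (hW _ he e.2)
    refine Set.mem_iUnion.mpr ⟨i, y, ?_, ?_⟩
    · rw [Set.mem_preimage, hy]
      exact ψ.map_target he
    · rw [Function.comp_apply, hy]
      exact ψ.right_inv he
  have hdim : (Module.finrank ℝ W : ENNReal) ≤ k :=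
    calc
      (Module.finrank ℝ W : ENNReal) = dimH (Subtype.val '' s : Set (Euc r)) := by
        rw [isometry_subtype_coe.dimH_image, Real.dimH_of_mem_nhds hs]
      _ ≤ dimH (⋃ i, (ψ ∘ F i) '' (F i ⁻¹' ψ.source)) := dimH_mono hcover
      _ ≤ k := by
        rw [dimH_iUnion]
        exact iSup_le fun i => dimH_image_chart_comp_le (hF i) hψ
  exact_mod_cast hdim

lemma isLegendrian_of_discs {I : Type*} [Countable I] {F : I → Euc k → Q}
    (hF : ∀ i, IsLegendrianDisc ηQ (F i)) (hS : IsSubmanifold r (⋃ i, Set.range (F i))) :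
    IsLegendrian ηQ (⋃ i, Set.range (F i)) := by
  refine ⟨hS, fun q hq => ?_⟩
  obtain ⟨ψ, hψ, hqψ, W, hW⟩ := hS q hq
  have hdim : Module.finrank ℝ (tangentTo r (⋃ i, Set.range (F i)) q) ≤ k := by
    rw [finrank_tangentTo hψ hW hqψ hq]
    exact finrank_le_of_subset_discs (fun i => (hF i).contMDiff) hψ (ψ.map_source hqψ)
      ((hW q hqψ).mp hq) fun e he heW =>
        (hW _ (ψ.map_target he)).mpr (by rwa [ψ.right_inv he])
  obtain ⟨i, y, rfl⟩ := Set.mem_iUnion.mp hq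
  have hle : LinearMap.range (mfderiv 𝓘(ℝ, Euc k) (𝓡 r) (F i) y).toLinearMap ≤
      tangentTo r (⋃ i, Set.range (F i)) (F i y) := by
    rintro _ ⟨v, rfl⟩
    exact mfderiv_mem_tangentTo ((hF i).contMDiff y)
      (Filter.Eventually.of_forall fun w => Set.mem_iUnion_of_mem i (Set.mem_range_self w)) v
  have hrank : Module.finrank ℝ
      (LinearMap.range (mfderiv 𝓘(ℝ, Euc k) (𝓡 r) (F i) y).toLinearMap) = k := by
    rw [LinearMap.finrank_range_of_inj ((hF i).injective y)]
    exact finrank_euclideanSpace_fin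
  rw [← Submodule.eq_of_le_of_finrank_le hle (hdim.trans hrank.ge)]
  exact (hF i).eq_contactCompl y

end Discs

section CleanIntersections

variable {m d : ℕ}
  {M : Type*} [TopologicalSpace M] {N : Type*} {ι : N → M} {S L : Set M}
  {φ : OpenPartialHomeomorph M (Euc m)} {W : Submodule ℝ (Euc m)} {g : W → N} {w : W}

lemma eventually_coe_mem_target (hw : (w : Euc m) ∈ φ.target) :
    ∀ᶠ w' : W in 𝓝 w, (w' : Euc m) ∈ φ.target :=
  continuous_subtype_val.continuousAt.eventually (φ.open_target.eventually_mem hw)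

variable [ChartedSpace (Euc m) M]

/-- The parametrization `g` of the subset `ι ⁻¹' S` of `N` by a chart `φ` of `M` in which `S` is
the linear slice `W`. It is only meaningful on the open set of those `w : W` that lie in the target
of `φ`. -/
structure IsSliceLift (ι : N → M) (S : Set M) (φ : OpenPartialHomeomorph M (Euc m))
    (W : Submodule ℝ (Euc m)) (g : W → N) : Prop where
  mem_maximalAtlas : φ ∈ IsManifold.maximalAtlas (𝓡 m) ∞ M
  mem_iff : ∀ y ∈ φ.source, y ∈ S ↔ φ y ∈ W
  apply_eq : ∀ w : W, (w : Euc m) ∈ φ.target → ι (g w) = φ.symm w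

namespace IsSliceLift

lemma mem_source (h : IsSliceLift ι S φ W g) (hw : (w : Euc m) ∈ φ.target) :
    ι (g w) ∈ φ.source := by
  rw [h.apply_eq w hw]
  exact φ.map_target hw

lemma chart_apply (h : IsSliceLift ι S φ W g) (hw : (w : Euc m) ∈ φ.target) :
    φ (ι (g w)) = w := by
  rw [h.apply_eq w hw, φ.right_inv hw]

lemma mem (h : IsSliceLift ι S φ W g) (hw : (w : Euc m) ∈ φ.target) : ι (g w) ∈ S := by
  rw [h.mem_iff _ (h.mem_source hw), h.chart_apply hw]
  exact w.2

lemma contMDiffAt_comp (h : IsSliceLift ι S φ W g) (hw : (w : Euc m) ∈ φ.target) :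
    ContMDiffAt 𝓘(ℝ, W) (𝓡 m) ∞ (ι ∘ g) w := by
  refine (ContMDiffAt.comp (g := φ.symm) (f := (Subtype.val : W → Euc m)) w
    (contMDiffAt_symm_of_mem_maximalAtlas h.mem_maximalAtlas hw)
    W.subtypeL.contDiff.contMDiff.contMDiffAt).congr_of_eventuallyEq ?_
  filter_upwards [eventually_coe_mem_target hw] with w' hw' using h.apply_eq w' hw'

lemma exists_isOpen_inter_preimage_eq_image [TopologicalSpace N] (h : IsSliceLift ι S φ W g)
    (hι : Topology.IsEmbedding ι) {O : Set W} (hO : IsOpen O)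
    (hOφ : ∀ w ∈ O, (w : Euc m) ∈ φ.target) {x : N} (hx : ι x ∈ φ.source)
    (hxO : ∃ w ∈ O, φ (ι x) = w) :
    ∃ V : Set N, IsOpen V ∧ x ∈ V ∧ V ∩ ι ⁻¹' S = g '' O := by
  obtain ⟨O, hO', rfl⟩ := isOpen_induced_iff.mp hO
  obtain ⟨w, hwO, hwx⟩ := hxO
  refine ⟨ι ⁻¹' (φ.source ∩ φ ⁻¹' O), (φ.isOpen_inter_preimage hO').preimage hι.continuous,
    ⟨hx, by rwa [Set.mem_preimage, hwx]⟩, ?_⟩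
  ext n
  constructor
  · rintro ⟨⟨hn, hnO⟩, hnS⟩
    refine ⟨⟨φ (ι n), (h.mem_iff _ hn).mp hnS⟩, hnO, hι.injective ?_⟩
    rw [h.apply_eq _ (φ.map_source hn)]
    exact φ.left_inv hn
  · rintro ⟨w, hw, rfl⟩
    refine ⟨⟨h.mem_source (hOφ w hw), ?_⟩, h.mem (hOφ w hw)⟩
    rw [Set.mem_preimage, h.chart_apply (hOφ w hw)]
    exact hw

end IsSliceLift

lemma IsSubmanifold.exists_isSliceLift (hS : IsSubmanifold m S) (hSι : S ⊆ Set.range ι) {x : N}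
    (hx : ι x ∈ S) : ∃ (φ : OpenPartialHomeomorph M (Euc m)) (W : Submodule ℝ (Euc m)) (g : W → N),
      IsSliceLift ι S φ W g ∧ ι x ∈ φ.source := by
  obtain ⟨φ, hφ, hxφ, W, hW⟩ := hS (ι x) hx
  have hpre (w : W) (hw : (w : Euc m) ∈ φ.target) : ∃ n, ι n = φ.symm w := by
    refine hSι ((hW _ (φ.map_target hw)).mpr ?_)
    rw [φ.right_inv hw]
    exact w.2
  have : Nonempty N := ⟨x⟩
  choose! g hg using hpre
  exact ⟨φ, W, g, ⟨hφ, hW, hg⟩, hxφ⟩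

variable [TopologicalSpace N] [ChartedSpace (Euc d) N]

namespace IsSliceLift

lemma contMDiffAt (h : IsSliceLift ι S φ W g) (hι : Manifold.IsSmoothEmbedding (𝓡 d) (𝓡 m) ∞ ι)
    (hw : (w : Euc m) ∈ φ.target) : ContMDiffAt 𝓘(ℝ, W) (𝓡 d) ∞ g w :=
  (ContMDiffAt.iff_comp_isImmersionAt (hι.isImmersion.isImmersionAt (g w))).mpr
    ⟨hι.isEmbedding.isInducing.continuousAt_iff.mpr (h.contMDiffAt_comp hw).continuousAt,
      h.contMDiffAt_comp hw⟩

lemma mfderiv_chart_apply (h : IsSliceLift ι S φ W g)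
    (hι : Manifold.IsSmoothEmbedding (𝓡 d) (𝓡 m) ∞ ι) (hw : (w : Euc m) ∈ φ.target) (v : W) :
    (mfderiv (𝓡 m) 𝓘(ℝ, Euc m) φ (ι (g w))
      (mfderiv (𝓡 d) (𝓡 m) ι (g w) (mfderiv 𝓘(ℝ, W) (𝓡 d) g w v)) : Euc m) = W.subtypeL v := by
  have hφιg : φ ∘ (ι ∘ g) =ᶠ[𝓝 w] W.subtypeL := by
    filter_upwards [eventually_coe_mem_target hw] with w' hw' using h.chart_apply hw'
  have hderiv := fderiv_chart_comp h.mem_maximalAtlas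
    ((h.contMDiffAt_comp hw).mdifferentiableAt (by simp)) (h.mem_source hw) v
  rw [hφιg.fderiv_eq, ContinuousLinearMap.fderiv] at hderiv
  exact (congrArg (mfderiv (𝓡 m) 𝓘(ℝ, Euc m) φ (ι (g w))) (mfderiv_comp_apply_of_contMDiffAt
    hι.contMDiff.contMDiffAt (h.contMDiffAt hι hw) v).symm).trans hderiv.symm

lemma range_mfderiv (h : IsSliceLift ι S φ W g)
    (hι : Manifold.IsSmoothEmbedding (𝓡 d) (𝓡 m) ∞ ι) (hw : (w : Euc m) ∈ φ.target) :
    LinearMap.range (mfderiv 𝓘(ℝ, W) (𝓡 d) g w).toLinearMap =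
      (tangentTo m S (ι (g w))).comap (mfderiv (𝓡 d) (𝓡 m) ι (g w)).toLinearMap := by
  rw [tangentTo_eq_comap h.mem_maximalAtlas h.mem_iff (h.mem_source hw) (h.mem hw)]
  apply le_antisymm
  · rintro _ ⟨v, rfl⟩
    exact (congrArg (· ∈ W) (h.mfderiv_chart_apply hι hw v)).mpr (Subtype.property (v : W))
  · intro u hu
    refine ⟨(⟨_, hu⟩ : W), ?_⟩
    apply mfderiv_injective_of_isImmersionAt (hι.isImmersion.isImmersionAt (g w))
    exact (mdifferentiable_of_mem_maximalAtlas h.mem_maximalAtlas).mfderiv_injective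
      (h.mem_source hw) (h.mfderiv_chart_apply hι hw ⟨_, hu⟩)

end IsSliceLift

lemma CleanIntersection.comap_tangentTo (h : CleanIntersection m (d := d) ι L) {x : N}
    (hx : ι x ∈ L) :
    (tangentTo m (Set.range ι ∩ L) (ι x)).comap (mfderiv (𝓡 d) (𝓡 m) ι x).toLinearMap =
      (tangentTo m L (ι x)).comap (mfderiv (𝓡 d) (𝓡 m) ι x).toLinearMap := by
  rw [h.2 x hx]
  ext u
  exact ⟨fun hu => hu.2, fun hu => ⟨⟨u, rfl⟩, hu⟩⟩

end CleanIntersections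

section ReducedLegendrian

variable {k m d r : ℕ}
  {Q : Type*} [TopologicalSpace Q] [ChartedSpace (Euc r) Q]
  {ηQ : ∀ q : Q, TangentSpace (𝓡 r) q →L[ℝ] ℝ}
  {E : Type*} [NormedAddCommGroup E] [NormedSpace ℝ E] {G : E → Q} {U : Set E} {e : E}

lemma finrank_range_fderiv_chart_comp {ψ : OpenPartialHomeomorph Q (Euc r)}
    (hψ : ψ ∈ IsManifold.maximalAtlas (𝓡 r) ∞ Q) (hG : MDifferentiableAt 𝓘(ℝ, E) (𝓡 r) G e)
    (he : G e ∈ ψ.source) :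
    Module.finrank ℝ (LinearMap.range (fderiv ℝ (ψ ∘ G) e).toLinearMap) =
      Module.finrank ℝ (LinearMap.range (mfderiv 𝓘(ℝ, E) (𝓡 r) G e).toLinearMap) := by
  let T := ((mdifferentiable_of_mem_maximalAtlas hψ).mfderiv he).toLinearEquiv
  have hcomp : (fderiv ℝ (ψ ∘ G) e).toLinearMap =
      T.toLinearMap ∘ₗ (mfderiv 𝓘(ℝ, E) (𝓡 r) G e).toLinearMap :=
    LinearMap.ext (fderiv_chart_comp hψ hG he)
  have hrange : LinearMap.range (fderiv ℝ (ψ ∘ G) e).toLinearMap =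
      (LinearMap.range (mfderiv 𝓘(ℝ, E) (𝓡 r) G e).toLinearMap).map T.toLinearMap :=
    (congrArg LinearMap.range hcomp).trans (LinearMap.range_comp _ _)
  rw [hrange]
  exact LinearEquiv.finrank_map_eq T _

variable [FiniteDimensional ℝ E] [IsManifold (𝓡 r) ∞ Q]

lemma exists_immersed_transversal_of_constant_rank (hU : IsOpen U)
    (hG : ∀ e ∈ U, ContMDiffAt 𝓘(ℝ, E) (𝓡 r) ∞ G e)
    (hrank : ∀ e ∈ U,
      Module.finrank ℝ (LinearMap.range (mfderiv 𝓘(ℝ, E) (𝓡 r) G e).toLinearMap) = k)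
    (he : e ∈ U) :
    ∃ (O : Set E) (s : Euc k → E), IsOpen O ∧ e ∈ O ∧ O ⊆ U ∧ ContDiff ℝ ∞ s ∧
      (∀ y, s y ∈ O) ∧ Set.range (G ∘ s) = G '' O ∧
      ∀ y, Function.Injective (mfderiv 𝓘(ℝ, Euc k) (𝓡 r) (G ∘ s) y) := by
  let ψ := chartAt (Euc r) (G e)
  have hψ : ψ ∈ IsManifold.maximalAtlas (𝓡 r) ∞ Q := IsManifold.chart_mem_maximalAtlas (G e)
  have hUψ : IsOpen (U ∩ G ⁻¹' ψ.source) := ContinuousOn.isOpen_inter_preimage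
    (fun e he => (hG e he).continuousAt.continuousWithinAt) hU ψ.open_source
  obtain ⟨O, s, hO, heO, hOU, hs, hsO, hrange, hinj⟩ := exists_transversal_of_constant_rank hUψ
    (fun e he => (contDiffAt_chart_comp hψ (hG e he.1) he.2).contDiffWithinAt)
    (fun e he => (finrank_range_fderiv_chart_comp hψ ((hG e he.1).mdifferentiableAt (by simp))
      he.2).trans (hrank e he.1)) (⟨he, mem_chart_source _ _⟩ : e ∈ U ∩ G ⁻¹' ψ.source)
  refine ⟨O, s, hO, heO, fun e he => (hOU he).1, hs, hsO, ?_, fun y u v huv => ?_⟩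
  · refine (Set.range_subset_iff.mpr fun y => Set.mem_image_of_mem G (hsO y)).antisymm ?_
    rintro _ ⟨w, hw, rfl⟩
    obtain ⟨y, hy⟩ : (ψ ∘ G) w ∈ Set.range ((ψ ∘ G) ∘ s) := hrange ▸ Set.mem_image_of_mem _ hw
    exact ⟨y, ψ.injOn (hOU (hsO y)).2 (hOU hw).2 hy⟩
  · have hGs : MDifferentiableAt 𝓘(ℝ, Euc k) (𝓡 r) (G ∘ s) y :=
      ((hG _ (hOU (hsO y)).1).comp y hs.contMDiff.contMDiffAt).mdifferentiableAt (by simp)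
    have hderiv := fderiv_chart_comp hψ hGs (hOU (hsO y)).2
    exact hinj y ((hderiv u).trans ((congrArg (mfderiv (𝓡 r) 𝓘(ℝ, Euc r) ψ (G (s y))) huv).trans
      (hderiv v).symm))

lemma exists_legendrianDisc_of_range_eq_contactCompl
    (hηQ : ∀ q, IsContactPair (ηQ q).toLinearMap (extD ηQ q)) (hr : r = 2 * k + 1) (hU : IsOpen U)
    (hG : ∀ e ∈ U, ContMDiffAt 𝓘(ℝ, E) (𝓡 r) ∞ G e)
    (hrange : ∀ e ∈ U, LinearMap.range (mfderiv 𝓘(ℝ, E) (𝓡 r) G e).toLinearMap =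
      contactCompl ηQ (G e) (LinearMap.range (mfderiv 𝓘(ℝ, E) (𝓡 r) G e).toLinearMap))
    (he : e ∈ U) :
    ∃ (O : Set E) (F : Euc k → Q), IsOpen O ∧ e ∈ O ∧ O ⊆ U ∧ Set.range F = G '' O ∧
      IsLegendrianDisc ηQ F := by
  have hrank (e) (he : e ∈ U) :
      Module.finrank ℝ (LinearMap.range (mfderiv 𝓘(ℝ, E) (𝓡 r) G e).toLinearMap) = k := by
    have hdim := (hηQ (G e)).finrank_of_eq_complement (hrange e he)
    rw [finrank_tangentSpace] at hdim
    omega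
  obtain ⟨O, s, hO, heO, hOU, hs, hsO, himage, hinj⟩ :=
    exists_immersed_transversal_of_constant_rank hU hG hrank he
  refine ⟨O, G ∘ s, hO, heO, hOU, himage,
    fun y => (hG _ (hOU (hsO y))).comp y hs.contMDiff.contMDiffAt, hinj, fun y => ?_⟩
  have hsU : s y ∈ U := hOU (hsO y)
  have hle : LinearMap.range (mfderiv 𝓘(ℝ, Euc k) (𝓡 r) (G ∘ s) y).toLinearMap ≤
      LinearMap.range (mfderiv 𝓘(ℝ, E) (𝓡 r) G (s y)).toLinearMap := by
    rw [mfderiv_comp y ((hG _ hsU).mdifferentiableAt (by simp))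
      (hs.contMDiff.contMDiffAt.mdifferentiableAt (by simp))]
    exact LinearMap.range_comp_le_range _ _
  have hfinrank : Module.finrank ℝ
      (LinearMap.range (mfderiv 𝓘(ℝ, Euc k) (𝓡 r) (G ∘ s) y).toLinearMap) = k := by
    rw [LinearMap.finrank_range_of_inj (hinj y)]
    exact finrank_euclideanSpace_fin
  rw [Submodule.eq_of_le_of_finrank_le hle ((hrank _ hsU).trans hfinrank.symm).le]
  exact hrange _ hsU

namespace IsContactReduction

variable {M : Type*} [TopologicalSpace M] [ChartedSpace (Euc m) M] [IsManifold (𝓡 m) ∞ M]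
  {N : Type*} [TopologicalSpace N] [ChartedSpace (Euc d) N] [IsManifold (𝓡 d) ∞ N]
  {η : ∀ x : M, TangentSpace (𝓡 m) x →L[ℝ] ℝ} {ι : N → M} {π : N → Q} {L : Set M} {f : N → ℝ}

lemma range_mfderiv_projection_comp_eq_contactCompl
    (h : IsContactReduction (d := d) (r := r) η ι π)
    (hQ : IsReducedForm (d := d) η ι π f ηQ) (hL : IsLegendrian η L)
    (hNL : CleanIntersection m (d := d) ι L) {φ : OpenPartialHomeomorph M (Euc m)}
    {W : Submodule ℝ (Euc m)} {g : W → N} (hg : IsSliceLift ι (Set.range ι ∩ L) φ W g) {w : W}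
    (hw : (w : Euc m) ∈ φ.target) :
    LinearMap.range (mfderiv 𝓘(ℝ, W) (𝓡 r) (π ∘ g) w).toLinearMap =
      contactCompl ηQ (π (g w))
        (LinearMap.range (mfderiv 𝓘(ℝ, W) (𝓡 r) (π ∘ g) w).toLinearMap) := by
  have hι := h.coisotropic.1
  have hrange : LinearMap.range (mfderiv 𝓘(ℝ, W) (𝓡 r) (π ∘ g) w).toLinearMap =
      ((tangentTo m L (ι (g w))).comap (mfderiv (𝓡 d) (𝓡 m) ι (g w)).toLinearMap).map
        (mfderiv (𝓡 d) (𝓡 r) π (g w)).toLinearMap := by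
    rw [← hNL.comap_tangentTo (hg.mem hw).2, ← hg.range_mfderiv hι hw, ← LinearMap.range_comp,
      mfderiv_comp w ((h.contMDiff_projection _).mdifferentiableAt (by simp))
        ((hg.contMDiffAt hι hw).mdifferentiableAt (by simp))]
    rfl
  rw [hrange]
  exact (h.isLinearReduction hQ (g w)).map_comap_eq_complement (hL.2 _ (hg.mem hw).2)

lemma exists_legendrianDisc (h : IsContactReduction (d := d) (r := r) η ι π)
    (hQ : IsReducedForm (d := d) η ι π f ηQ) (hL : IsLegendrian η L)
    (hNL : CleanIntersection m (d := d) ι L) (hr : r = 2 * k + 1) {x : N} (hx : ι x ∈ L) :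
    ∃ (V : Set N) (F : Euc k → Q), IsOpen V ∧ x ∈ V ∧ Set.range F = π '' (V ∩ ι ⁻¹' L) ∧
      IsLegendrianDisc ηQ F := by
  have hι := h.coisotropic.1
  have hxL : ι x ∈ Set.range ι ∩ L := ⟨⟨x, rfl⟩, hx⟩
  obtain ⟨φ, W, g, hg, hxφ⟩ := hNL.1.exists_isSliceLift Set.inter_subset_left hxL
  let w₀ : W := ⟨φ (ι x), (hg.mem_iff _ hxφ).mp hxL⟩
  obtain ⟨O, F, hO, hw₀O, hOφ, hF, hdisc⟩ := exists_legendrianDisc_of_range_eq_contactCompl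
    (h.isContactPair_reduced hQ) hr (φ.open_target.preimage continuous_subtype_val)
    (fun w hw => (h.contMDiff_projection _).comp w (hg.contMDiffAt hι hw))
    (fun w (hw : (w : Euc m) ∈ φ.target) =>
      h.range_mfderiv_projection_comp_eq_contactCompl hQ hL hNL hg hw)
    (show w₀ ∈ Subtype.val ⁻¹' φ.target from φ.map_source hxφ)
  obtain ⟨V, hV, hxV, hVL⟩ := hg.exists_isOpen_inter_preimage_eq_image hι.isEmbedding hO
    (fun w hw => hOφ hw) hxφ ⟨w₀, hw₀O, rfl⟩
  rw [Set.preimage_range_inter] at hVL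
  exact ⟨V, F, hV, hxV, by rw [hF, hVL, ← Set.image_comp], hdisc⟩

lemma exists_legendrianDiscs [SecondCountableTopology M]
    (h : IsContactReduction (d := d) (r := r) η ι π)
    (hQ : IsReducedForm (d := d) η ι π f ηQ) (hL : IsLegendrian η L)
    (hNL : CleanIntersection m (d := d) ι L) (hr : r = 2 * k + 1) :
    ∃ (I : Type) (_ : Countable I) (F : I → Euc k → Q),
      (∀ i, IsLegendrianDisc ηQ (F i)) ∧ ⋃ i, Set.range (F i) = π '' (ι ⁻¹' L) := by
  have : SecondCountableTopology N := h.coisotropic.1.isEmbedding.secondCountableTopology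
  choose V F hVo hxV hrange hF using fun x : ι ⁻¹' L =>
    h.exists_legendrianDisc hQ hL hNL hr (x := x) x.2
  obtain ⟨t, ht, hcover⟩ := TopologicalSpace.isOpen_iUnion_countable V hVo
  have : Countable t := ht.to_subtype
  have hunion : ⋃ i : t, Set.range (F i) = π '' (ι ⁻¹' L) := by
    have hsub : ι ⁻¹' L ⊆ ⋃ i : t, V i := by
      rw [Set.iUnion_coe_set, hcover]
      exact fun x hx => Set.mem_iUnion_of_mem ⟨x, hx⟩ (hxV ⟨x, hx⟩)
    simp only [hrange, ← Set.image_iUnion, ← Set.iUnion_inter, Set.inter_eq_right.mpr hsub]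
  refine ⟨Shrink.{0} t, (equivShrink.{0} t).symm.injective.countable,
    fun i => F ((equivShrink.{0} t).symm i), fun i => hF _, ?_⟩
  rw [← hunion]
  exact (equivShrink.{0} t).symm.surjective.iUnion_comp fun i => Set.range (F i)

end IsContactReduction

end ReducedLegendrian

end ContactReduction

end

open ContactReduction in
theorem mainTheorem4_general {m d r : ℕ}
    {M : Type*} [TopologicalSpace M] [SecondCountableTopology M] [ChartedSpace (Euc m) M]
    [IsManifold (𝓡 m) ∞ M]
    {N : Type*} [TopologicalSpace N] [Nonempty N] [ChartedSpace (Euc d) N] [IsManifold (𝓡 d) ∞ N]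
    {Q : Type*} [TopologicalSpace Q] [T2Space Q] [SecondCountableTopology Q]
    [ChartedSpace (Euc r) Q] [IsManifold (𝓡 r) ∞ Q]
    {η : ∀ x : M, TangentSpace (𝓡 m) x →L[ℝ] ℝ} {ι : N → M} {π : N → Q}
    (h : IsContactReduction (d := d) (r := r) η ι π) {L : Set M} (hL : IsLegendrian η L)
    (hNL : CleanIntersection m (d := d) ι L) :
    (∃ (f : N → ℝ) (ηQ : ∀ q : Q, TangentSpace (𝓡 r) q →L[ℝ] ℝ),
      IsReducedForm (d := d) η ι π f ηQ) ∧
    ((∀ x : N, IsVertical η (ι x) (tangentOf (d := d) ι x)) →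
      ∃! ηQ : ∀ q : Q, TangentSpace (𝓡 r) q →L[ℝ] ℝ,
        IsReducedForm (d := d) η ι π (fun _ => 1) ηQ) ∧
    ∀ (f : N → ℝ) (ηQ : ∀ q : Q, TangentSpace (𝓡 r) q →L[ℝ] ℝ),
      IsReducedForm (d := d) η ι π f ηQ →
        IsContactForm ηQ ∧
        IsImmersedLegendrian ηQ (π '' (ι ⁻¹' L)) ∧
        (IsSubmanifold r (π '' (ι ⁻¹' L)) → IsLegendrian ηQ (π '' (ι ⁻¹' L))) := by
  refine ⟨h.exists_reduced, h.existsUnique_reduced_of_isVertical, fun f ηQ hQ => ?_⟩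
  have hcontact := h.isContactForm_reduced hQ
  obtain ⟨-, k, hr, -⟩ := id hcontact
  obtain ⟨I, _, F, hF, hrange⟩ := h.exists_legendrianDiscs hQ hL hNL hr
  rw [← hrange]
  exact ⟨hcontact, isImmersedLegendrian_of_discs hr hF, isLegendrian_of_discs hF⟩

theorem mainTheorem4 {m d r : ℕ}
    {M : Type*} [TopologicalSpace M] [T2Space M] [SecondCountableTopology M]
    [ChartedSpace (ContactReduction.Euc m) M] [IsManifold (𝓡 m) ∞ M]
    {N : Type*} [TopologicalSpace N] [Nonempty N]
    [ChartedSpace (ContactReduction.Euc d) N] [IsManifold (𝓡 d) ∞ N]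
    {Q : Type*} [TopologicalSpace Q] [T2Space Q] [SecondCountableTopology Q]
    [ChartedSpace (ContactReduction.Euc r) Q] [IsManifold (𝓡 r) ∞ Q]
    (η : ∀ x : M, TangentSpace (𝓡 m) x →L[ℝ] ℝ)
    (hη : ContactReduction.IsContactForm η)
    (ι : N → M) (hN : ContactReduction.IsCoisotropic (d := d) η ι)
    (hhor : ∀ x : N, ¬ ContactReduction.IsHorizontal η (ι x)
      (ContactReduction.tangentOf (d := d) ι x))
    (π : N → Q)
    (hπ : ContactReduction.IsLeafQuotient (d := d) (r := r)
      (ContactReduction.charDistribution η ι) π)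
    (L : Set M) (hL : ContactReduction.IsLegendrian η L)
    (hNL : ContactReduction.CleanIntersection m (d := d) ι L) :
    (∃ (f : N → ℝ) (ηQ : ∀ q : Q, TangentSpace (𝓡 r) q →L[ℝ] ℝ),
      ContactReduction.IsReducedForm (d := d) η ι π f ηQ) ∧
    ((∀ x : N, ContactReduction.IsVertical η (ι x) (ContactReduction.tangentOf (d := d) ι x)) →
      ∃! ηQ : ∀ q : Q, TangentSpace (𝓡 r) q →L[ℝ] ℝ,
        ContactReduction.IsReducedForm (d := d) η ι π (fun _ => 1) ηQ) ∧
    ∀ (f : N → ℝ) (ηQ : ∀ q : Q, TangentSpace (𝓡 r) q →L[ℝ] ℝ),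
      ContactReduction.IsReducedForm (d := d) η ι π f ηQ →
        ContactReduction.IsContactForm ηQ ∧
        ContactReduction.IsImmersedLegendrian ηQ (π '' (ι ⁻¹' L)) ∧
        (ContactReduction.IsSubmanifold r (π '' (ι ⁻¹' L)) →
          ContactReduction.IsLegendrian ηQ (π '' (ι ⁻¹' L))) :=
  mainTheorem4_general ⟨hη, hN, hhor, hπ⟩ hL hNL
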